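/- Let $p,q\ge 0$ be integers with $p+q\ge 1$. Let $C_p$ be the Clifford algebra of the positive definite quadratic form $v_1^2+\dots+v_p^2$ on $\mathbb R^p$ and put $R_{p,q}=C_p\otimes_{\mathbb R} C_q$ (ordinary tensor product of algebras), with standard generators $e_1,\dots,e_p$ (from $C_p$) and $e_{p+1},\dots,e_{p+q}$ (from $C_q$). Let $R_{p,q}^+$ be the subalgebra generated by the products $e_ie_j$ $(i\neq j)$. Let $\rho:R_{p,q}\to M(m;\mathbb R)$ be a representation such that all the basis matrices $S_i=\rho(e_i)$ are symmetric, and put $$\mathfrak h_{p,q}(\rho)=\{X\in M(m;\mathbb R)\;:\;{}^tX S_i+S_iX=0\ \ (1\le i\le p+q)\}.$$ **Theorem 3.4.** The real Lie algebra $\mathfrak h_{p,q}(\rho)$ is reductive. The pair $(R_{p,q},R_{p,q}^+)$ is, up to isomorphism of real algebras, as in the following table, where $T=M(\ell;\mathbb K)$, $T'=M(r;\mathbb K')$ for some $\ell,r\ge1$ and $sT$ denotes the direct sum of $s$ copies of $T$; and $\mathfrak h_{p,q}(\rho)$ is isomorphic, as a real Lie algebra, to the Lie algebra in the third column. $$\begin{array}{|c|c|c|c|}\hline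 (R_{p,q},R_{p,q}^+)&(\mathbb K,\mathbb K')&\mathfrak h_{p,q}(\rho)&\{p \bmod 8,\ q\bmod 8\}\\\hline (T,T')&(\mathbb R,\mathbb C)&\mathfrak{so}(k,\mathbb C)&\{0,2\},\{4,6\}\\ (T,T')&(\mathbb C,\mathbb R)&\mathfrak{sp}(k,\mathbb R)&\{0,7\},\{2,3\},\{3,4\},\{6,7\}\\ (T,T')&(\mathbb C,\mathbb H)&\mathfrak{so}^*(2k)&\{0,3\},\{2,7\},\{3,6\},\{4,7\}\\ (T,T')&(\mathbb H,\mathbb C)&\mathfrak{sp}(k,\mathbb C)&\{0,6\},\{2,4\}\\\hline (T,2T')&(\mathbb R,\mathbb R)&\mathfrak{gl}(k,\mathbb R)&\{0,0\},\{2,2\},\{4,4\},\{6,6\}\\ (T,2T')&(\mathbb H,\mathbb H)&\mathfrak{gl}(k,\mathbb H)&\{0,4\},\{2,6\}\\\hline (2T,T')&(\mathbb R,\mathbb R)&\mathfrak{so}(k_1,k_2)&\{0,1\},\{1,2\},\{4,5\},\{5,6\}\\ (2T,T')&(\mathbb C,\mathbb C)&\mathfrak{u}(k_1,k_2)&\{1,3\},\{1,7\},\{3,5\},\{5,7\}\\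 (2T,T')&(\mathbb H,\mathbb H)&\mathfrak{sp}(k_1,k_2)&\{0,5\},\{1,4\},\{1,6\},\{2,5\}\\\hline (2T,2T')&(\mathbb C,\mathbb R)&\mathfrak{sp}(k_1,\mathbb R)\oplus\mathfrak{sp}(k_2,\mathbb R)&\{3,3\},\{7,7\}\\ (2T,2T')&(\mathbb C,\mathbb H)&\mathfrak{so}^*(2k_1)\oplus\mathfrak{so}^*(2k_2)&\{3,7\}\\\hline (4T,2T')&(\mathbb R,\mathbb R)&\mathfrak{so}(k_1,k_2)\oplus\mathfrak{so}(k_3,k_4)&\{1,1\},\{5,5\}\\ (4T,2T')&(\mathbb H,\mathbb H)&\mathfrak{sp}(k_1,k_2)\oplus\mathfrak{sp}(k_3,k_4)&\{1,5\}\\\hline \end{array}$$ Here $\mathfrak{sp}(k,\mathbb R)$, $\mathfrak{sp}(k,\mathbb C)$ and $\mathfrak{so}^*(2k)$ consist of matrices of size $2k$, and $k,k_1,\dots,k_4$ are multiplicities of irreducible representations in $\rho$. More precisely: * if $R_{p,q}=T$, then $R_{p,q}$ has exactly one irreducible representation $\rho_1$ up to isomorphism, and $k$ is the multiplicity of $\rho_1$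 in $\rho$; * if $R_{p,q}=2T$, then $R_{p,q}$ has exactly two irreducible representations $\rho_1,\rho_2$, and $k_1,k_2$ are their multiplicities in $\rho$; * if $R_{p,q}=4T$, then $R_{p,q}$ has exactly four irreducible representations and $R_{p,q}^+$ has exactly two, $\Lambda_e$ and $\Lambda_o$. The four can be numbered so that $\rho_1|_{R_{p,q}^+}\cong\rho_2|_{R_{p,q}^+}\cong\Lambda_e$ and $\rho_3|_{R_{p,q}^+}\cong\rho_4|_{R_{p,q}^+}\cong\Lambda_o$, and for any numbering with $\rho_1|_{R_{p,q}^+}\cong\rho_2|_{R_{p,q}^+}$ and $\rho_3|_{R_{p,q}^+}\cong\rho_4|_{R_{p,q}^+}$, the integers $k_1,\dots,k_4$ are the multiplicities of $\rho_1,\dots,\rho_4$ in $\rho$. -/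

import Mathlib

open scoped TensorProduct Matrix

attribute [local instance 100] LieRing.ofAssociativeRing

noncomputable section

namespace CliffordQuartic

/-- The positive definite quadratic form `v₁² + ⋯ + v_p²` on `ℝ^p`. -/
abbrev sumSq (p : ℕ) : QuadraticForm ℝ (Fin p → ℝ) :=
  QuadraticMap.weightedSumSquares ℝ (fun _ : Fin p => (1 : ℝ))

/-- `R_{p,q} = C_p ⊗ C_q`: the ordinary (ungraded) tensor product over `ℝ` of the Clifford algebras
of the positive definite forms on `ℝ^p` and `ℝ^q`. -/
abbrev R (p q : ℕ) : Type :=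
  CliffordAlgebra (sumSq p) ⊗[ℝ] CliffordAlgebra (sumSq q)

/-- The standard generators of `R_{p,q}`: `Sum.inl i` is the generator `e_i ⊗ 1` coming from `C_p`
and `Sum.inr j` is the generator `1 ⊗ e_{p+j}` coming from `C_q`. -/
def e (p q : ℕ) : Fin p ⊕ Fin q → R p q
  | Sum.inl i => CliffordAlgebra.ι (sumSq p) (Pi.single i 1) ⊗ₜ[ℝ] 1
  | Sum.inr j => 1 ⊗ₜ[ℝ] CliffordAlgebra.ι (sumSq q) (Pi.single j 1)

/-- The even subalgebra `R_{p,q}^+`, generated by the products `e_i e_j` with `i ≠ j`. -/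
def Rplus (p q : ℕ) : Subalgebra ℝ (R p q) :=
  Algebra.adjoin ℝ {x | ∃ i j : Fin p ⊕ Fin q, i ≠ j ∧ x = e p q i * e p q j}

/-- The Lie algebra `𝔥_{p,q}(ρ)` of all real `m × m` matrices `X` with `ᵗX S_i + S_i X = 0` for every
basis matrix `S_i = ρ(e_i)`. -/
def h {p q m : ℕ} (ρ : R p q →ₐ[ℝ] Matrix (Fin m) (Fin m) ℝ) :
    LieSubalgebra ℝ (Matrix (Fin m) (Fin m) ℝ) where
  carrier := {X | ∀ i, Xᵀ * ρ (e p q i) + ρ (e p q i) * X = 0}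
  add_mem' := by
    intro X Y hX hY i
    have h1 := hX i
    have h2 := hY i
    rw [Matrix.transpose_add, add_mul, mul_add, add_add_add_comm, h1, h2, add_zero]
  zero_mem' := by intro i; simp
  smul_mem' := by
    intro c X hX i
    have h1 := hX i
    rw [Matrix.transpose_smul, Matrix.smul_mul, Matrix.mul_smul, ← smul_add, h1, smul_zero]
  lie_mem' := by
    intro X Y hX hY i
    have h1 : Xᵀ * ρ (e p q i) = -(ρ (e p q i) * X) := eq_neg_of_add_eq_zero_left (hX i)
    have h2 : Yᵀ * ρ (e p q i) = -(ρ (e p q i) * Y) := eq_neg_of_add_eq_zero_left (hY i)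
    rw [Ring.lie_def, Matrix.transpose_sub, Matrix.transpose_mul, Matrix.transpose_mul, sub_mul,
      mul_assoc, mul_assoc, h1, h2, mul_neg, mul_neg, ← mul_assoc, ← mul_assoc, h1, h2]
    noncomm_ring

/-- The representation space `W = ℝ^m` of a matrix representation `ρ` of `R_{p,q}`. -/
def RepSpace {p q m : ℕ} (_ρ : R p q →ₐ[ℝ] Matrix (Fin m) (Fin m) ℝ) : Type := Fin m → ℝ

instance {p q m : ℕ} (ρ : R p q →ₐ[ℝ] Matrix (Fin m) (Fin m) ℝ) : AddCommGroup (RepSpace ρ) :=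
  inferInstanceAs (AddCommGroup (Fin m → ℝ))

/-- `R_{p,q}` acts on `W` by `a • w = ρ(a) w`. -/
instance {p q m : ℕ} (ρ : R p q →ₐ[ℝ] Matrix (Fin m) (Fin m) ℝ) : Module (R p q) (RepSpace ρ) where
  smul a w := (ρ a *ᵥ (w : Fin m → ℝ) : Fin m → ℝ)
  one_smul w := (congrArg (fun A : Matrix (Fin m) (Fin m) ℝ => A *ᵥ (w : Fin m → ℝ))
    (map_one ρ)).trans (Matrix.one_mulVec (w : Fin m → ℝ))
  mul_smul a b w := (congrArg (fun A : Matrix (Fin m) (Fin m) ℝ => A *ᵥ (w : Fin m → ℝ))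
    (map_mul ρ a b)).trans (Matrix.mulVec_mulVec (w : Fin m → ℝ) (ρ a) (ρ b)).symm
  smul_zero a := Matrix.mulVec_zero (ρ a)
  smul_add a v w := Matrix.mulVec_add (ρ a) (v : Fin m → ℝ) (w : Fin m → ℝ)
  add_smul a b w := (congrArg (fun A : Matrix (Fin m) (Fin m) ℝ => A *ᵥ (w : Fin m → ℝ))
    (map_add ρ a b)).trans (Matrix.add_mulVec (ρ a) (ρ b) (w : Fin m → ℝ))
  zero_smul w := (congrArg (fun A : Matrix (Fin m) (Fin m) ℝ => A *ᵥ (w : Fin m → ℝ))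
    (map_zero ρ)).trans (Matrix.zero_mulVec (w : Fin m → ℝ))

/-- The multiplicity of the simple module `V` in the module `W`: the length of the `V`-isotypic
component of `W` (finite for every `W` that is finite-dimensional over `ℝ`). -/
def mult {p q m : ℕ} (V : ModuleCat.{0} (R p q)) (ρ : R p q →ₐ[ℝ] Matrix (Fin m) (Fin m) ℝ) : ℕ :=
  (Module.length (R p q) (isotypicComponent (R p q) (RepSpace ρ) V)).toNat

/-- `V` is a complete list, without repetition, of the irreducible representations of the ring `A`
up to isomorphism. -/
structure IsIrrepList {A : Type} [Ring A] {s : ℕ} (V : Fin s → ModuleCat.{0} A) : Prop where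
  simple : ∀ i, IsSimpleModule A (V i)
  not_equiv : ∀ i j, i ≠ j → IsEmpty (V i ≃ₗ[A] V j)
  exhaust : ∀ U : ModuleCat.{0} A, IsSimpleModule A U → ∃ i, Nonempty (U ≃ₗ[A] V i)

/-- `A` is isomorphic as a real algebra to the direct sum of `s` copies of the matrix algebra
`M(ℓ; K)`, for some `ℓ ≥ 1`. -/
def IsMatrixSum (A : Type) [Ring A] [Algebra ℝ A] (s : ℕ) (K : Type) [Ring K] [Algebra ℝ K] : Prop :=
  ∃ ℓ : ℕ, 1 ≤ ℓ ∧ Nonempty (A ≃ₐ[ℝ] (Fin s → Matrix (Fin ℓ) (Fin ℓ) K))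

/-- `(R_{p,q}, R_{p,q}^+) = (s T, s' T')` with `T = M(ℓ; K)` and `T' = M(r; K')`. -/
def AlgType (p q s : ℕ) (K : Type) [Ring K] [Algebra ℝ K] (s' : ℕ) (K' : Type) [Ring K']
    [Algebra ℝ K'] : Prop :=
  IsMatrixSum (R p q) s K ∧ IsMatrixSum (Rplus p q) s' K'

/-- The restriction of a representation of `R_{p,q}` to `R_{p,q}^+`. -/
abbrev res {p q : ℕ} (V : ModuleCat.{0} (R p q)) : ModuleCat.{0} (Rplus p q) :=
  ModuleCat.of (Rplus p q) V

/-- A complex Lie algebra of complex matrices, regarded as a real Lie algebra. -/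
def toReal {n : Type} [Fintype n] [DecidableEq n] (L : LieSubalgebra ℂ (Matrix n n ℂ)) :
    LieSubalgebra ℝ (Matrix n n ℂ) where
  toSubmodule := L.toSubmodule.restrictScalars ℝ
  lie_mem' := fun hx hy => L.lie_mem hx hy

/-- The real Lie algebra of matrices `X` over `K` with `X* J + J X = 0`, where `X*` is the conjugate
transpose of `X`. -/
def skewHerm (K : Type) [Ring K] [StarRing K] [Algebra ℝ K] [StarModule ℝ K] {n : Type} [Fintype n]
    [DecidableEq n] (J : Matrix n n K) : LieSubalgebra ℝ (Matrix n n K) where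
  carrier := {X | Xᴴ * J + J * X = 0}
  add_mem' := by
    intro X Y hX hY
    simp only [Set.mem_ofPred_eq] at *
    rw [Matrix.conjTranspose_add, add_mul, mul_add, add_add_add_comm, hX, hY, add_zero]
  zero_mem' := by simp
  smul_mem' := by
    intro c X hX
    simp only [Set.mem_ofPred_eq] at *
    rw [Matrix.conjTranspose_smul, Matrix.smul_mul, Matrix.mul_smul, star_trivial, ← smul_add, hX,
      smul_zero]
  lie_mem' := by
    intro X Y hX hY
    have h1 : Xᴴ * J = -(J * X) := eq_neg_of_add_eq_zero_left hX
    have h2 : Yᴴ * J = -(J * Y) := eq_neg_of_add_eq_zero_left hY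
    show ⁅X, Y⁆ᴴ * J + J * ⁅X, Y⁆ = 0
    rw [Ring.lie_def, Matrix.conjTranspose_sub, Matrix.conjTranspose_mul, Matrix.conjTranspose_mul,
      sub_mul, mul_assoc, mul_assoc, h1, h2, mul_neg, mul_neg, ← mul_assoc, ← mul_assoc, h1, h2]
    noncomm_ring

instance : StarModule ℝ (Quaternion ℝ) :=
  ⟨fun r x => by rw [star_trivial r]; exact Quaternion.star_smul r x⟩

/-- The diagonal matrix with `a` entries `1` and `b` entries `-1`. -/
def diagSign (K : Type) [Ring K] (a b : ℕ) : Matrix (Fin a ⊕ Fin b) (Fin a ⊕ Fin b) K :=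
  Matrix.diagonal (Sum.elim (fun _ => 1) (fun _ => -1))

/-- `𝔤𝔩(k, K)`. -/
abbrev gl (k : ℕ) (K : Type) : Type := Matrix (Fin k) (Fin k) K

/-- `𝔰𝔬(k, ℂ)`. -/
abbrev soC (k : ℕ) : LieSubalgebra ℝ (Matrix (Fin k) (Fin k) ℂ) :=
  toReal (LieAlgebra.Orthogonal.so (Fin k) ℂ)

/-- `𝔰𝔭(k, ℂ)`, consisting of complex matrices of size `2k`. -/
abbrev spC (k : ℕ) : LieSubalgebra ℝ (Matrix (Fin k ⊕ Fin k) (Fin k ⊕ Fin k) ℂ) :=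
  toReal (LieAlgebra.Symplectic.sp (Fin k) ℂ)

/-- `𝔰𝔭(k, ℝ)`, consisting of real matrices of size `2k`. -/
abbrev spR (k : ℕ) : LieSubalgebra ℝ (Matrix (Fin k ⊕ Fin k) (Fin k ⊕ Fin k) ℝ) :=
  LieAlgebra.Symplectic.sp (Fin k) ℝ

/-- `𝔰𝔬*(2k)`: complex matrices `X` of size `2k` with `ᵗX + X = 0` and `X* J + J X = 0`, where `J` is
the standard symplectic matrix. -/
abbrev soStar (k : ℕ) : LieSubalgebra ℝ (Matrix (Fin k ⊕ Fin k) (Fin k ⊕ Fin k) ℂ) :=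
  toReal (LieAlgebra.Orthogonal.so (Fin k ⊕ Fin k) ℂ) ⊓ skewHerm ℂ (Matrix.J (Fin k) ℂ)

/-- `𝔰𝔬(a, b)`. -/
abbrev so (a b : ℕ) : LieSubalgebra ℝ (Matrix (Fin a ⊕ Fin b) (Fin a ⊕ Fin b) ℝ) :=
  LieAlgebra.Orthogonal.so' (Fin a) (Fin b) ℝ

/-- `𝔲(a, b)`. -/
abbrev u (a b : ℕ) : LieSubalgebra ℝ (Matrix (Fin a ⊕ Fin b) (Fin a ⊕ Fin b) ℂ) :=
  skewHerm ℂ (diagSign ℂ a b)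

/-- `𝔰𝔭(a, b)`: the quaternionic matrices of size `a + b` that are skew with respect to the Hermitian
form of signature `(a, b)`. -/
abbrev sp (a b : ℕ) : LieSubalgebra ℝ (Matrix (Fin a ⊕ Fin b) (Fin a ⊕ Fin b) (Quaternion ℝ)) :=
  skewHerm (Quaternion ℝ) (diagSign (Quaternion ℝ) a b)

/-- The four irreducible representations of `R_{p,q}` are listed so that the first two restrict to
the same representation of `R_{p,q}^+` and the last two restrict to the same one. -/
def IsPaired {p q : ℕ} (V : Fin 4 → ModuleCat.{0} (R p q)) : Prop :=
  Nonempty (res (V 0) ≃ₗ[Rplus p q] res (V 1)) ∧ Nonempty (res (V 2) ≃ₗ[Rplus p q] res (V 3))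

/-- The number of irreducible representations of `R_{p,q}` is `s`. -/
def HasIrreps (p q s : ℕ) : Prop := ∃ V : Fin s → ModuleCat.{0} (R p q), IsIrrepList V

/-- `R_{p,q}` has four irreducible representations and `R_{p,q}^+` has two, `Λ_e` and `Λ_o`. The four
can be listed so that the first two restrict to `Λ_e` and the last two restrict to `Λ_o`. -/
def HasPairedIrreps (p q : ℕ) : Prop :=
  ∃ V : Fin 4 → ModuleCat.{0} (R p q), IsIrrepList V ∧ IsPaired V ∧ IsIrrepList ![res (V 0), res (V 2)]

end CliffordQuartic

end

/-! Each `S_i` is symmetric with square `1`, so membership of `X` in `h ρ` says that `ᵗX = -S_i X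
S_i` for every `i`. This has two immediate consequences. First, the Lie algebra is closed under
transposition, and positivity of `tr(Z ᵗZ)` makes such a Lie algebra reductive
(`hasCentralRadical_of_transpose_mem`). Second, `X` commutes with every `S_i S_j`, so the Lie
algebra lies in the commutant of the even subalgebra (`commute_of_skew`). The rest is governed by
the volume elements of the two Clifford factors.

If `p` or `q` is odd, the volume element `z` of that factor is odd and central with square `±1`. For
operators commuting with the even subalgebra, the conditions at all generators reduce to one:
skewness relative to `z` (`skew_iff_of_odd`). The commutant is a matrix algebra over `ℝ`, `ℂ` or `ℍ`
in which the adjoint is the conjugate transpose, and `z` becomes an explicit matrix: a diagonal of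
signs if `z² = 1`; if `z² = -1`, the symplectic matrix over `ℝ` or the scalar `j` over `ℍ`. Then
`nonempty_equiv_skewHerm` gives the classical algebra. If `p` and `q` are both odd and congruent
modulo 4, the product of the volume elements is even and central with square `1`, and its
eigenspaces split the Lie algebra into two factors (`nonempty_equiv_prod`).

If `p` and `q` are both even, the product `ω` of the volume elements is even and anticommutes with
the generators. Conjugation by a generator decomposes `X` as `a + ω b`, with `a` and `b` in the
commutant of the whole algebra, `a* = -a` and `b* = ε b`, where `ω² = ε`
(`nonempty_equiv_of_anticomm`). For `ε = -1` the element `ω` acts as an imaginary unit and one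
obtains the complexification of a compact algebra; for `ε = 1`, sending `a + ω b` to `a + b` gives a
general linear algebra.

The matrix models come from decomposing an isotypic space orthogonally into isometric copies of one
simple module (`exists_isFrame`); that the adjoint matches the conjugation of the division algebra
follows from reality of traces and norms (`algEquiv_star`). The number of copies is a module length,
which is how the multiplicities enter.

The algebra types follow from eight-fold periodicity (`hasCliffordType_cl`), applied to the two
tensor factors and to the even subalgebra, itself a Clifford algebra of signature `(q, p - 1)` when
`p ≥ 1` (`nonempty_even_equiv_cl`). When there are several irreducible representations, the signs of
the central elements tell them apart. -/

noncomputable section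

namespace CliffordQuartic

section

/-! ### Clifford algebras of diagonal forms. -/

section DiagonalClifford

variable {ι κ : Type} [Fintype ι] [DecidableEq ι] [Fintype κ] [DecidableEq κ]

/-- The Clifford algebra of the diagonal quadratic form with coefficients `w`. -/
abbrev Cl (w : ι → ℝ) : Type := CliffordAlgebra (QuadraticMap.weightedSumSquares ℝ w)

/-- The standard generators of a diagonal Clifford algebra. -/
def Cl.gen (w : ι → ℝ) (i : ι) : Cl w := CliffordAlgebra.ι _ (Pi.single i 1)

theorem Cl.gen_sq (w : ι → ℝ) (i : ι) : Cl.gen w i * Cl.gen w i = algebraMap ℝ _ (w i) := by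
  rw [Cl.gen, CliffordAlgebra.ι_sq_scalar, QuadraticMap.weightedSumSquares_apply]
  congr 1
  rw [Finset.sum_eq_single i]
  · simp
  · intro j _ hj
    simp [Pi.single_eq_of_ne hj]
  · simp

theorem Cl.gen_anticomm (w : ι → ℝ) {i j : ι} (h : i ≠ j) :
    Cl.gen w i * Cl.gen w j = -(Cl.gen w j * Cl.gen w i) := by
  rw [Cl.gen, Cl.gen, CliffordAlgebra.ι_mul_ι_comm_of_isOrtho]
  rw [QuadraticMap.isOrtho_def]
  simp only [QuadraticMap.weightedSumSquares_apply, ← Finset.sum_add_distrib]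
  refine Finset.sum_congr rfl fun k _ => ?_
  by_cases hi : k = i
  · subst hi
    simp [Pi.single_eq_of_ne h]
  · simp [Pi.single_eq_of_ne hi]

/-- Adding the double sum to itself with the indices exchanged cancels the off-diagonal terms and
doubles the diagonal; the factor 2 is then cancelled. -/
theorem sum_mul_sum_of_anticomm {A : Type} [Ring A] [Algebra ℝ A] (w : ι → ℝ) (b : ι → A)
    (hsq : ∀ i, b i * b i = algebraMap ℝ A (w i)) (hanti : ∀ i j, i ≠ j → b i * b j = -(b j * b i))
    (v : ι → ℝ) :
    (∑ i, v i • b i) * (∑ i, v i • b i) = algebraMap ℝ A (∑ i, w i • (v i * v i)) := by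
  have h1 : (∑ i, v i • b i) * (∑ i, v i • b i) = ∑ i, ∑ j, (v i * v j) • (b i * b j) := by
    rw [Finset.sum_mul_sum]
    simp only [smul_mul_smul_comm]
  have h2 : (∑ i, v i • b i) * (∑ i, v i • b i) = ∑ i, ∑ j, (v i * v j) • (b j * b i) := by
    rw [h1, Finset.sum_comm]
    simp only [mul_comm]
  have h3 : ∀ i j, (v i * v j) • (b i * b j) + (v i * v j) • (b j * b i)
      = if i = j then (2 : ℝ) • algebraMap ℝ A (w i • (v i * v i)) else 0 := by
    intro i j
    split_ifs with h
    · subst h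
      rw [hsq, ← two_smul ℝ, Algebra.smul_def (v i * v i), ← map_mul, smul_eq_mul, mul_comm (v i * v i)]
    · rw [hanti i j h, smul_neg, neg_add_cancel]
  have h4 : (2 : ℝ) • ((∑ i, v i • b i) * (∑ i, v i • b i)) =
      (2 : ℝ) • algebraMap ℝ A (∑ i, w i • (v i * v i)) := by
    rw [two_smul ℝ ((∑ i, v i • b i) * (∑ i, v i • b i))]
    nth_rewrite 1 [h1]
    rw [h2, ← Finset.sum_add_distrib]
    simp only [← Finset.sum_add_distrib, h3]
    simp [map_sum, Finset.smul_sum]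
  exact smul_right_injective A (two_ne_zero (α := ℝ)) h4

/-- The universal property of a diagonal Clifford algebra in terms of its generators. -/
def Cl.lift {A : Type} [Ring A] [Algebra ℝ A] (w : ι → ℝ) (b : ι → A)
    (hsq : ∀ i, b i * b i = algebraMap ℝ A (w i))
    (hanti : ∀ i j, i ≠ j → b i * b j = -(b j * b i)) : Cl w →ₐ[ℝ] A :=
  CliffordAlgebra.lift _ ⟨Fintype.linearCombination ℝ b, fun v => by
    rw [Fintype.linearCombination_apply, sum_mul_sum_of_anticomm w b hsq hanti,
      QuadraticMap.weightedSumSquares_apply]⟩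

@[simp]
theorem Cl.lift_gen {A : Type} [Ring A] [Algebra ℝ A] (w : ι → ℝ) (b : ι → A)
    (hsq : ∀ i, b i * b i = algebraMap ℝ A (w i))
    (hanti : ∀ i j, i ≠ j → b i * b j = -(b j * b i)) (i : ι) :
    Cl.lift w b hsq hanti (Cl.gen w i) = b i := by
  rw [Cl.lift, Cl.gen, CliffordAlgebra.lift_ι_apply]
  simp

theorem Cl.hom_ext {A : Type} [Ring A] [Algebra ℝ A] {w : ι → ℝ} {f g : Cl w →ₐ[ℝ] A}
    (h : ∀ i, f (Cl.gen w i) = g (Cl.gen w i)) : f = g := by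
  apply CliffordAlgebra.hom_ext
  apply LinearMap.pi_ext'
  intro i
  ext
  exact h i

theorem Cl.adjoin_gen (w : ι → ℝ) : Algebra.adjoin ℝ (Set.range (Cl.gen w)) = ⊤ := by
  rw [eq_top_iff, ← CliffordAlgebra.adjoin_range_ι]
  apply Algebra.adjoin_le
  rintro _ ⟨v, rfl⟩
  have : v = ∑ i, v i • (Pi.single i 1 : ι → ℝ) := by
    ext j; simp [Pi.single_apply]
  rw [this, map_sum]
  refine Subalgebra.sum_mem _ fun i _ => ?_
  rw [map_smul]
  exact Subalgebra.smul_mem _ (Algebra.subset_adjoin (Set.mem_range_self i)) _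

/-- Reindexing a diagonal Clifford algebra. -/
def Cl.congr {w : ι → ℝ} {w' : κ → ℝ} (σ : ι ≃ κ) (h : ∀ i, w' (σ i) = w i) :
    Cl w ≃ₐ[ℝ] Cl w' :=
  AlgEquiv.ofAlgHom
    (Cl.lift w (fun i => Cl.gen w' (σ i)) (fun i => by rw [Cl.gen_sq, h])
      (fun i j hij => Cl.gen_anticomm _ (σ.injective.ne hij)))
    (Cl.lift w' (fun i => Cl.gen w (σ.symm i)) (fun i => by rw [Cl.gen_sq, ← h, σ.apply_symm_apply])
      (fun i j hij => Cl.gen_anticomm _ (σ.symm.injective.ne hij)))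
    (Cl.hom_ext fun i => by simp)
    (Cl.hom_ext fun i => by simp)

/-- Splitting off two generators of square `±1`: the remaining ones are multiplied by
their product. -/
def Cl.splitTwo (u : Fin 2 → ℝ) (hu : ∀ i, u i * u i = 1) (w : ι → ℝ) :
    Cl (Sum.elim u (fun i => -(u 0 * u 1) * w i)) ≃ₐ[ℝ] Cl u ⊗[ℝ] Cl w := by
  set W : Fin 2 ⊕ ι → ℝ := Sum.elim u (fun i => -(u 0 * u 1) * w i) with hW
  -- The product `a` anticommutes with both of its factors and has square `-(u 0 * u 1)`. Hence the
  -- elements `a ⊗ gen w i` anticommute with the `gen u j ⊗ 1` and have exactly the squares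
  -- prescribed by `W`.
  set a := Cl.gen u 0 * Cl.gen u 1 with ha
  have h01 := Cl.gen_anticomm u (show (0 : Fin 2) ≠ 1 by decide)
  have ha2 : a * a = algebraMap ℝ _ (-(u 0 * u 1)) := by
    rw [ha, mul_assoc, ← mul_assoc (Cl.gen u 1), Cl.gen_anticomm u (show (1 : Fin 2) ≠ 0 by decide)]
    rw [neg_mul, mul_neg, mul_assoc, Cl.gen_sq, ← mul_assoc, Cl.gen_sq, ← map_mul, ← map_neg]
  have hag : ∀ i, Cl.gen u i * a = -(a * Cl.gen u i) := by
    intro i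
    fin_cases i
    · simp only [ha, Fin.zero_eta, Fin.isValue]
      rw [← mul_assoc, mul_assoc (Cl.gen u 0) (Cl.gen u 1),
        Cl.gen_anticomm u (show (1 : Fin 2) ≠ 0 by decide), mul_neg, neg_neg, mul_assoc]
    · simp only [ha, Fin.mk_one, Fin.isValue]
      rw [← mul_assoc, Cl.gen_anticomm u (show (1 : Fin 2) ≠ 0 by decide), neg_mul]
  set b := Cl.gen W (.inl 0) * Cl.gen W (.inl 1) with hb
  have hb2 : b * b = algebraMap ℝ _ (-(u 0 * u 1)) := by
    rw [hb, mul_assoc, ← mul_assoc (Cl.gen W (.inl 1)),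
      Cl.gen_anticomm W (show (Sum.inl 1 : Fin 2 ⊕ ι) ≠ .inl 0 by simp)]
    rw [neg_mul, mul_neg, mul_assoc, Cl.gen_sq, ← mul_assoc, Cl.gen_sq, ← map_mul, ← map_neg]
    rfl
  have hbl : ∀ i, Cl.gen W (.inl i) * b = -(b * Cl.gen W (.inl i)) := by
    intro i
    fin_cases i
    · simp only [hb, Fin.zero_eta, Fin.isValue]
      rw [← mul_assoc, mul_assoc (Cl.gen W (.inl 0)) (Cl.gen W (.inl 1)),
        Cl.gen_anticomm W (show (Sum.inl 1 : Fin 2 ⊕ ι) ≠ .inl 0 by simp), mul_neg, neg_neg, mul_assoc]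
    · simp only [hb, Fin.mk_one, Fin.isValue]
      rw [← mul_assoc, Cl.gen_anticomm W (show (Sum.inl 1 : Fin 2 ⊕ ι) ≠ .inl 0 by simp), neg_mul]
  have hbr : ∀ i, Cl.gen W (.inr i) * b = b * Cl.gen W (.inr i) := by
    intro i
    rw [hb, ← mul_assoc, Cl.gen_anticomm W (show (Sum.inr i : Fin 2 ⊕ ι) ≠ .inl 0 by simp), neg_mul,
      mul_assoc, Cl.gen_anticomm W (show (Sum.inr i : Fin 2 ⊕ ι) ≠ .inl 1 by simp), mul_neg, neg_neg,
      mul_assoc]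
  clear_value b
  have hbb : ∀ i j, (b * Cl.gen W (.inr i)) * (b * Cl.gen W (.inr j)) =
      b * b * (Cl.gen W (.inr i) * Cl.gen W (.inr j)) := by
    intro i j
    rw [mul_assoc, ← mul_assoc (Cl.gen W _) b, hbr]
    simp only [mul_assoc]
  have hcc : -(u 0 * u 1) * -(u 0 * u 1) = 1 := by
    have := hu 0; have := hu 1
    linear_combination (u 1 * u 1) * hu 0 + hu 1
  let F : Cl W →ₐ[ℝ] Cl u ⊗[ℝ] Cl w := Cl.lift W
    (Sum.elim (fun i => Cl.gen u i ⊗ₜ 1) (fun j => a ⊗ₜ Cl.gen w j))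
    (by
      rintro (i | i)
      · simp only [Sum.elim_inl, Algebra.TensorProduct.tmul_mul_tmul, Cl.gen_sq, mul_one, hW,
          Algebra.TensorProduct.algebraMap_apply]
      · simp only [Sum.elim_inr, Algebra.TensorProduct.tmul_mul_tmul, Cl.gen_sq, hW, ha2,
          Algebra.algebraMap_eq_smul_one, TensorProduct.smul_tmul_smul,
          Algebra.TensorProduct.one_def])
    (by
      rintro (i | i) (j | j) hij
      · simp only [Sum.elim_inl, Algebra.TensorProduct.tmul_mul_tmul, mul_one]
        rw [Cl.gen_anticomm u (by simpa using hij), TensorProduct.neg_tmul]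
      · simp only [Sum.elim_inl, Sum.elim_inr, Algebra.TensorProduct.tmul_mul_tmul, mul_one, one_mul]
        rw [hag, TensorProduct.neg_tmul]
      · simp only [Sum.elim_inl, Sum.elim_inr, Algebra.TensorProduct.tmul_mul_tmul, mul_one, one_mul]
        rw [hag, TensorProduct.neg_tmul, neg_neg]
      · simp only [Sum.elim_inr, Algebra.TensorProduct.tmul_mul_tmul]
        rw [Cl.gen_anticomm w (by simpa using hij), TensorProduct.tmul_neg])
  let G1 : Cl u →ₐ[ℝ] Cl W := Cl.lift u (fun i => Cl.gen W (.inl i))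
    (fun i => by rw [Cl.gen_sq]; rfl) (fun i j hij => Cl.gen_anticomm _ (by simpa using hij))
  -- Multiplying by `b` makes the remaining generators commute with the image of `G1`. The forward
  -- map sends `b * gen W (inr i)` to `a² ⊗ gen w i`, so the scalar `-(u 0 * u 1)`, which is its own
  -- inverse, undoes `a²`.
  let G2 : Cl w →ₐ[ℝ] Cl W := Cl.lift w (fun i => (-(u 0 * u 1)) • (b * Cl.gen W (.inr i)))
    (fun i => by
      rw [smul_mul_smul_comm, hcc, one_smul, mul_assoc, ← mul_assoc (Cl.gen W _) b, hbr,
        mul_assoc b, ← mul_assoc, hb2, Cl.gen_sq, ← map_mul]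
      congr 1
      simp only [hW, Sum.elim_inr]
      rw [← mul_assoc, hcc, one_mul])
    (fun i j hij => by
      rw [smul_mul_smul_comm, smul_mul_smul_comm, ← smul_neg]
      congr 1
      rw [hbb, hbb, Cl.gen_anticomm W (show (Sum.inr i : Fin 2 ⊕ ι) ≠ .inr j by simpa using hij), mul_neg])
  have hcomm : ∀ x y, Commute (G1 x) (G2 y) := by
    intro x y
    have hx : x ∈ Algebra.adjoin ℝ (Set.range (Cl.gen u)) := by rw [Cl.adjoin_gen]; trivial
    have hy : y ∈ Algebra.adjoin ℝ (Set.range (Cl.gen w)) := by rw [Cl.adjoin_gen]; trivial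
    induction hx using Algebra.adjoin_induction with
    | algebraMap r => rw [AlgHom.commutes]; exact Algebra.commute_algebraMap_left _ _
    | add x x' _ _ h h' => rw [map_add]; exact h.add_left h'
    | mul x x' _ _ h h' => rw [map_mul]; exact h.mul_left h'
    | mem x hx =>
      obtain ⟨i, rfl⟩ := hx
      induction hy using Algebra.adjoin_induction with
      | algebraMap r => rw [AlgHom.commutes]; exact Algebra.commute_algebraMap_right _ _
      | add x x' _ _ h h' => rw [map_add]; exact h.add_right h'
      | mul x x' _ _ h h' => rw [map_mul]; exact h.mul_right h'
      | mem y hy =>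
        obtain ⟨j, rfl⟩ := hy
        simp only [G1, G2, Cl.lift_gen]
        refine Commute.smul_right ?_ _
        change _ * _ = _ * _
        rw [← mul_assoc, hbl, neg_mul, mul_assoc b,
          Cl.gen_anticomm W (show (Sum.inl i : Fin 2 ⊕ ι) ≠ .inr j by simp), mul_neg, neg_neg, mul_assoc]
  have hG1a : G1 a = b := by simp only [ha, hb, map_mul, G1, Cl.lift_gen]
  refine AlgEquiv.ofAlgHom F (Algebra.TensorProduct.lift G1 G2 hcomm) ?_ ?_
  · apply Algebra.TensorProduct.ext
    · refine Cl.hom_ext fun i => ?_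
      simp [F, G1]
    · refine Cl.hom_ext fun i => ?_
      simp only [F, G2, hb, AlgHom.coe_comp,
        Function.comp_apply, AlgHom.restrictScalars_apply, Algebra.TensorProduct.includeRight_apply,
        Algebra.TensorProduct.lift_tmul, map_one, one_mul, Cl.lift_gen, map_smul, map_mul,
        Sum.elim_inl, Sum.elim_inr, Algebra.TensorProduct.tmul_mul_tmul, mul_one, ← ha, ha2]
      rw [Algebra.algebraMap_eq_smul_one, TensorProduct.smul_tmul', smul_smul, hcc, one_smul]
      rfl
  · refine Cl.hom_ext fun i => ?_
    rcases i with i | i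
    · simp [F, G1]
    · simp only [AlgHom.coe_comp, Function.comp_apply, F, Cl.lift_gen, Sum.elim_inr,
        Algebra.TensorProduct.lift_tmul, hG1a, AlgHom.id_apply]
      simp only [G2, Cl.lift_gen]
      rw [mul_smul_comm, ← mul_assoc, hb2, ← Algebra.smul_def, smul_smul, hcc, one_smul]

end DiagonalClifford

end

section

/-! ### Sums of matrix algebras under products and tensor products. -/

section MatrixSum

variable {A B : Type} [Ring A] [Algebra ℝ A] [Ring B] [Algebra ℝ B]
variable {K L N : Type} [Ring K] [Algebra ℝ K] [Ring L] [Algebra ℝ L] [Ring N] [Algebra ℝ N]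

theorem IsMatrixSum.of_equiv {s : ℕ} (e : A ≃ₐ[ℝ] B) (h : IsMatrixSum B s K) : IsMatrixSum A s K := by
  obtain ⟨ℓ, hℓ, ⟨f⟩⟩ := h
  exact ⟨ℓ, hℓ, ⟨e.trans f⟩⟩

theorem IsMatrixSum.of_fintype {ι n : Type} [Fintype ι] [Fintype n] [DecidableEq n] [Nonempty n]
    (e : A ≃ₐ[ℝ] (ι → Matrix n n K)) : IsMatrixSum A (Fintype.card ι) K := by
  classical
  refine ⟨Fintype.card n, Fintype.card_pos, ⟨e.trans ?_⟩⟩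
  exact (AlgEquiv.piCongrLeft' ℝ (fun _ : ι => Matrix n n K) (Fintype.equivFin ι)).trans
    (AlgEquiv.piCongrRight fun _ => Matrix.reindexAlgEquiv ℝ K (Fintype.equivFin n))

theorem IsMatrixSum.pi {s t : ℕ} (e : A ≃ₐ[ℝ] (Fin t → B)) (h : IsMatrixSum B s K) :
    IsMatrixSum A (t * s) K := by
  obtain ⟨ℓ, hℓ, ⟨f⟩⟩ := h
  have : Nonempty (Fin ℓ) := ⟨⟨0, hℓ⟩⟩
  let c : (Fin t → Fin s → Matrix (Fin ℓ) (Fin ℓ) K) ≃ₐ[ℝ] (Fin t × Fin s → Matrix (Fin ℓ) (Fin ℓ) K) :=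
    { toFun := fun g x => g x.1 x.2
      invFun := fun g i j => g (i, j)
      left_inv := fun _ => rfl
      right_inv := fun _ => rfl
      map_mul' := fun _ _ => rfl
      map_add' := fun _ _ => rfl
      commutes' := fun _ => rfl }
  have := IsMatrixSum.of_fintype ((e.trans (AlgEquiv.piCongrRight fun _ => f)).trans c)
  simpa using this

theorem IsMatrixSum.matrix {u : ℕ} {n : Type} [Fintype n] [DecidableEq n] [Nonempty n]
    (h : IsMatrixSum K u N) : IsMatrixSum (Matrix n n K) u N := by
  obtain ⟨ℓ, hℓ, ⟨f⟩⟩ := h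
  have : Nonempty (Fin ℓ) := ⟨⟨0, hℓ⟩⟩
  have := IsMatrixSum.of_fintype ((f.mapMatrix (m := n)).trans ((Matrix.piAlgEquiv ℝ).trans
    (AlgEquiv.piCongrRight fun _ => Matrix.compAlgEquiv n (Fin ℓ) N ℝ)))
  simpa using this

/-- Tensor products distribute over both finite products, and a tensor product of matrix algebras is
a matrix algebra over the tensor product of the coefficients. The factors are exchanged before the
second distribution, hence the order `L ⊗ K`. -/
theorem IsMatrixSum.tensor {s t u : ℕ} (hA : IsMatrixSum A s K) (hB : IsMatrixSum B t L)
    (hKL : IsMatrixSum (L ⊗[ℝ] K) u N) : IsMatrixSum (A ⊗[ℝ] B) (t * (s * u)) N := by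
  obtain ⟨ℓ, hℓ, ⟨f⟩⟩ := hA
  obtain ⟨ℓ', hℓ', ⟨g⟩⟩ := hB
  have : Nonempty (Fin ℓ) := ⟨⟨0, hℓ⟩⟩
  have : Nonempty (Fin ℓ') := ⟨⟨0, hℓ'⟩⟩
  refine IsMatrixSum.pi ((Algebra.TensorProduct.congr f g).trans
    (Algebra.TensorProduct.piRight ℝ ℝ _ fun _ : Fin t => Matrix (Fin ℓ') (Fin ℓ') L)) ?_
  refine IsMatrixSum.pi ((Algebra.TensorProduct.comm ℝ _ _).trans
    (Algebra.TensorProduct.piRight ℝ ℝ _ fun _ : Fin s => Matrix (Fin ℓ) (Fin ℓ) K)) ?_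
  exact IsMatrixSum.of_equiv (Matrix.kroneckerTMulAlgEquiv _ _ ℝ ℝ L K) (IsMatrixSum.matrix hKL)

theorem IsMatrixSum.self : IsMatrixSum K 1 K := by
  have := IsMatrixSum.of_fintype (ι := Unit) (n := Unit) (K := K)
    (((Matrix.uniqueAlgEquiv (m := Unit) (R := ℝ) (A := K)).symm).trans
      (AlgEquiv.funUnique ℝ Unit (Matrix Unit Unit K)).symm)
  simpa using this

end MatrixSum

end

section

/-! ### Tensor products of the real division algebras. -/

section TensorDivision

open scoped Quaternion

/-- The quaternion `a + b i + c j + d k`. -/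
def quat (a b c d : ℝ) : Quaternion ℝ := ⟨a, b, c, d⟩

@[simp] theorem quat_re (a b c d : ℝ) : (quat a b c d).re = a := rfl
@[simp] theorem quat_imI (a b c d : ℝ) : (quat a b c d).imI = b := rfl
@[simp] theorem quat_imJ (a b c d : ℝ) : (quat a b c d).imJ = c := rfl
@[simp] theorem quat_imK (a b c d : ℝ) : (quat a b c d).imK = d := rfl

/-- In equal finite dimensions one half of bijectivity is enough; this and the next lemma let each
tensor computation prove whichever half is easier. -/
theorem isMatrixSum_of_injective {A B : Type} [Ring A] [Algebra ℝ A] [Ring B] [Algebra ℝ B]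
    [FiniteDimensional ℝ A] [FiniteDimensional ℝ B] {s : ℕ} {K : Type} [Ring K] [Algebra ℝ K]
    (f : A →ₐ[ℝ] B) (hf : Function.Injective f) (hd : Module.finrank ℝ A = Module.finrank ℝ B)
    (h : IsMatrixSum B s K) : IsMatrixSum A s K :=
  h.of_equiv (AlgEquiv.ofBijective f
    ⟨hf, (LinearMap.injective_iff_surjective_of_finrank_eq_finrank (f := f.toLinearMap) hd).1 hf⟩)

theorem isMatrixSum_of_surjective {A B : Type} [Ring A] [Algebra ℝ A] [Ring B] [Algebra ℝ B]
    [FiniteDimensional ℝ A] [FiniteDimensional ℝ B] {s : ℕ} {K : Type} [Ring K] [Algebra ℝ K]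
    (f : A →ₐ[ℝ] B) (hf : Function.Surjective f) (hd : Module.finrank ℝ A = Module.finrank ℝ B)
    (h : IsMatrixSum B s K) : IsMatrixSum A s K :=
  h.of_equiv (AlgEquiv.ofBijective f
    ⟨(LinearMap.injective_iff_surjective_of_finrank_eq_finrank (f := f.toLinearMap) hd).2 hf, hf⟩)

theorem isMatrixSum_real_tensor (K : Type) [Ring K] [Algebra ℝ K] : IsMatrixSum (ℝ ⊗[ℝ] K) 1 K :=
  IsMatrixSum.self.of_equiv (Algebra.TensorProduct.lid ℝ K)

theorem isMatrixSum_tensor_real (K : Type) [Ring K] [Algebra ℝ K] : IsMatrixSum (K ⊗[ℝ] ℝ) 1 K :=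
  IsMatrixSum.self.of_equiv (Algebra.TensorProduct.rid ℝ ℝ K)

theorem isMatrixSum_pi_self (s : ℕ) (K : Type) [Ring K] [Algebra ℝ K] : IsMatrixSum (Fin s → K) s K := by
  simpa using IsMatrixSum.pi (AlgEquiv.refl (R := ℝ) (A₁ := Fin s → K)) IsMatrixSum.self

theorem isMatrixSum_complex_tensor_complex : IsMatrixSum (ℂ ⊗[ℝ] ℂ) 2 ℂ := by
  let F : ℂ ⊗[ℝ] ℂ →ₐ[ℝ] (Fin 2 → ℂ) :=
    Algebra.TensorProduct.lift (Pi.constAlgHom ℝ (Fin 2) ℂ)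
      (AlgHom.pi ![AlgHom.id ℝ ℂ, Complex.conjAe.toAlgHom]) (fun _ _ => Commute.all _ _)
  refine isMatrixSum_of_surjective F ?_ (by rw [Module.finrank_tensorProduct, Module.finrank_pi_fintype]; simp) (isMatrixSum_pi_self 2 ℂ)
  intro v
  -- The elements `(1 ⊗ 1 ∓ i ⊗ i) / 2` are the idempotents mapping to the two coordinate vectors;
  -- the witness is the combination of them with coefficients `v 0` and `v 1`.
  refine ⟨(v 0 / 2) ⊗ₜ 1 - (v 0 / 2 * Complex.I) ⊗ₜ Complex.I + (v 1 / 2) ⊗ₜ 1 +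
    (v 1 / 2 * Complex.I) ⊗ₜ Complex.I, ?_⟩
  ext i
  fin_cases i
  · simp [F]
    linear_combination (v 1 / 2 - v 0 / 2) * Complex.I_mul_I
  · simp [F]
    linear_combination (v 0 / 2 - v 1 / 2) * Complex.I_mul_I

/-- The complex coordinates of a quaternion `c₁ + c₂ j`. -/
def quatFst (x : Quaternion ℝ) : ℂ := ⟨x.re, x.imI⟩

/-- The complex coordinates of a quaternion `c₁ + c₂ j`. -/
def quatSnd (x : Quaternion ℝ) : ℂ := ⟨x.imJ, x.imK⟩

theorem quatFst_mul (x y : Quaternion ℝ) :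
    quatFst (x * y) = quatFst x * quatFst y - quatSnd x * star (quatSnd y) := by
  apply Complex.ext <;> simp [quatFst, quatSnd, Complex.mul_re, Complex.mul_im] <;> ring

theorem quatSnd_mul (x y : Quaternion ℝ) :
    quatSnd (x * y) = quatFst x * quatSnd y + quatSnd x * star (quatFst y) := by
  apply Complex.ext <;> simp [quatFst, quatSnd, Complex.mul_re, Complex.mul_im] <;> ring

/-- The embedding of the quaternions into complex `2 × 2` matrices. -/
def quatToMatrix : Quaternion ℝ →ₐ[ℝ] Matrix (Fin 2) (Fin 2) ℂ :=
  AlgHom.ofLinearMap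
    { toFun := fun x => !![quatFst x, quatSnd x; -star (quatSnd x), star (quatFst x)]
      map_add' := fun x y => by
        ext i j; fin_cases i <;> fin_cases j <;> apply Complex.ext <;> simp [quatFst, quatSnd] <;> ring
      map_smul' := fun r x => by
        ext i j; fin_cases i <;> fin_cases j <;> apply Complex.ext <;> simp [quatFst, quatSnd] }
    (by
      ext i j; fin_cases i <;> fin_cases j <;> apply Complex.ext <;> simp [quatFst, quatSnd])
    (fun x y => by
      simp only [LinearMap.coe_mk, AddHom.coe_mk, Matrix.mul_fin_two, quatFst_mul, quatSnd_mul]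
      ext i j; fin_cases i <;> fin_cases j <;> simp <;> ring)

theorem quatToMatrix_apply (x : Quaternion ℝ) :
    quatToMatrix x = !![quatFst x, quatSnd x; -star (quatSnd x), star (quatFst x)] := rfl

theorem isMatrixSum_complex_tensor_quaternion : IsMatrixSum (ℂ ⊗[ℝ] Quaternion ℝ) 1 ℂ := by
  let F : ℂ ⊗[ℝ] Quaternion ℝ →ₐ[ℝ] Matrix (Fin 2) (Fin 2) ℂ :=
    Algebra.TensorProduct.lift (Algebra.algHom ℝ ℂ (Matrix (Fin 2) (Fin 2) ℂ)) quatToMatrix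
      (fun x y => Algebra.commute_algebraMap_left _ _)
  have hd : Module.finrank ℝ (ℂ ⊗[ℝ] Quaternion ℝ) = Module.finrank ℝ (Matrix (Fin 2) (Fin 2) ℂ) := by
    rw [Module.finrank_tensorProduct, Module.finrank_matrix, Quaternion.finrank_eq_four]
    simp
  refine isMatrixSum_of_surjective F ?_ hd (IsMatrixSum.matrix IsMatrixSum.self)
  intro M
  -- The images of `1, i, j, k` form a basis of the complex 2 by 2 matrices, and the left tensor
  -- factors are the coordinates of `M` in it.
  refine ⟨((M 0 0 + M 1 1) / 2) ⊗ₜ 1 + (-(M 0 0 - M 1 1) / 2 * Complex.I) ⊗ₜ (quat 0 1 0 0)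
    + ((M 0 1 - M 1 0) / 2) ⊗ₜ (quat 0 0 1 0) + (-(M 0 1 + M 1 0) / 2 * Complex.I) ⊗ₜ (quat 0 0 0 1), ?_⟩
  have h0 : (⟨0, 0⟩ : ℂ) = 0 := rfl
  have h1 : (⟨1, 0⟩ : ℂ) = 1 := rfl
  have h2 : (⟨0, 1⟩ : ℂ) = Complex.I := rfl
  have hF : ∀ x y, F (x ⊗ₜ y) = algebraMap ℂ _ x * quatToMatrix y := fun x y => rfl
  have h1 : quatToMatrix (quat 0 1 0 0) = !![Complex.I, 0; 0, -Complex.I] := by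
    rw [quatToMatrix_apply]
    ext i j; fin_cases i <;> fin_cases j <;> apply Complex.ext <;> simp [quatFst, quatSnd]
  have h2 : quatToMatrix (quat 0 0 1 0) = !![0, 1; -1, 0] := by
    rw [quatToMatrix_apply]
    ext i j; fin_cases i <;> fin_cases j <;> apply Complex.ext <;> simp [quatFst, quatSnd]
  have h3 : quatToMatrix (quat 0 0 0 1) = !![0, Complex.I; Complex.I, 0] := by
    rw [quatToMatrix_apply]
    ext i j; fin_cases i <;> fin_cases j <;> apply Complex.ext <;> simp [quatFst, quatSnd]
  simp only [map_add, hF, h1, h2, h3, map_one, mul_one]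
  ext i j
  fin_cases i <;> fin_cases j <;>
    simp [Matrix.algebraMap_matrix_apply, Matrix.mul_apply]
  · linear_combination (-(M 0 0 - M 1 1) / 2) * Complex.I_mul_I
  · linear_combination (-(M 0 1 + M 1 0) / 2) * Complex.I_mul_I
  · linear_combination (-(M 0 1 + M 1 0) / 2) * Complex.I_mul_I
  · linear_combination ((M 0 0 - M 1 1) / 2) * Complex.I_mul_I

theorem exists_quaternion_tensor (t : Quaternion ℝ ⊗[ℝ] Quaternion ℝ) :
    ∃ a b c d : Quaternion ℝ, t = a ⊗ₜ 1 + b ⊗ₜ (quat 0 1 0 0) + c ⊗ₜ (quat 0 0 1 0) +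
      d ⊗ₜ (quat 0 0 0 1) := by
  induction t using TensorProduct.induction_on with
  | zero => exact ⟨0, 0, 0, 0, by simp⟩
  | tmul x y =>
    refine ⟨y.re • x, y.imI • x, y.imJ • x, y.imK • x, ?_⟩
    rw [TensorProduct.smul_tmul, TensorProduct.smul_tmul, TensorProduct.smul_tmul,
      TensorProduct.smul_tmul, ← TensorProduct.tmul_add, ← TensorProduct.tmul_add,
      ← TensorProduct.tmul_add]
    congr 1
    ext <;> simp
  | add x y hx hy =>
    obtain ⟨a, b, c, d, rfl⟩ := hx
    obtain ⟨a', b', c', d', rfl⟩ := hy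
    refine ⟨a + a', b + b', c + c', d + d', ?_⟩
    simp only [TensorProduct.add_tmul]
    abel

/-- The quaternions act on themselves on the left and, through conjugation, on the right. These
commuting actions give a map to the real endomorphisms of a four-dimensional space, and both sides
have dimension 16. -/
theorem isMatrixSum_quaternion_tensor_quaternion :
    IsMatrixSum (Quaternion ℝ ⊗[ℝ] Quaternion ℝ) 1 ℝ := by
  let F : Quaternion ℝ ⊗[ℝ] Quaternion ℝ →ₐ[ℝ] Module.End ℝ (Quaternion ℝ) :=
    Algebra.TensorProduct.lift (Algebra.lmul ℝ (Quaternion ℝ))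
      (AlgHom.ofLinearMap
        { toFun := fun y => LinearMap.mulRight ℝ (star y)
          map_add' := fun x y => by ext1 v; simp [mul_add]
          map_smul' := fun r x => by ext1 v; simp }
        (by ext1 v; simp) (fun x y => by ext1 v; simp [mul_assoc]))
      (fun x y => by
        change _ * _ = _ * _
        ext1 v; simp [mul_assoc])
  have hF : ∀ x y v, F (x ⊗ₜ y) v = x * (v * star y) := fun x y v => rfl
  have hd : Module.finrank ℝ (Quaternion ℝ ⊗[ℝ] Quaternion ℝ) =
      Module.finrank ℝ (Module.End ℝ (Quaternion ℝ)) := by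
    rw [Module.finrank_tensorProduct, Module.finrank_linearMap]
  have hb : IsMatrixSum (Module.End ℝ (Quaternion ℝ)) 1 ℝ :=
    (IsMatrixSum.matrix IsMatrixSum.self).of_equiv
      (algEquivMatrix (Module.finBasisOfFinrankEq ℝ (Quaternion ℝ) Quaternion.finrank_eq_four))
  refine isMatrixSum_of_injective F ?_ hd hb
  rw [injective_iff_map_eq_zero]
  intro t ht
  obtain ⟨a, b, c, d, rfl⟩ := exists_quaternion_tensor t
  -- An element of the kernel is written in coordinates of its right factor; testing on `1, i, j, k`
  -- gives sixteen linear equations that force all coordinates to vanish.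
  have key : ∀ v, a * v - b * (v * quat 0 1 0 0) - c * (v * quat 0 0 1 0) - d * (v * quat 0 0 0 1) = 0 := by
    intro v
    have := LinearMap.congr_fun ht v
    simp only [map_add, LinearMap.add_apply, hF, star_one, mul_one, LinearMap.zero_apply] at this
    have h1 : star (quat 0 1 0 0) = -quat 0 1 0 0 := by ext <;> simp
    have h2 : star (quat 0 0 1 0) = -quat 0 0 1 0 := by ext <;> simp
    have h3 : star (quat 0 0 0 1) = -quat 0 0 0 1 := by ext <;> simp
    rw [h1, h2, h3] at this
    simpa [sub_eq_add_neg] using this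
  have e := key 1
  have ei := key (quat 0 1 0 0)
  have ej := key (quat 0 0 1 0)
  have ek := key (quat 0 0 0 1)
  simp only [Quaternion.ext_iff, Quaternion.re_mul, Quaternion.imI_mul, Quaternion.imJ_mul, Quaternion.imK_mul,
    Quaternion.re_sub, Quaternion.imI_sub, Quaternion.imJ_sub, Quaternion.imK_sub, quat_re, quat_imI,
    quat_imJ, quat_imK, Quaternion.re_one, Quaternion.imI_one, Quaternion.imJ_one, Quaternion.imK_one,
    Quaternion.re_zero, Quaternion.imI_zero, Quaternion.imJ_zero, Quaternion.imK_zero, mul_zero, mul_one,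
    sub_zero, zero_sub, add_zero, zero_add, mul_neg, neg_zero, sub_neg_eq_add, neg_neg] at e ei ej ek
  obtain ⟨e1, e2, e3, e4⟩ := e
  obtain ⟨f1, f2, f3, f4⟩ := ei
  obtain ⟨g1, g2, g3, g4⟩ := ej
  obtain ⟨h1, h2, h3, h4⟩ := ek
  have ha : a = 0 := by ext <;> simp <;> linarith
  have hb : b = 0 := by ext <;> simp <;> linarith
  have hc : c = 0 := by ext <;> simp <;> linarith
  have hd : d = 0 := by ext <;> simp <;> linarith
  simp [ha, hb, hc, hd]

end TensorDivision

end

section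

/-! ### Clifford algebras with at most two generators. -/

section LowDimensional

/-- A Clifford algebra on two generators is a quaternion algebra. -/
def Cl.equivQuaternionAlgebra (a b : ℝ) : Cl ![a, b] ≃ₐ[ℝ] QuaternionAlgebra ℝ a 0 b :=
  AlgEquiv.ofAlgHom
    (Cl.lift ![a, b] ![(QuaternionAlgebra.Basis.self ℝ).i, (QuaternionAlgebra.Basis.self ℝ).j]
      (by intro i; fin_cases i <;> ext <;> simp)
      (by intro i j hij; fin_cases i <;> fin_cases j <;> first | exact absurd rfl hij | (ext <;> simp)))
    (QuaternionAlgebra.lift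
      { i := Cl.gen _ 0
        j := Cl.gen _ 1
        k := Cl.gen _ 0 * Cl.gen _ 1
        i_mul_i := by rw [Cl.gen_sq]; simp [Algebra.algebraMap_eq_smul_one]
        j_mul_j := by rw [Cl.gen_sq]; simp [Algebra.algebraMap_eq_smul_one]
        i_mul_j := rfl
        j_mul_i := by rw [Cl.gen_anticomm _ (by decide : (1 : Fin 2) ≠ 0)]; simp })
    (by
      apply QuaternionAlgebra.hom_ext
      · simp [QuaternionAlgebra.lift, QuaternionAlgebra.Basis.lift]
      · simp [QuaternionAlgebra.lift, QuaternionAlgebra.Basis.lift])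
    (Cl.hom_ext fun i => by
      fin_cases i <;> simp [QuaternionAlgebra.lift, QuaternionAlgebra.Basis.lift])

/-- The split quaternion algebras are matrix algebras. -/
def splitQuaternionEquiv (c : ℝ) (hc : c * c = 1) :
    QuaternionAlgebra ℝ 1 0 c ≃ₐ[ℝ] Matrix (Fin 2) (Fin 2) ℝ :=
  AlgEquiv.ofLinearEquiv
    -- Here `i` becomes `diag(1, -1)` and `j` the antidiagonal matrix with entries `1` and `c`,
    -- which squares to `c`. The condition on `c` matters only for the inverse, where `c` stands in
    -- for `1 / c`.
    { toFun := fun x => !![x.re + x.imI, x.imJ + x.imK; c * (x.imJ - x.imK), x.re - x.imI]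
      invFun := fun M => ⟨(M 0 0 + M 1 1) / 2, (M 0 0 - M 1 1) / 2, (M 0 1 + c * M 1 0) / 2,
        (M 0 1 - c * M 1 0) / 2⟩
      map_add' := fun x y => by
        ext i j; fin_cases i <;> fin_cases j <;> simp <;> ring
      map_smul' := fun r x => by
        ext i j; fin_cases i <;> fin_cases j <;> simp <;> ring
      left_inv := fun x => by
        ext
        · simp
        · simp
        · simp only [Matrix.of_apply, Matrix.cons_val', Matrix.cons_val_zero, Matrix.cons_val_one,
            Matrix.cons_val_fin_one]
          linear_combination (x.imJ - x.imK) / 2 * hc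
        · simp only [Matrix.of_apply, Matrix.cons_val', Matrix.cons_val_zero, Matrix.cons_val_one,
            Matrix.cons_val_fin_one]
          linear_combination -(x.imJ - x.imK) / 2 * hc
      right_inv := fun M => by
        ext i j; fin_cases i <;> fin_cases j <;> simp
        all_goals first | ring1 | linear_combination M 1 0 * hc }
    (by ext i j; fin_cases i <;> fin_cases j <;> simp)
    (fun x y => by
      ext i j; fin_cases i <;> fin_cases j <;> simp <;> ring)

theorem isMatrixSum_cl_pos (c : ℝ) (hc : c * c = 1) : IsMatrixSum (Cl ![1, c]) 1 ℝ :=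
  (IsMatrixSum.matrix IsMatrixSum.self).of_equiv
    ((Cl.equivQuaternionAlgebra 1 c).trans (splitQuaternionEquiv c hc))

theorem isMatrixSum_cl_neg : IsMatrixSum (Cl ![-1, -1]) 1 (Quaternion ℝ) :=
  IsMatrixSum.self.of_equiv (Cl.equivQuaternionAlgebra (-1) (-1))

/-- The Clifford algebra without generators. -/
def Cl.equivOfIsEmpty {ι : Type} [Fintype ι] [DecidableEq ι] [IsEmpty ι] (w : ι → ℝ) :
    Cl w ≃ₐ[ℝ] ℝ :=
  AlgEquiv.ofAlgHom (Cl.lift w isEmptyElim isEmptyElim isEmptyElim) (Algebra.ofId ℝ _)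
    (by ext) (Cl.hom_ext isEmptyElim)

/-- The Clifford algebra with one generator of square `-1`. -/
def Cl.equivComplex {ι : Type} [Fintype ι] [DecidableEq ι] [Unique ι] (w : ι → ℝ) (hw : w default = -1) :
    Cl w ≃ₐ[ℝ] ℂ :=
  AlgEquiv.ofAlgHom
    (Cl.lift w (fun _ => Complex.I) (fun i => by rw [Unique.eq_default i, hw]; simp)
      (fun i j h => absurd (Subsingleton.elim i j) h))
    (Complex.lift ⟨Cl.gen w default, by rw [Cl.gen_sq, hw]; simp⟩)
    (by apply Complex.algHom_ext; simp)
    (Cl.hom_ext fun i => by rw [Unique.eq_default i]; simp)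

/-- The Clifford algebra with one generator of square `1`. -/
def Cl.equivProd {ι : Type} [Fintype ι] [DecidableEq ι] [Unique ι] (w : ι → ℝ) (hw : w default = 1) :
    Cl w ≃ₐ[ℝ] (Fin 2 → ℝ) := by
  have hg : Cl.gen w default * Cl.gen w default = 1 := by rw [Cl.gen_sq, hw, map_one]
  -- The two coordinates multiply the idempotents `(1 + g) / 2` and `(1 - g) / 2`.
  let G : (Fin 2 → ℝ) →ₗ[ℝ] Cl w :=
    { toFun := fun v => ((v 0 + v 1) / 2) • 1 + ((v 0 - v 1) / 2) • Cl.gen w default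
      map_add' := fun v v' => by simp only [Pi.add_apply]; module
      map_smul' := fun r v => by simp only [Pi.smul_apply, smul_eq_mul, RingHom.id_apply]; module }
  refine AlgEquiv.ofAlgHom
    (Cl.lift w (fun _ => ![1, -1]) (fun i => by
        rw [Unique.eq_default i, hw]; ext j; fin_cases j <;> simp)
      (fun i j h => absurd (Subsingleton.elim i j) h))
    (AlgHom.ofLinearMap G (by simp [G]) (fun v v' => ?_)) ?_ ?_
  · simp only [G, LinearMap.coe_mk, AddHom.coe_mk, Pi.mul_apply, add_mul, mul_add, smul_mul_smul_comm,
      one_mul, mul_one, hg]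
    module
  · apply AlgHom.ext
    intro v
    ext j
    fin_cases j
    · simp [G]
      ring
    · simp [G]
      ring
  · refine Cl.hom_ext fun i => ?_
    rw [Unique.eq_default i]
    simp [G]

end LowDimensional

/-! ### Eight-fold periodicity. -/

section Classification

open Quaternion

/-- The type of a sum of matrix algebras prescribed by the residue of `d` modulo `8`. -/
def HasCliffordType (A : Type) [Ring A] [Algebra ℝ A] (d : ℕ) : Prop :=
  ((d % 8 = 0 ∨ d % 8 = 2) → IsMatrixSum A 1 ℝ) ∧ (d % 8 = 1 → IsMatrixSum A 2 ℝ) ∧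
  ((d % 8 = 3 ∨ d % 8 = 7) → IsMatrixSum A 1 ℂ) ∧
  ((d % 8 = 4 ∨ d % 8 = 6) → IsMatrixSum A 1 (Quaternion ℝ)) ∧
  (d % 8 = 5 → IsMatrixSum A 2 (Quaternion ℝ))

variable {A B : Type} [Ring A] [Algebra ℝ A] [Ring B] [Algebra ℝ B]

theorem HasCliffordType.of_equiv {d : ℕ} (e : A ≃ₐ[ℝ] B) (h : HasCliffordType B d) :
    HasCliffordType A d :=
  ⟨fun k => (h.1 k).of_equiv e, fun k => (h.2.1 k).of_equiv e, fun k => (h.2.2.1 k).of_equiv e,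
    fun k => (h.2.2.2.1 k).of_equiv e, fun k => (h.2.2.2.2 k).of_equiv e⟩

/-- Real matrix coefficients leave the type unchanged, and the type table is symmetric under `d ↦ 2
- d`; the second index is stated in the reflected form in which the induction produces it. -/
theorem HasCliffordType.real_tensor {d d' : ℕ} (hA : IsMatrixSum A 1 ℝ) (hB : HasCliffordType B d)
    (h : (d + d') % 8 = 2) : HasCliffordType (A ⊗[ℝ] B) d' := by
  obtain ⟨h1, h2, h3, h4, h5⟩ := hB
  refine ⟨fun k => ?_, fun k => ?_, fun k => ?_, fun k => ?_, fun k => ?_⟩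
  · exact hA.tensor (h1 (by omega)) (isMatrixSum_tensor_real _)
  · exact hA.tensor (h2 (by omega)) (isMatrixSum_tensor_real _)
  · exact hA.tensor (h3 (by omega)) (isMatrixSum_tensor_real _)
  · exact hA.tensor (h4 (by omega)) (isMatrixSum_tensor_real _)
  · exact hA.tensor (h5 (by omega)) (isMatrixSum_tensor_real _)

/-- Tensoring with `ℍ` exchanges `ℝ` with `ℍ` and keeps `ℂ`, up to matrices. On residues this is `d
↦ 6 - d`, which exchanges `{0, 2}` with `{4, 6}` and `1` with `5`, and fixes `3` and `7`. -/
theorem HasCliffordType.quaternion_tensor {d d' : ℕ} (hA : IsMatrixSum A 1 (Quaternion ℝ))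
    (hB : HasCliffordType B d) (h : (d + d') % 8 = 6) : HasCliffordType (A ⊗[ℝ] B) d' := by
  obtain ⟨h1, h2, h3, h4, h5⟩ := hB
  refine ⟨fun k => ?_, fun k => ?_, fun k => ?_, fun k => ?_, fun k => ?_⟩
  · exact hA.tensor (h4 (by omega)) isMatrixSum_quaternion_tensor_quaternion
  · exact hA.tensor (h5 (by omega)) isMatrixSum_quaternion_tensor_quaternion
  · exact hA.tensor (h3 (by omega)) isMatrixSum_complex_tensor_quaternion
  · exact hA.tensor (h1 (by omega)) (isMatrixSum_real_tensor _)
  · exact hA.tensor (h2 (by omega)) (isMatrixSum_real_tensor _)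

/-- The coefficients of a diagonal form of signature `(r, s)`. -/
def sig (r s : ℕ) : Fin r ⊕ Fin s → ℝ := Sum.elim (fun _ => 1) (fun _ => -1)

theorem hasCliffordType_of_isMatrixSum_real {d : ℕ} (h : IsMatrixSum A 1 ℝ) (hd : d % 8 = 0) :
    HasCliffordType A d :=
  ⟨fun _ => h, fun k => by omega, fun k => by omega, fun k => by omega, fun k => by omega⟩

/-- The type depends on `r - s` modulo 8, written `r + 7 s` to stay in the natural numbers.
Splitting off two generators of equal sign reverses the signs of the others: two positive ones leave
signature `(s, r - 2)` tensored with real matrices, two negative ones leave `(s - 2, r)` tensored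
with `ℍ`. The cases `r, s ≤ 1` start the induction. -/
theorem hasCliffordType_cl (r s : ℕ) : HasCliffordType (Cl (sig r s)) (r + 7 * s) := by
  induction hn : r + s using Nat.strong_induction_on generalizing r s with
  | _ n ih =>
  by_cases hr : 2 ≤ r
  · obtain ⟨r', rfl⟩ := Nat.exists_eq_add_of_le hr
    have ht := HasCliffordType.real_tensor (isMatrixSum_cl_pos 1 (by norm_num))
      (ih (s + r') (by omega) s r' rfl) (d' := 2 + r' + 7 * s) (by omega)
    refine ht.of_equiv (AlgEquiv.trans (AlgEquiv.symm (Cl.congr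
      (((Equiv.refl (Fin 2)).sumCongr (Equiv.sumComm (Fin s) (Fin r'))).trans
        ((Equiv.sumAssoc _ _ _).symm.trans (finSumFinEquiv.sumCongr (Equiv.refl _)))) ?_))
      (Cl.splitTwo ![1, 1] (by intro i; fin_cases i <;> simp) (sig s r')))
    rintro (i | i | i)
    · fin_cases i <;> simp [sig]
    · simp [sig]
    · simp [sig]
  by_cases hs : 2 ≤ s
  · obtain ⟨s', rfl⟩ := Nat.exists_eq_add_of_le hs
    have ht := HasCliffordType.quaternion_tensor isMatrixSum_cl_neg
      (ih (s' + r) (by omega) s' r rfl) (d' := r + 7 * (2 + s')) (by omega)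
    refine ht.of_equiv (AlgEquiv.trans (AlgEquiv.symm (Cl.congr
      ((Equiv.sumAssoc _ _ _).symm.trans ((finSumFinEquiv.sumCongr (Equiv.refl _)).trans
        (Equiv.sumComm _ _))) ?_))
      (Cl.splitTwo ![-1, -1] (by intro i; fin_cases i <;> simp) (sig s' r)))
    rintro (i | i | i)
    · fin_cases i <;> simp [sig]
    · simp [sig]
    · simp [sig]
  obtain rfl | rfl : r = 0 ∨ r = 1 := by omega
  · obtain rfl | rfl : s = 0 ∨ s = 1 := by omega
    · exact hasCliffordType_of_isMatrixSum_real
        (IsMatrixSum.self.of_equiv (Cl.equivOfIsEmpty _)) (by norm_num)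
    · have : IsMatrixSum (Cl (sig 0 1)) 1 ℂ :=
        IsMatrixSum.self.of_equiv ((Cl.congr (w' := fun _ : Fin 1 => -1) (Equiv.emptySum _ _) (by
          rintro (i | i)
          · exact i.elim0
          · simp [sig])).trans (Cl.equivComplex _ rfl))
      exact ⟨fun k => by omega, fun k => by omega, fun _ => this, fun k => by omega, fun k => by omega⟩
  · obtain rfl | rfl : s = 0 ∨ s = 1 := by omega
    · have : IsMatrixSum (Cl (sig 1 0)) 2 ℝ :=
        (isMatrixSum_pi_self 2 ℝ).of_equiv ((Cl.congr (w' := fun _ : Fin 1 => 1) (Equiv.sumEmpty _ _) (by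
          rintro (i | i)
          · simp [sig]
          · exact i.elim0)).trans (Cl.equivProd _ rfl))
      exact ⟨fun k => by omega, fun _ => this, fun k => by omega, fun k => by omega, fun k => by omega⟩
    · refine hasCliffordType_of_isMatrixSum_real ((isMatrixSum_cl_pos (-1) (by norm_num)).of_equiv
        (Cl.congr finSumFinEquiv ?_)) (by norm_num)
      rintro (i | i)
      · fin_cases i; rfl
      · fin_cases i; rfl

end Classification

end

section

/-! ### Products of anticommuting elements. -/

section AnticommutingProduct

variable {A : Type} [Ring A]

theorem commute_prod_ofFn {n : ℕ} (g : Fin n → A) (x : A) (h : ∀ i, x * g i = g i * x) :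
    x * (List.ofFn g).prod = (List.ofFn g).prod * x :=
  Commute.list_prod_right (List.ofFn g) x fun y hy => by
    obtain ⟨i, rfl⟩ := (List.mem_ofFn' g y).1 hy
    exact h i

theorem anticommute_prod_ofFn {n : ℕ} (g : Fin n → A) (x : A) (h : ∀ i, x * g i = -(g i * x)) :
    x * (List.ofFn g).prod = (-1) ^ n * ((List.ofFn g).prod * x) := by
  induction n with
  | zero => simp
  | succ n ih =>
    rw [List.ofFn_succ, List.prod_cons, ← mul_assoc, h, neg_mul, mul_assoc, ih _ fun i => h i.succ,
      pow_succ]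
    rcases neg_one_pow_eq_or A n with h | h <;> rw [h] <;> simp [mul_assoc]

/-- Peeling off the first factor from a product of `n + 1` elements, `(g₀ P)² = (-1)^n P²`, because
`g₀` passes `n` anticommuting factors. The accumulated sign has period 4. -/
theorem prod_ofFn_sq {n : ℕ} (g : Fin n → A) (hsq : ∀ i, g i * g i = 1)
    (hanti : ∀ i j, i ≠ j → g i * g j = -(g j * g i)) :
    (List.ofFn g).prod * (List.ofFn g).prod = if n % 4 < 2 then 1 else -1 := by
  induction n with
  | zero => simp
  | succ n ih =>
    have h1 := anticommute_prod_ofFn (fun i => g (Fin.succ i)) (g 0)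
      (fun i => hanti _ _ (Fin.succ_ne_zero i).symm)
    have h2 := ih (fun i => g i.succ) (fun i => hsq _)
      (fun i j hij => hanti _ _ (Fin.succ_injective _ |>.ne hij))
    rw [List.ofFn_succ, List.prod_cons]
    set P := (List.ofFn fun i => g (Fin.succ i)).prod
    have h3 : g 0 * P * (g 0 * P) = (-1) ^ n * (P * P) := by
      have : P * g 0 = (-1) ^ n * (g 0 * P) := by
        rw [h1, ← mul_assoc, ← pow_add, ← two_mul, pow_mul]; simp
      rw [mul_assoc, ← mul_assoc P, this]
      rcases neg_one_pow_eq_or A n with h | h <;> rw [h] <;>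
        simp only [one_mul, neg_mul, mul_neg] <;> rw [← mul_assoc, ← mul_assoc, hsq, one_mul]
    rw [h3, h2]
    have h4 : n % 4 = 0 ∨ n % 4 = 1 ∨ n % 4 = 2 ∨ n % 4 = 3 := by omega
    rcases h4 with h | h | h | h
    · have : Even n := Nat.even_iff.2 (by omega)
      rw [this.neg_one_pow, if_pos (by omega), if_pos (by omega), one_mul]
    · have : Odd n := Nat.odd_iff.2 (by omega)
      rw [this.neg_one_pow, if_pos (by omega), if_neg (by omega), mul_one]
    · have : Even n := Nat.even_iff.2 (by omega)
      rw [this.neg_one_pow, if_neg (by omega), if_neg (by omega), one_mul]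
    · have : Odd n := Nat.odd_iff.2 (by omega)
      rw [this.neg_one_pow, if_neg (by omega), if_pos (by omega)]; simp

/-- A factor anticommutes with the `n - 1` others and commutes with itself. The exponent `n + 1` has
the parity of `n - 1` and avoids truncated subtraction. -/
theorem gen_mul_prod_ofFn {n : ℕ} (g : Fin n → A) (hanti : ∀ i j, i ≠ j → g i * g j = -(g j * g i))
    (i : Fin n) : g i * (List.ofFn g).prod = (-1) ^ (n + 1) * ((List.ofFn g).prod * g i) := by
  induction n with
  | zero => exact i.elim0
  | succ n ih =>
    rw [List.ofFn_succ, List.prod_cons]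
    refine Fin.cases ?_ (fun i => ?_) i
    · have h1 := anticommute_prod_ofFn (fun i => g (Fin.succ i)) (g 0)
        (fun i => hanti _ _ (Fin.succ_ne_zero i).symm)
      set P := (List.ofFn fun i => g (Fin.succ i)).prod
      have : P * g 0 = (-1) ^ n * (g 0 * P) := by
        rw [h1, ← mul_assoc, ← pow_add, ← two_mul, pow_mul]; simp
      rw [mul_assoc (g 0) P, this, pow_add, pow_add]
      rcases neg_one_pow_eq_or A n with h | h <;> rw [h] <;> simp
    · have h1 := ih (fun i => g i.succ) (fun i j hij => hanti _ _ (Fin.succ_injective _ |>.ne hij)) i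
      rw [← mul_assoc, hanti _ _ (Fin.succ_ne_zero i), neg_mul, mul_assoc, h1, pow_succ _ (n + 1)]
      rcases neg_one_pow_eq_or A (n + 1) with h | h <;> rw [h] <;> simp [mul_assoc]

end AnticommutingProduct

/-! ### Generators of the tensor product and its universal property. -/

section Generators

variable {p q : ℕ}

theorem e_inl (i : Fin p) : e p q (.inl i) = (Cl.gen (fun _ : Fin p => (1 : ℝ)) i) ⊗ₜ[ℝ] 1 := rfl

theorem e_inr (j : Fin q) : e p q (.inr j) = 1 ⊗ₜ[ℝ] (Cl.gen (fun _ : Fin q => (1 : ℝ)) j) := rfl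

theorem e_sq (i : Fin p ⊕ Fin q) : e p q i * e p q i = 1 := by
  rcases i with i | i
  · rw [e_inl, Algebra.TensorProduct.tmul_mul_tmul, Cl.gen_sq, map_one, mul_one]; rfl
  · rw [e_inr, Algebra.TensorProduct.tmul_mul_tmul, Cl.gen_sq, map_one, mul_one]; rfl

theorem e_inl_anticomm {i j : Fin p} (h : i ≠ j) :
    e p q (.inl i) * e p q (.inl j) = -(e p q (.inl j) * e p q (.inl i)) := by
  simp only [e_inl, Algebra.TensorProduct.tmul_mul_tmul]
  rw [Cl.gen_anticomm _ h, TensorProduct.neg_tmul]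

theorem e_inr_anticomm {i j : Fin q} (h : i ≠ j) :
    e p q (.inr i) * e p q (.inr j) = -(e p q (.inr j) * e p q (.inr i)) := by
  simp only [e_inr, Algebra.TensorProduct.tmul_mul_tmul]
  rw [Cl.gen_anticomm _ h, TensorProduct.tmul_neg]

theorem e_inl_inr_comm (i : Fin p) (j : Fin q) :
    e p q (.inl i) * e p q (.inr j) = e p q (.inr j) * e p q (.inl i) := by
  simp only [e_inl, e_inr, Algebra.TensorProduct.tmul_mul_tmul, one_mul, mul_one]

theorem adjoin_e : Algebra.adjoin ℝ (Set.range (e p q)) = ⊤ := by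
  rw [eq_top_iff]
  intro x _
  have hl : ∀ a : CliffordAlgebra (sumSq p), a ⊗ₜ[ℝ] (1 : CliffordAlgebra (sumSq q)) ∈
      Algebra.adjoin ℝ (Set.range (e p q)) := by
    intro a
    have : (⊤ : Subalgebra ℝ _) ≤ (Algebra.adjoin ℝ (Set.range (e p q))).comap
        (Algebra.TensorProduct.includeLeft : CliffordAlgebra (sumSq p) →ₐ[ℝ] R p q) := by
      rw [← Cl.adjoin_gen (fun _ : Fin p => (1 : ℝ))]
      apply Algebra.adjoin_le
      rintro _ ⟨i, rfl⟩
      exact Algebra.subset_adjoin (Set.mem_range_self (f := e p q) (.inl i))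
    exact this (x := a) trivial
  have hr : ∀ a : CliffordAlgebra (sumSq q), (1 : CliffordAlgebra (sumSq p)) ⊗ₜ[ℝ] a ∈
      Algebra.adjoin ℝ (Set.range (e p q)) := by
    intro a
    have : (⊤ : Subalgebra ℝ _) ≤ (Algebra.adjoin ℝ (Set.range (e p q))).comap
        (Algebra.TensorProduct.includeRight : CliffordAlgebra (sumSq q) →ₐ[ℝ] R p q) := by
      rw [← Cl.adjoin_gen (fun _ : Fin q => (1 : ℝ))]
      apply Algebra.adjoin_le
      rintro _ ⟨i, rfl⟩
      exact Algebra.subset_adjoin (Set.mem_range_self (f := e p q) (.inr i))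
    exact this (x := a) trivial
  induction x using TensorProduct.induction_on with
  | zero => exact Subalgebra.zero_mem _
  | add x y hx hy => exact Subalgebra.add_mem _ (hx trivial) (hy trivial)
  | tmul a b =>
    have : a ⊗ₜ[ℝ] b = (a ⊗ₜ[ℝ] (1 : CliffordAlgebra (sumSq q))) *
        ((1 : CliffordAlgebra (sumSq p)) ⊗ₜ[ℝ] b) := by
      rw [Algebra.TensorProduct.tmul_mul_tmul, one_mul, mul_one]
    rw [this]
    exact Subalgebra.mul_mem _ (hl a) (hr b)

/-- An induction principle for `R_{p,q}` in terms of its generators. -/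
theorem R_induction {P : R p q → Prop} (halg : ∀ r, P (algebraMap ℝ _ r)) (hgen : ∀ i, P (e p q i))
    (hadd : ∀ x y, P x → P y → P (x + y)) (hmul : ∀ x y, P x → P y → P (x * y)) (x : R p q) : P x := by
  have hx : x ∈ Algebra.adjoin ℝ (Set.range (e p q)) := by rw [adjoin_e]; trivial
  induction hx using Algebra.adjoin_induction with
  | mem x hx => obtain ⟨i, rfl⟩ := hx; exact hgen i
  | algebraMap r => exact halg r
  | add x y _ _ h h' => exact hadd x y h h'
  | mul x y _ _ h h' => exact hmul x y h h'

/-- The universal properties of the two Clifford factors give two homomorphisms; their images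
commute because their generators do, so they combine on the tensor product. -/
theorem exists_R_lift {B : Type} [Ring B] [Algebra ℝ B] (b : Fin p ⊕ Fin q → B)
    (hsq : ∀ i, b i * b i = 1)
    (hl : ∀ i j, i ≠ j → b (.inl i) * b (.inl j) = -(b (.inl j) * b (.inl i)))
    (hr : ∀ i j, i ≠ j → b (.inr i) * b (.inr j) = -(b (.inr j) * b (.inr i)))
    (hc : ∀ i j, b (.inl i) * b (.inr j) = b (.inr j) * b (.inl i)) :
    ∃ f : R p q →ₐ[ℝ] B, ∀ i, f (e p q i) = b i := by
  let f1 : CliffordAlgebra (sumSq p) →ₐ[ℝ] B := Cl.lift (fun _ => (1 : ℝ)) (fun i => b (.inl i))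
    (fun i => by rw [hsq, map_one]) hl
  let f2 : CliffordAlgebra (sumSq q) →ₐ[ℝ] B := Cl.lift (fun _ => (1 : ℝ)) (fun i => b (.inr i))
    (fun i => by rw [hsq, map_one]) hr
  have hf1 : ∀ i, f1 (Cl.gen (fun _ => (1 : ℝ)) i) = b (.inl i) := fun i => Cl.lift_gen ..
  have hf2 : ∀ i, f2 (Cl.gen (fun _ => (1 : ℝ)) i) = b (.inr i) := fun i => Cl.lift_gen ..
  have hcomm : ∀ x y, Commute (f1 x) (f2 y) := by
    intro x y
    have hx : x ∈ Algebra.adjoin ℝ (Set.range (Cl.gen (fun _ : Fin p => (1 : ℝ)))) := by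
      rw [Cl.adjoin_gen]; trivial
    have hy : y ∈ Algebra.adjoin ℝ (Set.range (Cl.gen (fun _ : Fin q => (1 : ℝ)))) := by
      rw [Cl.adjoin_gen]; trivial
    induction hx using Algebra.adjoin_induction with
    | algebraMap r => rw [AlgHom.commutes]; exact Algebra.commute_algebraMap_left _ _
    | add x x' _ _ h h' => rw [map_add]; exact h.add_left h'
    | mul x x' _ _ h h' => rw [map_mul]; exact h.mul_left h'
    | mem x hx =>
      obtain ⟨i, rfl⟩ := hx
      induction hy using Algebra.adjoin_induction with
      | algebraMap r => rw [AlgHom.commutes]; exact Algebra.commute_algebraMap_right _ _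
      | add x x' _ _ h h' => rw [map_add]; exact h.add_right h'
      | mul x x' _ _ h h' => rw [map_mul]; exact h.mul_right h'
      | mem y hy =>
        obtain ⟨j, rfl⟩ := hy
        rw [hf1, hf2]
        exact hc i j
  refine ⟨Algebra.TensorProduct.lift f1 f2 hcomm, ?_⟩
  rintro (i | i)
  · rw [e_inl, Algebra.TensorProduct.lift_tmul, hf1, map_one, mul_one]
  · rw [e_inr, Algebra.TensorProduct.lift_tmul, hf2, map_one, one_mul]

/-- The endomorphisms of `R_{p,q}` multiplying the generators of the two factors by scalars. -/
theorem exists_scaling (p q : ℕ) {a b : ℝ} (ha : a * a = 1) (hb : b * b = 1) :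
    ∃ f : R p q →ₐ[ℝ] R p q, (∀ i, f (e p q (.inl i)) = a • e p q (.inl i)) ∧
      ∀ j, f (e p q (.inr j)) = b • e p q (.inr j) := by
  obtain ⟨f, hf⟩ := exists_R_lift (p := p) (q := q)
    (Sum.elim (fun i => a • e p q (.inl i)) (fun i => b • e p q (.inr i)))
    (by
      rintro (i | i)
      · simp only [Sum.elim_inl, smul_mul_smul_comm, ha, one_smul, e_sq]
      · simp only [Sum.elim_inr, smul_mul_smul_comm, hb, one_smul, e_sq])
    (fun i j h => by
      simp only [Sum.elim_inl, smul_mul_smul_comm]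
      rw [e_inl_anticomm h, smul_neg])
    (fun i j h => by
      simp only [Sum.elim_inr, smul_mul_smul_comm]
      rw [e_inr_anticomm h, smul_neg])
    (fun i j => by
      simp only [Sum.elim_inl, Sum.elim_inr, smul_mul_smul_comm]
      rw [e_inl_inr_comm, mul_comm])
  exact ⟨f, fun i => hf _, fun i => hf _⟩

/-- The endomorphism of `R_{p,q}` multiplying the generators of the two factors by `a` and `b`. -/
def scaling (p q : ℕ) {a b : ℝ} (ha : a * a = 1) (hb : b * b = 1) : R p q →ₐ[ℝ] R p q :=
  (exists_scaling p q ha hb).choose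

theorem scaling_inl {a b : ℝ} (ha : a * a = 1) (hb : b * b = 1) (i : Fin p) :
    scaling p q ha hb (e p q (.inl i)) = a • e p q (.inl i) :=
  (exists_scaling p q ha hb).choose_spec.1 i

theorem scaling_inr {a b : ℝ} (ha : a * a = 1) (hb : b * b = 1) (i : Fin q) :
    scaling p q ha hb (e p q (.inr i)) = b • e p q (.inr i) :=
  (exists_scaling p q ha hb).choose_spec.2 i

/-- The grading automorphism of `R_{p,q}`, changing the sign of every generator. -/
def grading (p q : ℕ) : R p q →ₐ[ℝ] R p q :=
  scaling p q (a := -1) (b := -1) (by norm_num) (by norm_num)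

theorem grading_e (i : Fin p ⊕ Fin q) : grading p q (e p q i) = -e p q i := by
  rcases i with i | i
  · rw [grading, scaling_inl, neg_smul, one_smul]
  · rw [grading, scaling_inr, neg_smul, one_smul]

end Generators

/-! ### The even subalgebra as the fixed points of the grading. -/

section EvenSubalgebra

variable {p q : ℕ}

theorem e_mul_e_mem (i j : Fin p ⊕ Fin q) : e p q i * e p q j ∈ Rplus p q := by
  by_cases h : i = j
  · rw [h, e_sq]; exact Subalgebra.one_mem _
  · exact Algebra.subset_adjoin ⟨i, j, h, rfl⟩

theorem Rplus_induction {P : (x : R p q) → x ∈ Rplus p q → Prop}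
    (halg : ∀ r, P (algebraMap ℝ _ r) (Subalgebra.algebraMap_mem _ r))
    (hgen : ∀ i j, P (e p q i * e p q j) (e_mul_e_mem i j))
    (hadd : ∀ x y hx hy, P x hx → P y hy → P (x + y) (Subalgebra.add_mem _ hx hy))
    (hmul : ∀ x y hx hy, P x hx → P y hy → P (x * y) (Subalgebra.mul_mem _ hx hy)) {x : R p q}
    (hx : x ∈ Rplus p q) : P x hx := by
  induction hx using Algebra.adjoin_induction with
  | mem x hx => obtain ⟨i, j, _, rfl⟩ := hx; exact hgen i j
  | algebraMap r => exact halg r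
  | add x y _ _ h h' => exact hadd x y _ _ h h'
  | mul x y _ _ h h' => exact hmul x y _ _ h h'

theorem grading_of_mem {x : R p q} (hx : x ∈ Rplus p q) : grading p q x = x := by
  induction hx using Rplus_induction with
  | halg r => rw [AlgHom.commutes]
  | hgen i j => rw [map_mul, grading_e, grading_e, neg_mul_neg]
  | hadd x y _ _ h h' => rw [map_add, h, h']
  | hmul x y _ _ h h' => rw [map_mul, h, h']

theorem e_mul_mul_e_mem (k : Fin p ⊕ Fin q) {x : R p q} (hx : x ∈ Rplus p q) :
    e p q k * x * e p q k ∈ Rplus p q := by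
  induction hx using Rplus_induction with
  | halg r =>
    rw [← Algebra.commutes, mul_assoc, e_sq, mul_one]
    exact Subalgebra.algebraMap_mem _ r
  | hgen i j =>
    rw [← mul_assoc, mul_assoc]
    exact Subalgebra.mul_mem _ (e_mul_e_mem _ _) (e_mul_e_mem _ _)
  | hadd x y _ _ h h' => rw [mul_add, add_mul]; exact Subalgebra.add_mem _ h h'
  | hmul x y _ _ h h' =>
    have : e p q k * (x * y) * e p q k = (e p q k * x * e p q k) * (e p q k * y * e p q k) := by
      rw [show (e p q k * x * e p q k) * (e p q k * y * e p q k) =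
        e p q k * x * (e p q k * e p q k) * y * e p q k by simp only [mul_assoc], e_sq, mul_one]
      simp only [mul_assoc]
    rw [this]
    exact Subalgebra.mul_mem _ h h'

/-- One has `e_i = (e_i e_k) e_k`, and conjugation by `e_k` preserves even elements, so the sums `a
+ b e_k` are closed under multiplication and contain the generators. -/
theorem exists_even_add_odd (k : Fin p ⊕ Fin q) (x : R p q) :
    ∃ a ∈ Rplus p q, ∃ b ∈ Rplus p q, x = a + b * e p q k := by
  induction x using R_induction with
  | halg r => exact ⟨_, Subalgebra.algebraMap_mem _ r, 0, Subalgebra.zero_mem _, by simp⟩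
  | hgen i =>
    refine ⟨0, Subalgebra.zero_mem _, _, e_mul_e_mem i k, ?_⟩
    rw [mul_assoc, e_sq, mul_one, zero_add]
  | hadd x y h h' =>
    obtain ⟨a, ha, b, hb, rfl⟩ := h
    obtain ⟨a', ha', b', hb', rfl⟩ := h'
    refine ⟨a + a', Subalgebra.add_mem _ ha ha', b + b', Subalgebra.add_mem _ hb hb', ?_⟩
    rw [add_mul]; abel
  | hmul x y h h' =>
    obtain ⟨a, ha, b, hb, rfl⟩ := h
    obtain ⟨a', ha', b', hb', rfl⟩ := h'
    refine ⟨a * a' + b * (e p q k * b' * e p q k),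
      Subalgebra.add_mem _ (Subalgebra.mul_mem _ ha ha')
        (Subalgebra.mul_mem _ hb (e_mul_mul_e_mem k hb')),
      a * b' + b * (e p q k * a' * e p q k),
      Subalgebra.add_mem _ (Subalgebra.mul_mem _ ha hb')
        (Subalgebra.mul_mem _ hb (e_mul_mul_e_mem k ha')), ?_⟩
    have : b * (e p q k * a' * e p q k) * e p q k = b * e p q k * a' := by
      rw [mul_assoc b, mul_assoc (e p q k * a'), e_sq, mul_one, ← mul_assoc]
    rw [add_mul _ _ (e p q k), this]
    simp only [add_mul, mul_add, mul_assoc]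
    abel

/-- The grading sends `a + b e_k` to `a - b e_k`, so a fixed element has no odd part. At least one
generator is needed for this decomposition. -/
theorem mem_Rplus_iff (hpq : 1 ≤ p + q) {x : R p q} : x ∈ Rplus p q ↔ grading p q x = x := by
  refine ⟨grading_of_mem, fun h => ?_⟩
  have : Nonempty (Fin p ⊕ Fin q) := Fintype.card_pos_iff.1 (by simp only [Fintype.card_sum, Fintype.card_fin]; omega)
  obtain ⟨k⟩ := this
  obtain ⟨a, ha, b, hb, rfl⟩ := exists_even_add_odd k x
  rw [map_add, map_mul, grading_of_mem ha, grading_of_mem hb, grading_e, mul_neg] at h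
  have h2 : (2 : ℝ) • (b * e p q k) = 0 := by
    rw [two_smul]
    have := add_left_cancel h
    nth_rewrite 1 [← this]
    exact neg_add_cancel _
  have h3 : b * e p q k = 0 := by simpa using h2
  rw [h3, add_zero]; exact ha

theorem mul_e_mem_of_grading (hpq : 1 ≤ p + q) {x : R p q} (h : grading p q x = -x)
    (k : Fin p ⊕ Fin q) : x * e p q k ∈ Rplus p q := by
  rw [mem_Rplus_iff hpq, map_mul, h, grading_e, neg_mul_neg]

end EvenSubalgebra

end

section

/-! ### The even subalgebra as a Clifford algebra. -/

section EvenClifford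

variable {p q : ℕ}

theorem sig_inl (r s : ℕ) (i : Fin r) : sig r s (.inl i) = 1 := rfl

theorem sig_inr (r s : ℕ) (i : Fin s) : sig r s (.inr i) = -1 := rfl

theorem e_inl_zero_mul_mul (x y : R (p + 1) q) :
    (e (p + 1) q (.inl 0) * x) * (e (p + 1) q (.inl 0) * y) =
      (e (p + 1) q (.inl 0) * x * e (p + 1) q (.inl 0)) * y := by
  simp only [mul_assoc]

/-- The even subalgebra is generated by anticommuting elements `e₁ e_j`. -/
theorem exists_cl_hom_even (p q : ℕ) : ∃ F : Cl (sig q p) →ₐ[ℝ] R (p + 1) q,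
    (∀ i, F (Cl.gen _ (.inl i)) = e (p + 1) q (.inl 0) * e (p + 1) q (.inr i)) ∧
    (∀ i, F (Cl.gen _ (.inr i)) = e (p + 1) q (.inl 0) * e (p + 1) q (.inl i.succ)) := by
  have hl : ∀ i : Fin p, e (p + 1) q (.inl 0) * e (p + 1) q (.inl i.succ) * e (p + 1) q (.inl 0) =
      -e (p + 1) q (.inl i.succ) := by
    intro i
    rw [e_inl_anticomm (Fin.succ_ne_zero i).symm, neg_mul, mul_assoc, e_sq, mul_one]
  have hr : ∀ i : Fin q, e (p + 1) q (.inl 0) * e (p + 1) q (.inr i) * e (p + 1) q (.inl 0) =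
      e (p + 1) q (.inr i) := by
    intro i
    rw [e_inl_inr_comm, mul_assoc, e_sq, mul_one]
  -- The first generator commutes with those of the second factor, so these products have square
  -- `1`; it anticommutes with the others of its own factor, so those products have square `-1`.
  -- This accounts for the signature `(q, p)`.
  refine ⟨Cl.lift _ (Sum.elim (fun i => e (p + 1) q (.inl 0) * e (p + 1) q (.inr i))
    (fun i => e (p + 1) q (.inl 0) * e (p + 1) q (.inl i.succ))) ?_ ?_,
    fun i => Cl.lift_gen .., fun i => Cl.lift_gen ..⟩
  · rintro (i | i)
    · rw [Sum.elim_inl, e_inl_zero_mul_mul, hr, e_sq, sig_inl, map_one]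
    · rw [Sum.elim_inr, e_inl_zero_mul_mul, hl, neg_mul, e_sq, sig_inr, map_neg, map_one]
  · rintro (i | i) (j | j) hij
    · simp only [Sum.elim_inl]
      rw [e_inl_zero_mul_mul, e_inl_zero_mul_mul, hr, hr, e_inr_anticomm (by simpa using hij)]
    · simp only [Sum.elim_inl, Sum.elim_inr]
      rw [e_inl_zero_mul_mul, e_inl_zero_mul_mul, hr, hl, neg_mul, neg_neg, e_inl_inr_comm]
    · simp only [Sum.elim_inl, Sum.elim_inr]
      rw [e_inl_zero_mul_mul, e_inl_zero_mul_mul, hr, hl, neg_mul, e_inl_inr_comm]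
    · simp only [Sum.elim_inr]
      rw [e_inl_zero_mul_mul, e_inl_zero_mul_mul, hl, hl, neg_mul, neg_mul,
        e_inl_anticomm (fun h => hij (by rw [Fin.succ_injective _ h]))]

/-- This supplies a left inverse of the preceding homomorphism without counting dimensions:
generators act by antidiagonal matrices, so even elements act by diagonal ones, and the upper left
entry of `e₁ e_j` is the Clifford generator it came from. -/
theorem exists_hom_matrix_cl (p q : ℕ) : ∃ T : R (p + 1) q →ₐ[ℝ] Matrix (Fin 2) (Fin 2) (Cl (sig q p)),
    T (e (p + 1) q (.inl 0)) = !![0, 1; 1, 0] ∧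
    (∀ i, T (e (p + 1) q (.inr i)) = !![0, Cl.gen _ (.inl i); Cl.gen _ (.inl i), 0]) ∧
    (∀ i : Fin p, T (e (p + 1) q (.inl i.succ)) =
      !![0, -Cl.gen _ (.inr i); Cl.gen _ (.inr i), 0]) := by
  have hsl : ∀ i, Cl.gen (sig q p) (.inl i) * Cl.gen (sig q p) (.inl i) = 1 := fun i => by
    rw [Cl.gen_sq, sig_inl, map_one]
  have hsr : ∀ i, Cl.gen (sig q p) (.inr i) * Cl.gen (sig q p) (.inr i) = -1 := fun i => by
    rw [Cl.gen_sq, sig_inr, map_neg, map_one]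
  have hone : (1 : Matrix (Fin 2) (Fin 2) (Cl (sig q p))) = !![1, 0; 0, 1] := Matrix.one_fin_two
  obtain ⟨T, hT⟩ := exists_R_lift (p := p + 1) (q := q)
    (Sum.elim (Fin.cases !![0, 1; 1, 0] fun i => !![0, -Cl.gen (sig q p) (.inr i); Cl.gen _ (.inr i), 0])
      fun i => !![0, Cl.gen _ (.inl i); Cl.gen _ (.inl i), 0])
    (by
      rintro (i | i)
      · refine Fin.cases ?_ (fun i => ?_) i
        · simp [hone]
        · simp [hone, hsr]
      · simp [hone, hsl])
    (by
      intro i j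
      refine Fin.cases ?_ (fun i => ?_) i <;> refine Fin.cases ?_ (fun j => ?_) j
      · intro h; exact absurd rfl h
      · intro _; simp
      · intro _; simp
      · intro h
        have := Cl.gen_anticomm (sig q p) (i := .inr i) (j := .inr j)
          (by rintro ⟨⟩; exact h rfl)
        simp [this])
    (by
      intro i j h
      have := Cl.gen_anticomm (sig q p) (i := .inl i) (j := .inl j) (by simpa using h)
      simp [this])
    (by
      intro i j
      refine Fin.cases ?_ (fun i => ?_) i
      · simp
      · have := Cl.gen_anticomm (sig q p) (i := .inl j) (j := .inr i) (by simp)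
        simp [this])
  exact ⟨T, hT (.inl 0), fun i => hT (.inr i), fun i => hT (.inl i.succ)⟩

/-- The even subalgebra of `R_{p,q}` is the Clifford algebra of a form of signature `(q, p - 1)`. -/
theorem nonempty_even_equiv_cl (p q : ℕ) : Nonempty (Rplus (p + 1) q ≃ₐ[ℝ] Cl (sig q p)) := by
  obtain ⟨F, hF1, hF2⟩ := exists_cl_hom_even p q
  obtain ⟨T, hT0, hT1, hT2⟩ := exists_hom_matrix_cl p q
  -- Diagonal matrices multiply entrywise, so the vanishing of the off-diagonal entries must be
  -- carried through the induction for the upper left entry to be multiplicative.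
  have hTF : ∀ x, T (F x) 0 0 = x ∧ T (F x) 0 1 = 0 ∧ T (F x) 1 0 = 0 := by
    intro x
    have hx : x ∈ Algebra.adjoin ℝ (Set.range (Cl.gen (sig q p))) := by rw [Cl.adjoin_gen]; trivial
    induction hx using Algebra.adjoin_induction with
    | mem x hx =>
      obtain ⟨i | i, rfl⟩ := hx
      · rw [hF1, map_mul, hT0, hT1]; simp
      · rw [hF2, map_mul, hT0, hT2]; simp
    | algebraMap r => rw [AlgHom.commutes, AlgHom.commutes]; simp [Matrix.algebraMap_matrix_apply]
    | add x y _ _ h h' => simp [h, h']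
    | mul x y _ _ h h' => simp [Matrix.mul_apply, h, h']
  have hinj : Function.Injective F := by
    intro x y h
    rw [← (hTF x).1, ← (hTF y).1, h]
  have hz : ∀ i, e (p + 1) q (.inl 0) * e (p + 1) q i ∈ F.range := by
    rintro (i | i)
    · refine Fin.cases ?_ (fun i => ?_) i
      · rw [e_sq]; exact Subalgebra.one_mem _
      · exact ⟨_, hF2 i⟩
    · exact ⟨_, hF1 i⟩
  have hz' : ∀ i, e (p + 1) q i * e (p + 1) q (.inl 0) ∈ F.range := by
    rintro (i | i)
    · by_cases h : i = 0
      · rw [h, e_sq]; exact Subalgebra.one_mem _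
      · rw [e_inl_anticomm h]; exact Subalgebra.neg_mem _ (hz _)
    · rw [← e_inl_inr_comm]; exact hz _
  have hrange : F.range = Rplus (p + 1) q := by
    apply le_antisymm
    · rintro _ ⟨x, rfl⟩
      have hx : x ∈ Algebra.adjoin ℝ (Set.range (Cl.gen (sig q p))) := by rw [Cl.adjoin_gen]; trivial
      change F x ∈ _
      induction hx using Algebra.adjoin_induction with
      | mem x hx =>
        obtain ⟨i | i, rfl⟩ := hx
        · rw [hF1]; exact e_mul_e_mem _ _
        · rw [hF2]; exact e_mul_e_mem _ _
      | algebraMap r => rw [AlgHom.commutes]; exact Subalgebra.algebraMap_mem _ r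
      | add x y _ _ h h' => rw [map_add]; exact Subalgebra.add_mem _ h h'
      | mul x y _ _ h h' => rw [map_mul]; exact Subalgebra.mul_mem _ h h'
    · apply Algebra.adjoin_le
      rintro _ ⟨i, j, _, rfl⟩
      have : e (p + 1) q i * e (p + 1) q j = (e (p + 1) q i * e (p + 1) q (.inl 0)) *
          (e (p + 1) q (.inl 0) * e (p + 1) q j) := by
        rw [mul_assoc, ← mul_assoc (e (p + 1) q (.inl 0)), e_sq, one_mul]
      rw [this]
      exact Subalgebra.mul_mem _ (hz' i) (hz j)
  exact ⟨((AlgEquiv.ofInjective F hinj).trans (Subalgebra.equivOfEq _ _ hrange)).symm⟩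

theorem comm_e (i : Fin p ⊕ Fin q) :
    Algebra.TensorProduct.comm ℝ _ _ (e p q i) = e q p i.swap := by
  rcases i with i | i <;> rfl

theorem nonempty_even_comm (p q : ℕ) : Nonempty (Rplus p q ≃ₐ[ℝ] Rplus q p) := by
  let f : R p q ≃ₐ[ℝ] R q p := Algebra.TensorProduct.comm ℝ _ _
  have h : (Rplus p q).map (f : R p q →ₐ[ℝ] R q p) = Rplus q p := by
    rw [Rplus, AlgHom.map_adjoin, Rplus]
    congr 1
    ext x
    constructor
    · rintro ⟨_, ⟨i, j, hij, rfl⟩, rfl⟩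
      refine ⟨i.swap, j.swap, fun h => hij (Sum.swap_leftInverse.injective h), ?_⟩
      rw [map_mul]
      exact congrArg₂ _ (comm_e i) (comm_e j)
    · rintro ⟨i, j, hij, rfl⟩
      refine ⟨e p q i.swap * e p q j.swap,
        ⟨i.swap, j.swap, fun h => hij (Sum.swap_leftInverse.injective h), rfl⟩, ?_⟩
      rw [map_mul]
      refine congrArg₂ _ ((comm_e i.swap).trans ?_) ((comm_e j.swap).trans ?_) <;>
        rw [Sum.swap_swap]
  exact ⟨(f.subalgebraMap (Rplus p q)).trans (Subalgebra.equivOfEq _ _ h)⟩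

theorem hasCliffordType_even_left (p q : ℕ) : HasCliffordType (Rplus (p + 1) q) (q + 7 * p) :=
  (hasCliffordType_cl q p).of_equiv (nonempty_even_equiv_cl p q).some

theorem hasCliffordType_even_right (p q : ℕ) : HasCliffordType (Rplus p (q + 1)) (p + 7 * q) :=
  (hasCliffordType_even_left q p).of_equiv (nonempty_even_comm p (q + 1)).some

/-- The table of types is invariant under `d ↦ 2 - d`. -/
theorem HasCliffordType.of_mod {A : Type} [Ring A] [Algebra ℝ A] {d d' : ℕ} (h : HasCliffordType A d)
    (hd : d % 8 = d' % 8 ∨ (d + d') % 8 = 2) : HasCliffordType A d' :=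
  ⟨fun _ => h.1 (by omega), fun _ => h.2.1 (by omega), fun _ => h.2.2.1 (by omega),
    fun _ => h.2.2.2.1 (by omega), fun _ => h.2.2.2.2 (by omega)⟩

/-- The index is `q - p + 1` modulo 8. Exchanging the two factors replaces it by `p - q + 1`, its
reflection under `d ↦ 2 - d`, so the case `p = 0` can be read off from the exchanged algebra. -/
theorem hasCliffordType_even {p q d : ℕ} (hpq : 1 ≤ p + q) (hd : (p + d) % 8 = (q + 1) % 8) :
    HasCliffordType (Rplus p q) d := by
  rcases p with _ | p
  · obtain ⟨q', rfl⟩ := Nat.exists_eq_add_of_le' (show 1 ≤ q by omega)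
    exact (hasCliffordType_even_right 0 q').of_mod (by omega)
  · exact (hasCliffordType_even_left p q).of_mod (by omega)

theorem hasCliffordType_sumSq (p : ℕ) : HasCliffordType (CliffordAlgebra (sumSq p)) p :=
  HasCliffordType.of_equiv (Cl.congr (w := fun _ : Fin p => (1 : ℝ)) (w' := sig p 0)
    (Equiv.sumEmpty (Fin p) (Fin 0)).symm (fun i => rfl)) (by simpa using hasCliffordType_cl p 0)

end EvenClifford

end

section

/-! ### Simple modules over a sum of matrix algebras. -/

section StandardModule

variable {A : Type} [Ring A] [Algebra ℝ A] {K : Type} [DivisionRing K] [Algebra ℝ K] {s ℓ : ℕ}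

/-- The module of column vectors over the `i`-th factor of a sum of matrix algebras. -/
@[ext]
structure StdModule (φ : A ≃ₐ[ℝ] (Fin s → Matrix (Fin ℓ) (Fin ℓ) K)) (i : Fin s) : Type where
  /-- The underlying column vector. -/
  vec : Fin ℓ → K

variable (φ : A ≃ₐ[ℝ] (Fin s → Matrix (Fin ℓ) (Fin ℓ) K)) (i : Fin s)

namespace StdModule

/-- The underlying column vector, as an equivalence. -/
def equivVec : StdModule φ i ≃ (Fin ℓ → K) where
  toFun := vec
  invFun := mk
  left_inv _ := rfl
  right_inv _ := rfl

instance : AddCommGroup (StdModule φ i) := (equivVec φ i).addCommGroup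

instance : Module ℝ (StdModule φ i) := (equivVec φ i).module ℝ

variable {φ i}

theorem vec_add (v w : StdModule φ i) : (v + w).vec = v.vec + w.vec := rfl

theorem vec_zero : (0 : StdModule φ i).vec = 0 := rfl

theorem vec_real_smul (r : ℝ) (v : StdModule φ i) : (r • v).vec = r • v.vec := rfl

instance : SMul A (StdModule φ i) where
  smul a v := ⟨φ a i *ᵥ v.vec⟩

theorem vec_smul (a : A) (v : StdModule φ i) : (a • v).vec = φ a i *ᵥ v.vec := rfl

instance : Module A (StdModule φ i) where
  one_smul v := by
    ext1
    rw [vec_smul, map_one, Pi.one_apply, Matrix.one_mulVec]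
  mul_smul a b v := by
    ext1
    simp only [vec_smul, map_mul, Pi.mul_apply, Matrix.mulVec_mulVec]
  smul_zero a := by
    ext1
    rw [vec_smul, vec_zero, Matrix.mulVec_zero]
  smul_add a v w := by
    ext1
    simp only [vec_smul, vec_add, Matrix.mulVec_add]
  add_smul a b v := by
    ext1
    simp only [vec_smul, vec_add, map_add, Pi.add_apply, Matrix.add_mulVec]
  zero_smul v := by
    ext1
    simp only [vec_smul, vec_zero, map_zero, Pi.zero_apply, Matrix.zero_mulVec]

instance : IsScalarTower ℝ A (StdModule φ i) where
  smul_assoc r a v := by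
    ext1
    simp only [vec_smul, vec_real_smul, map_smul, Pi.smul_apply, Matrix.smul_mulVec]

theorem nontrivial (hℓ : 1 ≤ ℓ) : Nontrivial (StdModule φ i) := by
  have : Nonempty (Fin ℓ) := ⟨⟨0, hℓ⟩⟩
  exact (equivVec φ i).nontrivial

end StdModule

/-- The matrix with a given column. -/
def colMatrix {K : Type} [Zero K] {ℓ : ℕ} (b : Fin ℓ) (w : Fin ℓ → K) : Matrix (Fin ℓ) (Fin ℓ) K :=
  Matrix.of fun a c => if c = b then w a else 0

theorem colMatrix_mulVec {K : Type} [Ring K] {ℓ : ℕ} (b : Fin ℓ) (w v : Fin ℓ → K) :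
    colMatrix b w *ᵥ v = fun a => w a * v b := by
  ext a
  simp [colMatrix, Matrix.mulVec, dotProduct]

/-- A matrix with a single nonzero column, placed where `v` has an invertible entry, carries `v` to
any prescribed vector. -/
theorem isSimpleModule_std (hℓ : 1 ≤ ℓ) : IsSimpleModule A (StdModule φ i) := by
  rw [isSimpleModule_iff_toSpanSingleton_surjective]
  refine ⟨StdModule.nontrivial hℓ, fun v hv w => ?_⟩
  obtain ⟨b, hb⟩ : ∃ b, v.vec b ≠ 0 := by
    by_contra! h
    exact hv (StdModule.ext (funext h))
  refine ⟨φ.symm (Pi.single i (colMatrix b fun a => w.vec a * (v.vec b)⁻¹)), ?_⟩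
  ext1
  rw [LinearMap.toSpanSingleton_apply, StdModule.vec_smul, AlgEquiv.apply_symm_apply,
    Pi.single_eq_same, colMatrix_mulVec]
  funext a
  rw [mul_assoc, inv_mul_cancel₀ hb, mul_one]

/-- The unit of the `i`-th factor acts as the identity on one module and as zero on the other. -/
theorem isEmpty_std_equiv (hℓ : 1 ≤ ℓ) {i j : Fin s} (hij : i ≠ j) :
    IsEmpty (StdModule φ i ≃ₗ[A] StdModule φ j) := by
  refine ⟨fun f => ?_⟩
  have : Nontrivial (StdModule φ i) := StdModule.nontrivial hℓ
  obtain ⟨v, hv⟩ := exists_ne (0 : StdModule φ i)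
  apply hv
  have h1 : (φ.symm (Pi.single i 1)) • v = v := by
    ext1
    rw [StdModule.vec_smul, AlgEquiv.apply_symm_apply, Pi.single_eq_same, Matrix.one_mulVec]
  have h2 : (φ.symm (Pi.single i 1)) • f v = 0 := by
    ext1
    rw [StdModule.vec_smul, AlgEquiv.apply_symm_apply, Pi.single_eq_of_ne hij.symm, Matrix.zero_mulVec,
      StdModule.vec_zero]
  rw [← f.map_smul, h1] at h2
  exact f.map_eq_zero_iff.1 h2

/-- The unit is the sum of the diagonal matrix units, so one of them does not annihilate `u`.
Placing a vector in the corresponding column and applying the matrix to `u` is then a nonzero map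
between simple modules. -/
theorem exists_equiv_std (U : Type) [AddCommGroup U] [Module A U] [hU : IsSimpleModule A U] :
    ∃ i, Nonempty (StdModule φ i ≃ₗ[A] U) := by
  have := hU.nontrivial
  obtain ⟨u, hu⟩ := exists_ne (0 : U)
  have hsum : (1 : A) = ∑ i, ∑ b, φ.symm (Pi.single i (Matrix.single b b (1 : K))) := by
    apply φ.injective
    rw [map_one, map_sum]
    simp only [map_sum, AlgEquiv.apply_symm_apply]
    ext j a c
    rw [Finset.sum_apply, Finset.sum_eq_single j]
    · rw [Finset.sum_apply]
      simp only [Pi.single_eq_same, Pi.one_apply]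
      rw [Matrix.sum_single_one]
    · intro k _ hk
      rw [Finset.sum_apply]
      exact Finset.sum_eq_zero fun b _ => Pi.single_eq_of_ne hk.symm _
    · simp
  obtain ⟨i, b, hib⟩ : ∃ i b, φ.symm (Pi.single i (Matrix.single b b (1 : K))) • u ≠ 0 := by
    by_contra! h
    apply hu
    rw [← one_smul A u, hsum, Finset.sum_smul]
    refine Finset.sum_eq_zero fun i _ => ?_
    rw [Finset.sum_smul]
    exact Finset.sum_eq_zero fun b _ => h i b
  have := isSimpleModule_std φ i (Fin.pos b)
  let f : StdModule φ i →ₗ[A] U :=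
    { toFun := fun v => φ.symm (Pi.single i (colMatrix b v.vec)) • u
      map_add' := fun v w => by
        rw [← add_smul, ← map_add, ← Pi.single_add]
        congr 4
        ext a c
        simp only [colMatrix, Matrix.of_apply, Matrix.add_apply, StdModule.vec_add, Pi.add_apply]
        split_ifs
        · rfl
        · simp
      map_smul' := fun a v => by
        rw [RingHom.id_apply, smul_smul]
        congr 1
        apply φ.injective
        rw [map_mul, AlgEquiv.apply_symm_apply, AlgEquiv.apply_symm_apply]
        ext j x y
        by_cases hj : j = i
        · subst hj
          rw [Pi.mul_apply, Pi.single_eq_same, Pi.single_eq_same, StdModule.vec_smul]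
          simp only [colMatrix, Matrix.of_apply, Matrix.mul_apply, Matrix.mulVec, dotProduct]
          split_ifs <;> simp
        · rw [Pi.mul_apply, Pi.single_eq_of_ne hj, Pi.single_eq_of_ne hj, mul_zero] }
  refine ⟨i, ⟨LinearEquiv.ofBijective f (LinearMap.bijective_of_ne_zero fun h => hib ?_)⟩⟩
  have := LinearMap.congr_fun h ⟨Pi.single b 1⟩
  have h2 : colMatrix b (Pi.single b 1 : Fin ℓ → K) = Matrix.single b b (1 : K) := by
    ext x y
    simp only [colMatrix, Matrix.of_apply, Pi.single_apply, Matrix.single_apply, eq_comm (a := b)]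
    by_cases hx : x = b <;> by_cases hy : y = b <;> simp [hx, hy]
  rw [← h2]
  exact this

/-- Right multiplication by the conjugate of a scalar on column vectors. -/
def stdEnd [StarRing K] (c : K) : Module.End A (StdModule φ i) where
  toFun v := ⟨fun a => v.vec a * star c⟩
  map_add' v w := by ext1; funext a; exact add_mul _ _ _
  map_smul' a v := by
    ext1
    rw [RingHom.id_apply, StdModule.vec_smul, StdModule.vec_smul]
    funext x
    simp only [Matrix.mulVec, dotProduct, Finset.sum_mul, mul_assoc]

theorem vec_stdEnd [StarRing K] (c : K) (v : StdModule φ i) (a : Fin ℓ) :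
    (stdEnd φ i c v).vec a = v.vec a * star c := rfl

/-- A basis vector generates the module by matrices with one column, so an endomorphism is
determined by its value there, and only one coordinate of that value matters. -/
theorem stdEnd_bijective [StarRing K] (hℓ : 1 ≤ ℓ) :
    Function.Bijective (stdEnd φ i : K → Module.End A (StdModule φ i)) := by
  let b : Fin ℓ := ⟨0, hℓ⟩
  have hcol : ∀ v : StdModule φ i, φ.symm (Pi.single i (colMatrix b v.vec)) •
      (⟨Pi.single b 1⟩ : StdModule φ i) = v := by
    intro v
    ext1
    rw [StdModule.vec_smul, AlgEquiv.apply_symm_apply, Pi.single_eq_same, colMatrix_mulVec]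
    funext a
    simp
  constructor
  · intro c d h
    have := congrArg (fun T => (T (⟨Pi.single b 1⟩ : StdModule φ i)).vec b) h
    simpa [vec_stdEnd] using this
  · intro T
    refine ⟨star ((T ⟨Pi.single b 1⟩).vec b), LinearMap.ext fun v => StdModule.ext (funext fun a => ?_)⟩
    rw [vec_stdEnd, star_star]
    conv_rhs => rw [← hcol v]
    rw [map_smul, StdModule.vec_smul, AlgEquiv.apply_symm_apply, Pi.single_eq_same, colMatrix_mulVec]

/-- Right multiplication reverses products; composing with the conjugation of `K` restores their
order, so no opposite algebra appears. -/
theorem nonempty_equiv_std_end [StarRing K] [StarModule ℝ K] (hℓ : 1 ≤ ℓ) :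
    Nonempty (K ≃ₐ[ℝ] Module.End A (StdModule φ i)) := by
  refine ⟨AlgEquiv.ofBijective (AlgHom.ofLinearMap
    { toFun := stdEnd φ i
      map_add' := fun c d => ?_
      map_smul' := fun r c => ?_ } ?_ fun c d => ?_) (stdEnd_bijective φ i hℓ)⟩ <;>
    refine LinearMap.ext fun v => StdModule.ext (funext fun a => ?_)
  · rw [LinearMap.add_apply, StdModule.vec_add, Pi.add_apply]
    simp only [vec_stdEnd, star_add, mul_add]
  · rw [RingHom.id_apply, LinearMap.smul_apply, StdModule.vec_real_smul, Pi.smul_apply]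
    simp only [vec_stdEnd, star_smul, star_trivial, mul_smul_comm]
  · simp only [LinearMap.coe_mk, AddHom.coe_mk, vec_stdEnd, star_one, mul_one, Module.End.one_apply]
  · simp only [LinearMap.coe_mk, AddHom.coe_mk, Module.End.mul_apply, vec_stdEnd, star_mul, mul_assoc]

end StandardModule

section MatrixSumModules

variable {A : Type} [Ring A] [Algebra ℝ A] {K : Type} [DivisionRing K] [Algebra ℝ K] {s : ℕ}

theorem IsMatrixSum.exists_irreps (h : IsMatrixSum A s K) :
    ∃ V : Fin s → ModuleCat.{0} A, IsIrrepList V := by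
  obtain ⟨ℓ, hℓ, ⟨φ⟩⟩ := h
  refine ⟨fun i => ModuleCat.of A (StdModule φ i), fun i => isSimpleModule_std φ i hℓ,
    fun i j hij => isEmpty_std_equiv φ hℓ hij, fun U hU => ?_⟩
  obtain ⟨i, ⟨f⟩⟩ := exists_equiv_std φ U
  exact ⟨i, ⟨f.symm⟩⟩

theorem IsMatrixSum.isSemisimpleRing (h : IsMatrixSum A s K) : IsSemisimpleRing A := by
  obtain ⟨ℓ, hℓ, ⟨φ⟩⟩ := h
  exact φ.symm.toRingEquiv.isSemisimpleRing

variable (U : Type) [AddCommGroup U] [Module A U] [Module ℝ U] [IsScalarTower ℝ A U]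

theorem IsMatrixSum.nonempty_equiv_end [IsSimpleModule A U] [StarRing K] [StarModule ℝ K]
    (h : IsMatrixSum A s K) : Nonempty (K ≃ₐ[ℝ] Module.End A U) := by
  obtain ⟨ℓ, hℓ, ⟨φ⟩⟩ := h
  obtain ⟨i, ⟨f⟩⟩ := exists_equiv_std φ U
  obtain ⟨g⟩ := nonempty_equiv_std_end φ i hℓ
  exact ⟨g.trans (f.conjAlgEquiv ℝ)⟩

end MatrixSumModules

end

section

open scoped InnerProductSpace

/-! ### Star representations and Schur's lemma. -/

section StarRep

variable {A : Type} [Ring A] [Algebra ℝ A]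

/-- The operator `st a` is the adjoint of `a` on the inner product space `W`. -/
def IsStarRep (st : A → A) (W : Type) [NormedAddCommGroup W] [InnerProductSpace ℝ W] [Module A W] : Prop :=
  ∀ (a : A) (v w : W), ⟪a • v, w⟫_ℝ = ⟪v, st a • w⟫_ℝ

variable {st : A → A}
variable {L : Type} [NormedAddCommGroup L] [InnerProductSpace ℝ L] [FiniteDimensional ℝ L] [Module A L]
  [IsScalarTower ℝ A L]
variable {W : Type} [NormedAddCommGroup W] [InnerProductSpace ℝ W] [FiniteDimensional ℝ W] [Module A W]
  [IsScalarTower ℝ A W]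

/-- The adjoint of an intertwining operator. -/
def adj (hL : IsStarRep st L) (hW : IsStarRep st W) (u : L →ₗ[A] W) : W →ₗ[A] L :=
  { LinearMap.adjoint (u.restrictScalars ℝ) with
    map_smul' := fun a w => by
      refine ext_inner_right ℝ fun x => ?_
      simp only [AddHom.toFun_eq_coe, LinearMap.coe_toAddHom, RingHom.id_apply]
      rw [LinearMap.adjoint_inner_left, hL, LinearMap.adjoint_inner_left, hW]
      simp }

variable (hL : IsStarRep st L) (hW : IsStarRep st W)

theorem adj_inner_left (u : L →ₗ[A] W) (w : W) (x : L) : ⟪adj hL hW u w, x⟫_ℝ = ⟪w, u x⟫_ℝ :=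
  LinearMap.adjoint_inner_left (u.restrictScalars ℝ) x w

theorem adj_inner_right (u : L →ₗ[A] W) (w : W) (x : L) : ⟪x, adj hL hW u w⟫_ℝ = ⟪u x, w⟫_ℝ := by
  rw [real_inner_comm, adj_inner_left, real_inner_comm]

/-- A symmetric operator has a real eigenvalue `c`, so `T - c` is a noninjective endomorphism of a
simple module and must vanish. -/
theorem exists_scalar_of_symmetric [IsSimpleModule A L] (T : Module.End A L)
    (hT : ∀ x y, ⟪T x, y⟫_ℝ = ⟪x, T y⟫_ℝ) : ∃ c : ℝ, ∀ x, T x = c • x := by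
  have : Nontrivial L := IsSimpleModule.nontrivial A L
  have hsymm : (T.restrictScalars ℝ).IsSymmetric := hT
  obtain ⟨c, hc⟩ : ∃ c : ℝ, Module.End.HasEigenvalue (T.restrictScalars ℝ : Module.End ℝ L) c :=
    ⟨_, hsymm.hasEigenvalue_iSup_of_finiteDimensional⟩
  obtain ⟨v, hv⟩ := hc.exists_hasEigenvector
  refine ⟨c, fun x => ?_⟩
  rcases LinearMap.injective_or_eq_zero (T - c • (1 : Module.End A L)) with h | h
  · exfalso
    apply hv.2
    apply h
    rw [map_zero, LinearMap.sub_apply, LinearMap.smul_apply, Module.End.one_apply, sub_eq_zero]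
    exact hv.apply_eq_smul
  · have := LinearMap.congr_fun h x
    rwa [LinearMap.sub_apply, LinearMap.smul_apply, Module.End.one_apply, LinearMap.zero_apply,
      sub_eq_zero] at this

/-- Write `d` for the image of `x` and `d'` for its adjoint. Both `d + d'` and `d' d` are symmetric,
hence real scalars `t'` and `n'`, while the trace and norm of `x` in `K` give real `t` and `n`. If
`t' = t`, then `d' = t - d` is the image of `star x`; otherwise `d` is itself a real scalar. -/
theorem algEquiv_star {K : Type} [DivisionRing K] [Algebra ℝ K] [StarRing K] [StarModule ℝ K]
    (hK : ∀ x : K, ∃ t n : ℝ, x + star x = algebraMap ℝ K t ∧ star x * x = algebraMap ℝ K n)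
    [IsSimpleModule A L] (θ : K ≃ₐ[ℝ] Module.End A L) (x : K) : θ (star x) = adj hL hL (θ x) := by
  obtain ⟨t, n, ht, hn⟩ := hK x
  have hsx : star x = algebraMap ℝ K t - x := by rw [← ht]; abel
  set d := θ x with hd
  set d' := adj hL hL d with hd'
  obtain ⟨t', ht'⟩ := exists_scalar_of_symmetric (d + d') (fun v w => by
    rw [LinearMap.add_apply, LinearMap.add_apply, inner_add_left, inner_add_right, hd', adj_inner_left,
      adj_inner_right]
    ring)
  obtain ⟨n', hn'⟩ := exists_scalar_of_symmetric (d' * d) (fun v w => by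
    rw [Module.End.mul_apply, Module.End.mul_apply, hd', adj_inner_left, adj_inner_right])
  have e1 : ∀ v, d' v = t' • v - d v := fun v => by
    rw [← ht', LinearMap.add_apply]; abel
  have e2 : ∀ v, t' • d v - d (d v) = n' • v := fun v => by
    rw [← hn', Module.End.mul_apply, e1]
  have e3 : ∀ v, t • d v - d (d v) = n • v := fun v => by
    have h := congrArg θ hn
    rw [hsx, sub_mul, map_sub, map_mul, map_mul, AlgEquiv.commutes, AlgEquiv.commutes] at h
    have := LinearMap.congr_fun h v
    simpa [Algebra.algebraMap_eq_smul_one] using this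
  by_cases htt : t' = t
  · refine LinearMap.ext fun v => ?_
    rw [e1, hsx, map_sub, AlgEquiv.commutes, htt]
    simp [Algebra.algebraMap_eq_smul_one, hd]
  -- Two monic quadratic equations for `d` with different linear coefficients differ by a linear
  -- one, which makes `d` a real scalar; such elements are self-conjugate and self-adjoint.
  · have e4 : ∀ v, d v = ((t' - t)⁻¹ * (n' - n)) • v := fun v => by
      have h5 : (t' - t) • d v = (n' - n) • v := by
        rw [sub_smul, sub_smul, ← e2, ← e3]; abel
      rw [mul_smul, ← h5, smul_smul, inv_mul_cancel₀ (sub_ne_zero.2 htt), one_smul]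
    set c := (t' - t)⁻¹ * (n' - n)
    have hx : x = algebraMap ℝ K c := by
      apply θ.injective
      rw [AlgEquiv.commutes]
      refine LinearMap.ext fun v => ?_
      rw [← hd, e4]
      simp [Algebra.algebraMap_eq_smul_one]
    have hsx' : star x = x := by
      rw [hx, Algebra.algebraMap_eq_smul_one, star_smul, star_one, star_trivial]
    rw [hsx']
    refine LinearMap.ext fun v => ext_inner_right ℝ fun w => ?_
    rw [hd', adj_inner_left, ← hd, e4, e4, real_inner_smul_left, real_inner_smul_right]

end StarRep

/-! ### Orthogonal frames and block operators. -/

section Frame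

variable {A : Type} [Ring A] [Algebra ℝ A]
variable {L : Type} [NormedAddCommGroup L] [InnerProductSpace ℝ L] [FiniteDimensional ℝ L] [Module A L]
  [IsScalarTower ℝ A L]
variable {W : Type} [NormedAddCommGroup W] [InnerProductSpace ℝ W] [FiniteDimensional ℝ W] [Module A W]
  [IsScalarTower ℝ A W]
variable {κ : Type} [Fintype κ] [DecidableEq κ]

/-- Isometric embeddings of `L` into `W` with orthogonal images in `P`. -/
structure IsOrthoFamily (P : Submodule A W) (u : κ → (L →ₗ[A] W)) : Prop where
  orth : ∀ i j x y, ⟪u i x, u j y⟫_ℝ = if i = j then ⟪x, y⟫_ℝ else 0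
  mem : ∀ i x, u i x ∈ P

/-- Isometric embeddings of `L` into `W` whose images are an orthogonal decomposition of `P`. -/
structure IsFrame (P : Submodule A W) (u : κ → (L →ₗ[A] W)) : Prop extends IsOrthoFamily P u where
  complete : ∀ w ∈ P, (∀ i x, ⟪u i x, w⟫_ℝ = 0) → w = 0

/-- The sum of the embeddings of a family. -/
def familySum (u : κ → (L →ₗ[A] W)) : (κ → L) →ₗ[A] W := ∑ i, (u i).comp (LinearMap.proj i)

omit [Algebra ℝ A] [InnerProductSpace ℝ L] [FiniteDimensional ℝ L] [IsScalarTower ℝ A L]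
  [InnerProductSpace ℝ W] [FiniteDimensional ℝ W] [IsScalarTower ℝ A W] [DecidableEq κ] in
theorem familySum_apply (u : κ → (L →ₗ[A] W)) (x : κ → L) : familySum u x = ∑ i, u i (x i) := by
  simp [familySum]

variable {P : Submodule A W} {u : κ → (L →ₗ[A] W)}

theorem IsOrthoFamily.inner_familySum (h : IsOrthoFamily P u) (x : κ → L) (i : κ) (y : L) :
    ⟪familySum u x, u i y⟫_ℝ = ⟪x i, y⟫_ℝ := by
  rw [familySum_apply, sum_inner]
  simp [h.orth]

theorem IsOrthoFamily.familySum_injective (h : IsOrthoFamily P u) : Function.Injective (familySum u) := by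
  rw [injective_iff_map_eq_zero]
  intro x hx
  ext i
  refine ext_inner_right ℝ fun y => ?_
  rw [← h.inner_familySum, hx, inner_zero_left, Pi.zero_apply, inner_zero_left]

theorem IsOrthoFamily.card_mul_finrank_le (h : IsOrthoFamily P u) :
    Fintype.card κ * Module.finrank ℝ L ≤ Module.finrank ℝ W := by
  have := LinearMap.finrank_le_finrank_of_injective (f := (familySum u).restrictScalars ℝ)
    h.familySum_injective
  rw [Module.finrank_pi_fintype] at this
  simpa using this

theorem IsOrthoFamily.range_le (h : IsOrthoFamily P u) : LinearMap.range (familySum u) ≤ P := by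
  rintro _ ⟨x, rfl⟩
  rw [familySum_apply]
  exact Submodule.sum_mem _ fun i _ => h.mem i _

variable {st : A → A} (hL : IsStarRep st L) (hW : IsStarRep st W)

-- If the family is not complete, the orthogonal complement of its images in `P` is a nonzero
-- submodule and contains a simple one isomorphic to `L`. By Schur's lemma the embedding `f'`
-- satisfies `f'* f' = c` with `c > 0`, so dividing by `√c` makes it isometric.
include hL hW in
theorem exists_isOrthoFamily_succ [IsSimpleModule A L]
    (hP : ∀ S : Submodule A W, S ≤ P → IsSimpleModule A S → Nonempty (L ≃ₗ[A] S)) {n : ℕ}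
    {u : Fin n → (L →ₗ[A] W)} (h : IsOrthoFamily P u) (hn : ¬ IsFrame P u) :
    ∃ u' : Fin (n + 1) → (L →ₗ[A] W), IsOrthoFamily P u' := by
  have hex : ∃ w ∈ P, (∀ i x, ⟪u i x, w⟫_ℝ = 0) ∧ w ≠ 0 := by
    by_contra! hc
    exact hn { h with complete := hc }
  obtain ⟨w, hwP, hw, hw0⟩ := hex
  let C : Submodule A W :=
    { carrier := {w | w ∈ P ∧ ∀ i x, ⟪u i x, w⟫_ℝ = 0}
      add_mem' := fun {v w} hv hw => ⟨P.add_mem hv.1 hw.1, fun i x => by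
        rw [inner_add_right, hv.2, hw.2, add_zero]⟩
      zero_mem' := ⟨P.zero_mem, fun i x => inner_zero_right _⟩
      smul_mem' := fun a w hw => ⟨P.smul_mem a hw.1, fun i x => by
        rw [real_inner_comm, hW, real_inner_comm, ← map_smul, hw.2]⟩ }
  have hC : C ≠ ⊥ := by
    intro hC
    apply hw0
    have : w ∈ C := ⟨hwP, hw⟩
    rw [hC] at this
    simpa using this
  have : IsArtinian A W := isArtinian_of_tower ℝ inferInstance
  obtain ⟨S, hS, hSC⟩ := (IsAtomic.eq_bot_or_exists_atom_le C).resolve_left hC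
  have hSs : IsSimpleModule A S := isSimpleModule_iff_isAtom.2 hS
  obtain ⟨f⟩ := hP S (fun x hx => (hSC hx).1) hSs
  let f' : L →ₗ[A] W := S.subtype.comp f.toLinearMap
  have hf' : ∀ x, f' x ∈ C := fun x => hSC (f x).2
  obtain ⟨c, hc⟩ := exists_scalar_of_symmetric ((adj hL hW f').comp f') (fun x y => by
    change ⟪adj hL hW f' (f' x), y⟫_ℝ = ⟪x, adj hL hW f' (f' y)⟫_ℝ
    rw [adj_inner_left, adj_inner_right])
  have hcc : ∀ x y, ⟪f' x, f' y⟫_ℝ = c * ⟪x, y⟫_ℝ := fun x y => by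
    have h1 : adj hL hW f' (f' x) = c • x := hc x
    rw [← adj_inner_left hL hW, h1, real_inner_smul_left]
  have hcpos : 0 < c := by
    have : Nontrivial L := IsSimpleModule.nontrivial A L
    obtain ⟨x, hx⟩ := exists_ne (0 : L)
    have hfx : f' x ≠ 0 := by
      intro h0
      apply hx
      apply f.injective
      apply Subtype.ext
      rw [map_zero]
      exact h0
    have h1 := hcc x x
    have h2 : 0 < ⟪f' x, f' x⟫_ℝ := real_inner_self_pos.2 hfx
    have h3 : 0 < ⟪x, x⟫_ℝ := real_inner_self_pos.2 hx
    rw [h1] at h2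
    exact pos_of_mul_pos_left h2 h3.le
  refine ⟨Fin.cons ((Real.sqrt c)⁻¹ • f') u, ⟨?_, ?_⟩⟩
  · intro i j x y
    refine Fin.cases ?_ (fun i => ?_) i <;> refine Fin.cases ?_ (fun j => ?_) j
    · rw [Fin.cons_zero, LinearMap.smul_apply, LinearMap.smul_apply, real_inner_smul_left,
        real_inner_smul_right, hcc, if_pos rfl, ← mul_assoc, ← mul_assoc, ← mul_inv,
        Real.mul_self_sqrt hcpos.le, inv_mul_cancel₀ hcpos.ne', one_mul]
    · rw [Fin.cons_zero, Fin.cons_succ, if_neg (Fin.succ_ne_zero j).symm, LinearMap.smul_apply,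
        real_inner_smul_left, real_inner_comm, (hf' x).2, mul_zero]
    · rw [Fin.cons_zero, Fin.cons_succ, if_neg (Fin.succ_ne_zero i), LinearMap.smul_apply,
        real_inner_smul_right, (hf' y).2, mul_zero]
    · simp only [Fin.cons_succ, h.orth, Fin.succ_inj]
  · intro i x
    refine Fin.cases ?_ (fun i => ?_) i
    · rw [Fin.cons_zero, LinearMap.smul_apply, ← algebraMap_smul A]
      exact P.smul_mem _ (hf' x).1
    · exact h.mem i x

-- Otherwise orthogonal families could be lengthened indefinitely, although each copy of `L` uses a
-- positive dimension of `W`.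
include hL hW in
theorem exists_isFrame [IsSimpleModule A L]
    (hP : ∀ S : Submodule A W, S ≤ P → IsSimpleModule A S → Nonempty (L ≃ₗ[A] S)) :
    ∃ (n : ℕ) (u : Fin n → (L →ₗ[A] W)), IsFrame P u := by
  by_contra! hno
  have hall : ∀ n : ℕ, ∃ u : Fin n → (L →ₗ[A] W), IsOrthoFamily P u := by
    intro n
    induction n with
    | zero => exact ⟨fun i => i.elim0, ⟨fun i => i.elim0, fun i => i.elim0⟩⟩
    | succ n ih =>
      obtain ⟨u, hu⟩ := ih
      exact exists_isOrthoFamily_succ hL hW hP hu (hno n u)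
  obtain ⟨u, hu⟩ := hall (Module.finrank ℝ W + 1)
  have h1 := hu.card_mul_finrank_le
  have : Nontrivial L := IsSimpleModule.nontrivial A L
  have h2 : 0 < Module.finrank ℝ L := Module.finrank_pos
  rw [Fintype.card_fin] at h1
  nlinarith

theorem IsOrthoFamily.adj_apply (h : IsOrthoFamily P u) (i j : κ) (x : L) :
    adj hL hW (u i) (u j x) = if i = j then x else 0 := by
  refine ext_inner_right ℝ fun y => ?_
  rw [adj_inner_left, h.orth]
  by_cases hij : i = j
  · rw [if_pos hij, if_pos hij.symm]
  · rw [if_neg hij, if_neg (Ne.symm hij), inner_zero_left]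

/-- The sum of the `u_i u_i*` is the orthogonal projection onto `P`: the difference lies in `P` and
is orthogonal to every copy of `L`. -/
theorem IsFrame.sum_adj (h : IsFrame P u) {w : W} (hw : w ∈ P) :
    ∑ i, u i (adj hL hW (u i) w) = w := by
  have h0 : w - ∑ i, u i (adj hL hW (u i) w) = 0 := by
    refine h.complete _ (P.sub_mem hw (Submodule.sum_mem _ fun i _ => h.mem i _)) fun i x => ?_
    rw [inner_sub_right, inner_sum]
    simp only [h.orth]
    simp [adj_inner_right]
  exact (sub_eq_zero.1 h0).symm

-- The frame identifies `P` with a sum of copies of a simple module; this turns its cardinality into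
-- a multiplicity.
include hL hW in
theorem IsFrame.length_eq [IsSimpleModule A L] (h : IsFrame P u) :
    Module.length A P = Fintype.card κ := by
  have hr : LinearMap.range (familySum u) = P := by
    refine le_antisymm h.range_le fun w hw => ⟨fun i => adj hL hW (u i) w, ?_⟩
    rw [familySum_apply, h.sum_adj hL hW hw]
  have e := (LinearEquiv.ofInjective _ h.familySum_injective).trans (LinearEquiv.ofEq _ _ hr)
  rw [← e.length_eq, Module.length_pi_of_fintype]
  simp

/-- The operator on `W` with a given block matrix with respect to a family of embeddings. -/
def blockOp (u : κ → (L →ₗ[A] W)) (Y : Matrix κ κ (Module.End A L)) : Module.End A W :=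
  ∑ i, ∑ j, (u i).comp ((Y i j).comp (adj hL hW (u j)))

omit [DecidableEq κ] in
theorem blockOp_apply (Y : Matrix κ κ (Module.End A L)) (w : W) :
    blockOp hL hW u Y w = ∑ i, ∑ j, u i (Y i j (adj hL hW (u j) w)) := by
  simp [blockOp]

theorem IsOrthoFamily.blockOp_apply (h : IsOrthoFamily P u) (Y : Matrix κ κ (Module.End A L)) (l : κ)
    (x : L) : blockOp hL hW u Y (u l x) = ∑ i, u i (Y i l x) := by
  rw [CliffordQuartic.blockOp_apply]
  refine Finset.sum_congr rfl fun i _ => ?_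
  rw [Finset.sum_eq_single l]
  · rw [h.adj_apply, if_pos rfl]
  · intro j _ hj
    rw [h.adj_apply, if_neg hj, map_zero, map_zero]
  · simp

/-- The relations `u_i* u_j = δ_ij` turn composition of operators into multiplication of block
matrices. -/
theorem IsOrthoFamily.blockOp_mul (h : IsOrthoFamily P u) (X Y : Matrix κ κ (Module.End A L)) :
    blockOp hL hW u (X * Y) = blockOp hL hW u X * blockOp hL hW u Y := by
  refine LinearMap.ext fun w => ?_
  obtain ⟨Z, hZ⟩ : ∃ Z, Z = X * Y := ⟨_, rfl⟩
  have hXY : ∀ i j x, Z i j x = ∑ k, X i k (Y k j x) := fun i j x => by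
    have h1 : Z i j = ∑ k, X i k * Y k j := by rw [hZ]; exact Matrix.mul_apply
    rw [h1, LinearMap.sum_apply]
    rfl
  rw [← hZ, Module.End.mul_apply, CliffordQuartic.blockOp_apply hL hW Z,
    CliffordQuartic.blockOp_apply hL hW Y]
  simp only [map_sum, h.blockOp_apply, hXY]
  calc _ = ∑ i, ∑ k, ∑ j, (u i) ((X i k) ((Y k j) ((adj hL hW (u j)) w))) :=
        Finset.sum_congr rfl fun i _ => Finset.sum_comm
    _ = ∑ k, ∑ i, ∑ j, (u i) ((X i k) ((Y k j) ((adj hL hW (u j)) w))) := Finset.sum_comm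
    _ = _ := Finset.sum_congr rfl fun k _ => Finset.sum_comm

theorem blockOp_add (X Y : Matrix κ κ (Module.End A L)) :
    blockOp hL hW u (X + Y) = blockOp hL hW u X + blockOp hL hW u Y := by
  refine LinearMap.ext fun w => ?_
  simp [CliffordQuartic.blockOp_apply, Finset.sum_add_distrib]

theorem blockOp_smul (r : ℝ) (X : Matrix κ κ (Module.End A L)) :
    blockOp hL hW u (r • X) = r • blockOp hL hW u X := by
  refine LinearMap.ext fun w => ?_
  rw [LinearMap.smul_apply]
  simp only [CliffordQuartic.blockOp_apply, Finset.smul_sum, Matrix.smul_apply, LinearMap.smul_apply,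
    LinearMap.map_smul_of_tower]

theorem inner_blockOp (Y : Matrix κ κ (Module.End A L)) (v w : W) :
    ⟪blockOp hL hW u Y v, w⟫_ℝ = ⟪v, blockOp hL hW u (Matrix.of fun i j => adj hL hL (Y j i)) w⟫_ℝ := by
  rw [blockOp_apply, blockOp_apply, sum_inner, inner_sum]
  simp only [sum_inner, inner_sum]
  rw [Finset.sum_comm]
  refine Finset.sum_congr rfl fun i _ => Finset.sum_congr rfl fun j _ => ?_
  rw [Matrix.of_apply, ← adj_inner_left hL hW, adj_inner_right, ← adj_inner_right hL hW]

theorem IsOrthoFamily.blockOp_mem (h : IsOrthoFamily P u) (Y : Matrix κ κ (Module.End A L)) (w : W) :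
    blockOp hL hW u Y w ∈ P := by
  rw [CliffordQuartic.blockOp_apply]
  exact Submodule.sum_mem _ fun i _ => Submodule.sum_mem _ fun j _ => h.mem i _

theorem IsOrthoFamily.blockOp_of_orthogonal (h : IsOrthoFamily P u) (Y : Matrix κ κ (Module.End A L))
    {w : W} (hw : ∀ y ∈ P, ⟪w, y⟫_ℝ = 0) : blockOp hL hW u Y w = 0 := by
  rw [CliffordQuartic.blockOp_apply]
  refine Finset.sum_eq_zero fun i _ => Finset.sum_eq_zero fun j _ => ?_
  have : adj hL hW (u j) w = 0 := by
    refine ext_inner_right ℝ fun x => ?_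
    rw [adj_inner_left, hw _ (h.mem j x), inner_zero_left]
  rw [this, map_zero, map_zero]

theorem IsOrthoFamily.blockOp_injective (h : IsOrthoFamily P u) :
    Function.Injective (blockOp hL hW u) := by
  intro X Y hXY
  ext i j x
  have h1 : ∀ Z : Matrix κ κ (Module.End A L), Z i j x = adj hL hW (u i) (blockOp hL hW u Z (u j x)) := by
    intro Z
    rw [h.blockOp_apply, map_sum]
    simp only [h.adj_apply]
    simp
  rw [h1, hXY, ← h1]

/-- The blocks are `u_i* X u_j`. They recover `X` because `X` has values in `P` and vanishes on its
orthogonal complement. -/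
theorem IsFrame.exists_blockOp (h : IsFrame P u) (X : Module.End A W) (hX : ∀ w, X w ∈ P)
    (hX' : ∀ w, (∀ y ∈ P, ⟪w, y⟫_ℝ = 0) → X w = 0) : ∃ Y, blockOp hL hW u Y = X := by
  refine ⟨Matrix.of fun i j => (adj hL hW (u i)).comp (X.comp (u j)), LinearMap.ext fun w => ?_⟩
  -- The difference of `w` and its projection is orthogonal to `P`, so `X` does not see it.
  have h1 : X w = X (∑ j, u j (adj hL hW (u j) w)) := by
    rw [← sub_eq_zero, ← map_sub]
    apply hX'
    intro y hy
    rw [inner_sub_left, sum_inner]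
    simp only [← adj_inner_right hL hW (u _) y, adj_inner_left hL hW]
    rw [← inner_sum, h.sum_adj hL hW hy, sub_self]
  rw [blockOp_apply, ← h.sum_adj hL hW (hX w), h1]
  simp [map_sum]

end Frame

end

section

open scoped InnerProductSpace

/-! ### Matrix models of commutants. -/

section CommutantModel

variable {A : Type} [Ring A] [Algebra ℝ A]
variable {W : Type} [NormedAddCommGroup W] [InnerProductSpace ℝ W] [Module A W] [IsScalarTower ℝ A W]
variable {κ : Type} [Fintype κ]
variable {K : Type} [Ring K] [StarRing K] [Algebra ℝ K]

/-- `Ψ` is a star isomorphism of a matrix algebra onto the algebra of the `A`-linear operators on `W`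
which are supported on `P`. -/
structure IsCommutantModel (P : Submodule A W) (Ψ : Matrix κ κ K →ₗ[ℝ] Module.End A W) : Prop where
  map_mul : ∀ X Y, Ψ (X * Y) = Ψ X * Ψ Y
  inner_left : ∀ Y v w, ⟪Ψ Y v, w⟫_ℝ = ⟪v, Ψ Yᴴ w⟫_ℝ
  mem : ∀ Y w, Ψ Y w ∈ P
  orthogonal : ∀ Y w, (∀ y ∈ P, ⟪w, y⟫_ℝ = 0) → Ψ Y w = 0
  injective : Function.Injective Ψ
  exists_eq : ∀ X : Module.End A W, (∀ w, X w ∈ P) →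
    (∀ w, (∀ y ∈ P, ⟪w, y⟫_ℝ = 0) → X w = 0) → ∃ Y, Ψ Y = X

variable {st : A → A}
variable {L : Type} [NormedAddCommGroup L] [InnerProductSpace ℝ L] [FiniteDimensional ℝ L] [Module A L]
  [IsScalarTower ℝ A L] [FiniteDimensional ℝ W]
variable [DecidableEq κ] (hL : IsStarRep st L) (hW : IsStarRep st W) (u : κ → (L →ₗ[A] W))
  (θ : K ≃ₐ[ℝ] Module.End A L)

/-- The operator on `W` with a given block matrix over `K ≅ End L`. -/
def matrixOp : Matrix κ κ K →ₗ[ℝ] Module.End A W where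
  toFun Y := blockOp hL hW u (Y.map θ)
  map_add' X Y := by
    rw [← blockOp_add]
    congr 1
    ext1 i j
    exact map_add θ _ _
  map_smul' r X := by
    rw [RingHom.id_apply, ← blockOp_smul]
    congr 1
    ext1 i j
    exact map_smul θ _ _

omit [StarRing K] in
theorem matrixOp_apply (Y : Matrix κ κ K) : matrixOp hL hW u θ Y = blockOp hL hW u (Y.map θ) := rfl

variable {u} {P : Submodule A W}

omit [StarRing K] in
theorem IsOrthoFamily.matrixOp_apply (h : IsOrthoFamily P u) (Y : Matrix κ κ K) (l : κ) (x : L) :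
    matrixOp hL hW u θ Y (u l x) = ∑ i, u i (θ (Y i l) x) :=
  h.blockOp_apply hL hW _ l x

/-- Block matrices over `Module.End A L` already describe the commutant on `P`; compatibility of `θ`
with conjugation is what turns the adjoint into the conjugate transpose over `K`. -/
theorem IsFrame.isCommutantModel (h : IsFrame P u)
    (hθ : ∀ x, θ (star x) = adj hL hL (θ x)) : IsCommutantModel P (matrixOp hL hW u θ) where
  map_mul X Y := by
    rw [matrixOp_apply, matrixOp_apply, matrixOp_apply, ← h.blockOp_mul]
    congr 1
    exact Matrix.map_mul (f := (θ : K →+* Module.End A L))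
  inner_left Y v w := by
    rw [matrixOp_apply, inner_blockOp, matrixOp_apply]
    have : Matrix.of (fun i j => adj hL hL (Y.map θ j i)) = Yᴴ.map θ := by
      ext1 i j
      exact (hθ _).symm
    rw [this]
  mem Y w := h.blockOp_mem hL hW _ w
  orthogonal Y w hw := h.blockOp_of_orthogonal hL hW _ hw
  injective X Y hXY := by
    have h1 := h.blockOp_injective hL hW hXY
    ext i j
    exact θ.injective (congrFun (congrFun h1 i) j)
  exists_eq X hX hX' := by
    obtain ⟨Y, hY⟩ := h.exists_blockOp hL hW X hX hX'
    refine ⟨Y.map θ.symm, ?_⟩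
    rw [matrixOp_apply, ← hY]
    congr 1
    ext1 i j
    exact θ.apply_symm_apply _

-- The copies of `L` span `P`. This is used to recognize the action of a central element as that of
-- a given matrix.
include hL hW in
theorem IsFrame.eq_on (h : IsFrame P u) (S T : Module.End ℝ W) (hST : ∀ i x, S (u i x) = T (u i x)) {w : W}
    (hw : w ∈ P) : S w = T w := by
  rw [← h.sum_adj hL hW hw, map_sum, map_sum]
  exact Finset.sum_congr rfl fun i _ => hST _ _

end CommutantModel

/-! ### Symmetric representations and their skew operators. -/

section SymmetricRepresentation

variable {p q : ℕ}
variable {W : Type} [NormedAddCommGroup W] [InnerProductSpace ℝ W] [Module (R p q) W]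

/-- The generators of `R_{p,q}` act on `W` by symmetric operators. -/
def IsSymmRep (p q : ℕ) (W : Type) [NormedAddCommGroup W] [InnerProductSpace ℝ W] [Module (R p q) W] :
    Prop :=
  ∀ i (v w : W), ⟪e p q i • v, w⟫_ℝ = ⟪v, e p q i • w⟫_ℝ

/-- The defining relations are unchanged when products are reversed, so the universal property
applies to the opposite algebra. -/
theorem exists_star (p q : ℕ) : ∃ f : R p q →ₐ[ℝ] (R p q)ᵐᵒᵖ, ∀ i, f (e p q i) = .op (e p q i) := by
  refine exists_R_lift _ (fun i => ?_) (fun i j hij => ?_) (fun i j hij => ?_) fun i j => ?_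
  · rw [← MulOpposite.op_mul, e_sq, MulOpposite.op_one]
  · rw [← MulOpposite.op_mul, ← MulOpposite.op_mul, ← MulOpposite.op_neg, e_inl_anticomm hij.symm]
  · rw [← MulOpposite.op_mul, ← MulOpposite.op_mul, ← MulOpposite.op_neg, e_inr_anticomm hij.symm]
  · rw [← MulOpposite.op_mul, ← MulOpposite.op_mul, e_inl_inr_comm]

/-- The transposition: the antiautomorphism of `R_{p,q}` fixing the generators. -/
def transp (p q : ℕ) (a : R p q) : R p q := ((exists_star p q).choose a).unop

theorem transp_e (i : Fin p ⊕ Fin q) : transp p q (e p q i) = e p q i := by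
  rw [transp, (exists_star p q).choose_spec]; rfl

theorem transp_add (a b : R p q) : transp p q (a + b) = transp p q a + transp p q b := by
  rw [transp, map_add]; rfl

theorem transp_mul (a b : R p q) : transp p q (a * b) = transp p q b * transp p q a := by
  rw [transp, map_mul]; rfl

theorem transp_algebraMap (r : ℝ) : transp p q (algebraMap ℝ _ r) = algebraMap ℝ _ r := by
  rw [transp, AlgHom.commutes]; rfl

theorem transp_mem {a : R p q} (ha : a ∈ Rplus p q) : transp p q a ∈ Rplus p q := by
  induction ha using Rplus_induction with
  | halg r => rw [transp_algebraMap]; exact Subalgebra.algebraMap_mem _ _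
  | hgen i j => rw [transp_mul, transp_e, transp_e]; exact e_mul_e_mem _ _
  | hadd x y _ _ hx hy => rw [transp_add]; exact add_mem hx hy
  | hmul x y _ _ hx hy => rw [transp_mul]; exact mul_mem hy hx

/-- The transposition of the even subalgebra. -/
def transpEven (p q : ℕ) (a : Rplus p q) : Rplus p q := ⟨transp p q a, transp_mem a.2⟩

variable [IsScalarTower ℝ (R p q) W]

theorem IsSymmRep.isStarRep (hS : IsSymmRep p q W) : IsStarRep (transp p q) W := by
  intro a
  induction a using R_induction with
  | halg r =>
    intro v w
    rw [transp_algebraMap, algebraMap_smul, algebraMap_smul, real_inner_smul_left, real_inner_smul_right]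
  | hgen i => intro v w; rw [transp_e, hS]
  | hadd x y hx hy =>
    intro v w
    rw [transp_add, add_smul, add_smul, inner_add_left, inner_add_right, hx, hy]
  | hmul x y hx hy => intro v w; rw [transp_mul, mul_smul, mul_smul, hx, hy]

theorem IsSymmRep.isStarRep_even (hS : IsSymmRep p q W) : IsStarRep (transpEven p q) W :=
  fun a v w => hS.isStarRep a v w

/-- The Lie algebra `𝔥_{p,q}` of operators on `W` supported on `P`. -/
def hOn (P : Submodule (R p q) W) : LieSubalgebra ℝ (Module.End ℝ W) where
  carrier := {X | (∀ i v w, ⟪X v, e p q i • w⟫_ℝ + ⟪v, e p q i • X w⟫_ℝ = 0) ∧ (∀ w, X w ∈ P) ∧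
    ∀ w, (∀ y ∈ P, ⟪w, y⟫_ℝ = 0) → X w = 0}
  add_mem' := by
    rintro X Y ⟨h1, h2, h3⟩ ⟨h4, h5, h6⟩
    refine ⟨fun i v w => ?_, fun w => P.add_mem (h2 w) (h5 w), fun w hw => ?_⟩
    · rw [LinearMap.add_apply, LinearMap.add_apply, inner_add_left, smul_add, inner_add_right]
      linarith [h1 i v w, h4 i v w]
    · rw [LinearMap.add_apply, h3 w hw, h6 w hw, add_zero]
  zero_mem' := by
    refine ⟨fun i v w => ?_, fun w => P.zero_mem, fun w hw => rfl⟩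
    rw [LinearMap.zero_apply, LinearMap.zero_apply, smul_zero, inner_zero_left, inner_zero_right, add_zero]
  smul_mem' := by
    rintro c X ⟨h1, h2, h3⟩
    refine ⟨fun i v w => ?_, fun w => ?_, fun w hw => ?_⟩
    · rw [LinearMap.smul_apply, LinearMap.smul_apply, real_inner_smul_left, smul_algebra_smul_comm,
        real_inner_smul_right, ← mul_add, h1, mul_zero]
    · rw [LinearMap.smul_apply, ← algebraMap_smul (R p q)]
      exact P.smul_mem _ (h2 w)
    · rw [LinearMap.smul_apply, h3 w hw, smul_zero]
  lie_mem' := by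
    rintro X Y ⟨h1, h2, h3⟩ ⟨h4, h5, h6⟩
    refine ⟨fun i v w => ?_, fun w => P.sub_mem (h2 _) (h5 _), fun w hw => ?_⟩
    · have e1 := h1 i (Y v) w
      have e2 := h4 i v (X w)
      have e3 := h4 i (X v) w
      have e4 := h1 i v (Y w)
      rw [Ring.lie_def, LinearMap.sub_apply, LinearMap.sub_apply, inner_sub_left, smul_sub,
        inner_sub_right]
      simp only [Module.End.mul_apply]
      linarith
    · rw [Ring.lie_def, LinearMap.sub_apply, Module.End.mul_apply, Module.End.mul_apply, h3 w hw, h6 w hw,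
        map_zero, map_zero, sub_zero]

theorem mem_hOn {P : Submodule (R p q) W} {X : Module.End ℝ W} : X ∈ hOn P ↔
    (∀ i v w, ⟪X v, e p q i • w⟫_ℝ + ⟪v, e p q i • X w⟫_ℝ = 0) ∧ (∀ w, X w ∈ P) ∧
      ∀ w, (∀ y ∈ P, ⟪w, y⟫_ℝ = 0) → X w = 0 := Iff.rfl

omit [InnerProductSpace ℝ W] [IsScalarTower ℝ (R p q) W] in
theorem e_smul_e_smul (i : Fin p ⊕ Fin q) (w : W) : e p q i • e p q i • w = w := by
  rw [smul_smul, e_sq, one_smul]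

/-- An infinitesimal symmetry commutes with the even subalgebra. -/
theorem commute_of_skew (hS : IsSymmRep p q W) {X : Module.End ℝ W}
    (hX : ∀ i v w, ⟪X v, e p q i • w⟫_ℝ + ⟪v, e p q i • X w⟫_ℝ = 0) {a : R p q} (ha : a ∈ Rplus p q) :
    ∀ w, X (a • w) = a • X w := by
  induction ha using Rplus_induction with
  | halg r => intro w; rw [algebraMap_smul, algebraMap_smul, map_smul]
  | hgen i j =>
    intro w
    refine ext_inner_left ℝ fun v => ?_
    rw [mul_smul, mul_smul, ← e_smul_e_smul i v, hS, hS i _ (e p q i • e p q j • X w), e_smul_e_smul]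
    -- Moving `X` across `e_i` turns it into minus its adjoint, and moving it across `e_j` turns it
    -- back.
    have h1 := hX i (e p q i • v) (e p q i • e p q j • w)
    have h2 := hX j (e p q i • v) w
    rw [e_smul_e_smul] at h1
    linarith
  | hadd x y _ _ hx hy => intro w; rw [add_smul, add_smul, map_add, hx, hy]
  | hmul x y _ _ hx hy => intro w; rw [mul_smul, mul_smul, hx, hy]

variable {z : R p q} {ε : ℝ}

/-- Each `z e_i` is even, and `e_i = ε z (z e_i)`. For operators commuting with even elements, the
conditions at the various generators therefore all coincide with the one at `z`. -/
theorem skew_iff_of_odd (hpq : 1 ≤ p + q) (hS : IsSymmRep p q W) (hz : grading p q z = -z)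
    (hzc : ∀ x, z * x = x * z) (hzz : z * z = algebraMap ℝ _ ε) (hε : ε * ε = 1)
    {X : Module.End ℝ W} :
    (∀ i v w, ⟪X v, e p q i • w⟫_ℝ + ⟪v, e p q i • X w⟫_ℝ = 0) ↔
      (∀ a ∈ Rplus p q, ∀ w, X (a • w) = a • X w) ∧ ∀ v w, ⟪X v, z • w⟫_ℝ + ⟪v, z • X w⟫_ℝ = 0 := by
  have hne : Nonempty (Fin p ⊕ Fin q) := by
    rw [← Fintype.card_pos_iff, Fintype.card_sum, Fintype.card_fin, Fintype.card_fin]; omega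
  have hez : ∀ i (w : W), e p q i • w = ε • z • (z * e p q i) • w := fun i w => by
    rw [smul_smul z, ← mul_assoc, hzz, ← algebraMap_smul (R p q) ε, smul_smul, ← mul_assoc, ← map_mul,
      hε, map_one, one_mul]
  have hze : ∀ i (w : W), z • w = (z * e p q i) • e p q i • w := fun i w => by
    rw [smul_smul, mul_assoc, e_sq, mul_one]
  constructor
  · intro hX
    refine ⟨fun a ha => commute_of_skew hS hX ha, fun v w => ?_⟩
    obtain ⟨i⟩ := hne
    have hm := mul_e_mem_of_grading hpq hz i
    have h1 : ∀ w : W, z • w = e p q i • (z * e p q i) • w := fun w => by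
      rw [smul_smul, ← mul_assoc, ← hzc, mul_assoc, e_sq, mul_one]
    rw [h1, h1, ← commute_of_skew hS hX hm]
    exact hX i v _
  · rintro ⟨h1, h2⟩ i v w
    rw [hez, hez, ← h1 _ (mul_e_mem_of_grading hpq hz i), real_inner_smul_right, real_inner_smul_right,
      ← mul_add, h2, mul_zero]

variable {κ : Type} [Fintype κ] [DecidableEq κ]
variable {K : Type} [Ring K] [StarRing K] [Algebra ℝ K] [StarModule ℝ K]

/-- If an odd central element `z` acts on `P` by the matrix `Z`, then `𝔥` is the Lie algebra of matrices
skew with respect to `Z`. -/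
theorem nonempty_equiv_skewHerm (hpq : 1 ≤ p + q) (hS : IsSymmRep p q W) (hz : grading p q z = -z)
    (hzc : ∀ x, z * x = x * z) (hzz : z * z = algebraMap ℝ _ ε) (hε : ε * ε = 1)
    (hzs : ∀ v w : W, ⟪z • v, w⟫_ℝ = ε * ⟪v, z • w⟫_ℝ) {P : Submodule (R p q) W}
    {Ψ : Matrix κ κ K →ₗ[ℝ] Module.End (Rplus p q) W}
    (hΨ : IsCommutantModel (P.restrictScalars (Rplus p q)) Ψ) {Z : Matrix κ κ K}
    (hZ : ∀ w ∈ P, Ψ Z w = z • w) (hZs : Zᴴ = ε • Z) : Nonempty (hOn P ≃ₗ⁅ℝ⁆ skewHerm K Z) := by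
  have key : ∀ (Y : Matrix κ κ K), (∀ v w, ⟪Ψ Y v, z • w⟫_ℝ + ⟪v, z • Ψ Y w⟫_ℝ = 0) ↔
      Yᴴ * Z + Z * Y = 0 := fun Y => by
    have h1 : ∀ w, z • Ψ Y w = Ψ (Z * Y) w := fun w => by
      rw [hΨ.map_mul, Module.End.mul_apply, hZ _ (hΨ.mem Y w)]
    have h2 : ∀ v w, ⟪Ψ Y v, z • w⟫_ℝ = ⟪v, Ψ (Yᴴ * Z) w⟫_ℝ := fun v w => by
      -- The matrix `Z` describes `z` only on `P`, so `z` is first moved onto `Ψ Y v`, which lies in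
      -- `P`.
      have h3 : ⟪Ψ Y v, z • w⟫_ℝ = ε * ⟪z • Ψ Y v, w⟫_ℝ := by rw [hzs, ← mul_assoc, hε, one_mul]
      rw [h3, h1, hΨ.inner_left, Matrix.conjTranspose_mul, hZs, Matrix.mul_smul, map_smul,
        LinearMap.smul_apply, real_inner_smul_right, ← mul_assoc, hε, one_mul]
    constructor
    · intro h
      apply hΨ.injective
      refine LinearMap.ext fun w => ext_inner_left ℝ fun v => ?_
      rw [map_add, LinearMap.add_apply, inner_add_right, ← h2, ← h1, h, map_zero, LinearMap.zero_apply,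
        inner_zero_right]
    · intro h v w
      rw [h2, h1, ← inner_add_right, ← LinearMap.add_apply, ← map_add, h, map_zero, LinearMap.zero_apply,
        inner_zero_right]
  let f : skewHerm K Z →ₗ⁅ℝ⁆ hOn P :=
    { toFun := fun Y => ⟨(Ψ Y.1).restrictScalars ℝ,
        (skew_iff_of_odd hpq hS hz hzc hzz hε).2
          ⟨fun a ha w => (Ψ Y.1).map_smul ⟨a, ha⟩ w, (key Y.1).2 Y.2⟩, hΨ.mem Y.1, hΨ.orthogonal Y.1⟩
      map_add' := fun X Y => Subtype.ext <| LinearMap.ext fun w => by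
        exact LinearMap.congr_fun (map_add Ψ X.1 Y.1) w
      map_smul' := fun r X => Subtype.ext <| LinearMap.ext fun w => by
        exact LinearMap.congr_fun (map_smul Ψ r X.1) w
      map_lie' := fun {X Y} => Subtype.ext <| LinearMap.ext fun w => by
        change Ψ (X.1 * Y.1 - Y.1 * X.1) w = Ψ X.1 (Ψ Y.1 w) - Ψ Y.1 (Ψ X.1 w)
        rw [map_sub, hΨ.map_mul, hΨ.map_mul]
        rfl }
  refine ⟨(LieEquiv.ofBijective f ⟨fun X Y hXY => ?_, fun X => ?_⟩).symm⟩
  · apply Subtype.ext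
    apply hΨ.injective
    refine LinearMap.ext fun w => ?_
    exact LinearMap.congr_fun (congrArg Subtype.val hXY) w
  · obtain ⟨X, hX1, hX2, hX3⟩ := X
    obtain ⟨hc, hsk⟩ := (skew_iff_of_odd hpq hS hz hzc hzz hε).1 hX1
    let X' : Module.End (Rplus p q) W := { X with map_smul' := fun a w => hc a.1 a.2 w }
    obtain ⟨Y, hY⟩ := hΨ.exists_eq X' hX2 hX3
    refine ⟨⟨Y, (key Y).1 ?_⟩, Subtype.ext <| LinearMap.ext fun w => ?_⟩
    · rw [hY]; exact hsk
    · change Ψ Y w = X w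
      rw [hY]; rfl

end SymmetricRepresentation

end

section

open scoped InnerProductSpace

/-! ### The case of an even element anticommuting with the generators. -/

section EvenCore

variable {p q : ℕ}
variable {W : Type} [NormedAddCommGroup W] [InnerProductSpace ℝ W] [Module (R p q) W]
  [IsScalarTower ℝ (R p q) W]
variable {κ : Type} [Fintype κ] [DecidableEq κ]
variable {K : Type} [Ring K] [StarRing K] [Algebra ℝ K] [StarModule ℝ K]
variable {ω : R p q} {ε : ℝ}

theorem commute_of_anticomm (hω : ∀ i, e p q i * ω = -(ω * e p q i)) {a : R p q} (ha : a ∈ Rplus p q) :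
    a * ω = ω * a := by
  induction ha using Rplus_induction with
  | halg r => exact Algebra.commutes r ω
  | hgen i j => rw [mul_assoc, hω, mul_neg, ← mul_assoc, hω, neg_mul, neg_neg, mul_assoc]
  | hadd x y _ _ hx hy => rw [add_mul, mul_add, hx, hy]
  | hmul x y _ _ hx hy => rw [mul_assoc, hy, ← mul_assoc, hx, mul_assoc]

omit [DecidableEq κ] [StarModule ℝ K] in
/-- If an element `ω` anticommutes with the generators, then `𝔥` is isomorphic to every Lie algebra of
pairs of matrices `(a, b)` with `a* = -a` and `b* = ε b` bracketed like the operators `a + ω b`. -/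
theorem nonempty_equiv_of_anticomm (hpq : 1 ≤ p + q) (hS : IsSymmRep p q W) (hω : ω ∈ Rplus p q)
    (hωe : ∀ i, e p q i * ω = -(ω * e p q i)) (hωω : ω * ω = algebraMap ℝ _ ε) (hε : ε * ε = 1)
    (hωs : ∀ v w : W, ⟪ω • v, w⟫_ℝ = ε * ⟪v, ω • w⟫_ℝ)
    {Ψ : Matrix κ κ K →ₗ[ℝ] Module.End (R p q) W} (hΨ : IsCommutantModel ⊤ Ψ)
    {𝔏 : Type} [LieRing 𝔏] [LieAlgebra ℝ 𝔏] (α β : 𝔏 →ₗ[ℝ] Matrix κ κ K)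
    (hα : ∀ x y, α ⁅x, y⁆ = (α x * α y - α y * α x) + ε • (β x * β y - β y * β x))
    (hβ : ∀ x y, β ⁅x, y⁆ = (α x * β y - α y * β x) + (β x * α y - β y * α x))
    (hαs : ∀ x, (α x)ᴴ = -α x) (hβs : ∀ x, (β x)ᴴ = ε • β x)
    (hinj : ∀ x, α x = 0 → β x = 0 → x = 0)
    (hsurj : ∀ a b : Matrix κ κ K, aᴴ = -a → bᴴ = ε • b → ∃ x, α x = a ∧ β x = b) :
    Nonempty (hOn (⊤ : Submodule (R p q) W) ≃ₗ⁅ℝ⁆ 𝔏) := by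
  obtain ⟨k⟩ : Nonempty (Fin p ⊕ Fin q) := by
    rw [← Fintype.card_pos_iff, Fintype.card_sum, Fintype.card_fin, Fintype.card_fin]; omega
  have hωω' : ∀ w : W, ω • ω • w = ε • w := fun w => by rw [smul_smul, hωω, algebraMap_smul]
  have heω : ∀ i (w : W), e p q i • ω • w = -(ω • e p q i • w) := fun i w => by
    rw [smul_smul, hωe, neg_smul, mul_smul]
  have hΨω : ∀ Y (w : W), ω • Ψ Y w = Ψ Y (ω • w) := fun Y w => ((Ψ Y).map_smul ω w).symm
  let F : 𝔏 →ₗ[ℝ] Module.End ℝ W :=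
    { toFun := fun x =>
        { toFun := fun w => Ψ (α x) w + ω • Ψ (β x) w
          map_add' := fun v w => by rw [map_add, map_add, smul_add]; abel
          map_smul' := fun r w => by
            rw [RingHom.id_apply, LinearMap.map_smul_of_tower, LinearMap.map_smul_of_tower,
              smul_algebra_smul_comm, smul_add] }
      map_add' := fun x y => LinearMap.ext fun w => by
        change Ψ (α (x + y)) w + ω • Ψ (β (x + y)) w = _ + ω • _ + (_ + ω • _)
        rw [map_add, map_add, map_add, map_add, LinearMap.add_apply, LinearMap.add_apply, smul_add]
        abel
      map_smul' := fun r x => LinearMap.ext fun w => by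
        change Ψ (α (r • x)) w + ω • Ψ (β (r • x)) w = r • (_ + ω • _)
        rw [map_smul, map_smul, map_smul, map_smul, LinearMap.smul_apply, LinearMap.smul_apply,
          smul_algebra_smul_comm, smul_add] }
  have hF : ∀ x w, F x w = Ψ (α x) w + ω • Ψ (β x) w := fun x w => rfl
  have hmem : ∀ x, F x ∈ hOn (⊤ : Submodule (R p q) W) := fun x => by
    refine ⟨fun i v w => ?_, fun w => trivial, fun w hw => ?_⟩
    · rw [hF, hF, inner_add_left, smul_add, inner_add_right, hωs, hΨ.inner_left, hΨ.inner_left, hαs, hβs,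
        map_neg, LinearMap.neg_apply, inner_neg_right, map_smul Ψ ε, LinearMap.smul_apply,
        real_inner_smul_right, ← mul_assoc, hε, one_mul, heω, inner_neg_right, map_smul, map_smul, map_smul]
      ring
    · have : w = 0 := inner_self_eq_zero.1 (hw w trivial)
      rw [this, map_zero]
  let f : 𝔏 →ₗ⁅ℝ⁆ hOn (⊤ : Submodule (R p q) W) :=
    { toFun := fun x => ⟨F x, hmem x⟩
      map_add' := fun x y => Subtype.ext (map_add F x y)
      map_smul' := fun r x => Subtype.ext (map_smul F r x)
      map_lie' := fun {x y} => Subtype.ext <| LinearMap.ext fun w => by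
        change F ⁅x, y⁆ w = F x (F y w) - F y (F x w)
        simp only [hF, hα, hβ, map_add, map_sub, map_smul, hΨ.map_mul, LinearMap.add_apply,
          LinearMap.sub_apply, LinearMap.smul_apply, Module.End.mul_apply, smul_add, smul_sub, ← hΨω,
          hωω']
        abel }
  refine ⟨(LieEquiv.ofBijective f ⟨?_, fun X => ?_⟩).symm⟩
  · refine (injective_iff_map_eq_zero f).2 fun x hx => ?_
    have h0 : ∀ w, Ψ (α x) w + ω • Ψ (β x) w = 0 := fun w =>
      LinearMap.congr_fun (congrArg Subtype.val hx) w
    -- Conjugation by a generator fixes the commutant and changes the sign of `ω`, so both `a + ω b`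
    -- and `a - ω b` vanish.
    have h1 : ∀ w, Ψ (α x) w - ω • Ψ (β x) w = 0 := fun w => by
      have h2 := congrArg (fun v => e p q k • v) (h0 (e p q k • w))
      simp only [smul_add, smul_zero] at h2
      rw [heω, ← map_smul, ← map_smul, e_smul_e_smul, ← sub_eq_add_neg] at h2
      exact h2
    have h3 : ∀ w, Ψ (α x) w = 0 := fun w => by
      have h4 : (2 : ℝ) • Ψ (α x) w = 0 := by
        have := congrArg₂ (· + ·) (h0 w) (h1 w)
        simp only [add_add_sub_cancel, add_zero] at this
        rw [two_smul, this]
      exact (smul_eq_zero.1 h4).resolve_left two_ne_zero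
    apply hinj
    · apply hΨ.injective
      rw [map_zero]
      exact LinearMap.ext h3
    · apply hΨ.injective
      rw [map_zero]
      refine LinearMap.ext fun w => ?_
      have h5 := h0 w
      rw [h3, zero_add] at h5
      have h6 := hωω' (Ψ (β x) w)
      rw [h5, smul_zero] at h6
      have hε0 : ε ≠ 0 := by rintro rfl; simp at hε
      exact (smul_eq_zero.1 h6.symm).resolve_left hε0
  · obtain ⟨X, hX, -, -⟩ := X
    set E := e p q k with hE
    have hc : ∀ a ∈ Rplus p q, ∀ w, X (a • w) = a • X w := fun a ha => commute_of_skew hS hX ha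
    -- Conjugation by `E` preserves the even subalgebra, so `E X E` commutes with it as `X` does.
    have hEX : ∀ a ∈ Rplus p q, ∀ w, E • X (E • a • w) = a • E • X (E • w) := fun a ha w => by
      have h1 : E • a • w = (E * a * E) • E • w := by
        rw [smul_smul, smul_smul, mul_assoc, hE, e_sq, mul_one]
      rw [h1, hc _ (e_mul_mul_e_mem k ha), smul_smul, smul_smul, ← mul_assoc, ← mul_assoc, hE, e_sq,
        one_mul]
    -- Even elements together with `E` generate the algebra, so commuting with them is full
    -- linearity.
    have hlin : ∀ T : Module.End ℝ W, (∀ a ∈ Rplus p q, ∀ w, T (a • w) = a • T w) →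
        (∀ w, T (E • w) = E • T w) → ∃ T' : Module.End (R p q) W, ∀ w, T' w = T w := fun T h1 h2 => by
      refine ⟨{ T with map_smul' := fun x w => ?_ }, fun w => rfl⟩
      obtain ⟨a, ha, b, hb, rfl⟩ := exists_even_add_odd k x
      change T _ = (a + b * e p q k) • T w
      rw [add_smul, mul_smul, map_add, h1 a ha, h1 b hb, h2, add_smul, mul_smul]
    have hcm : ∀ (r : ℝ) (a : R p q) (w : W), a • r • w = r • a • w := fun r a w =>
      smul_algebra_smul_comm r a w
    let m : R p q → Module.End ℝ W := Algebra.lsmul ℝ ℝ W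
    -- The two halves of `X` are its parts commuting and anticommuting with `E`. The second is
    -- divided by `ω`, whose inverse is `ε ω`, to make it commute with `E` as well.
    let T₁ : Module.End ℝ W := (2⁻¹ : ℝ) • (X + m E * X * m E)
    let T₂ : Module.End ℝ W := (2⁻¹ * ε : ℝ) • (m ω * (X - m E * X * m E))
    have hT₁ : ∀ w, T₁ w = (2⁻¹ : ℝ) • (X w + E • X (E • w)) := fun w => rfl
    have hT₂ : ∀ w, T₂ w = (2⁻¹ * ε : ℝ) • ω • (X w - E • X (E • w)) := fun w => rfl
    obtain ⟨A, hA⟩ := hlin T₁ (fun a ha w => by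
        rw [hT₁, hT₁, hc a ha, hEX a ha, ← smul_add, hcm]) (fun w => by
        rw [hT₁, hT₁, hE, e_smul_e_smul, hcm, smul_add (e p q k), e_smul_e_smul, add_comm])
    obtain ⟨B, hB⟩ := hlin T₂ (fun a ha w => by
        rw [hT₂, hT₂, hc a ha, hEX a ha, ← smul_sub, smul_smul ω a, ← commute_of_anticomm hωe ha, mul_smul a ω, hcm]) (fun w => by
        rw [hT₂, hT₂, hE, e_smul_e_smul, hcm, heω, smul_sub (e p q k), e_smul_e_smul,
          ← smul_neg, neg_sub])
    obtain ⟨a, ha⟩ := hΨ.exists_eq A (fun w => trivial) (fun w hw => by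
      have : w = 0 := inner_self_eq_zero.1 (hw w trivial)
      rw [this, map_zero])
    obtain ⟨b, hb⟩ := hΨ.exists_eq B (fun w => trivial) (fun w hw => by
      have : w = 0 := inner_self_eq_zero.1 (hw w trivial)
      rw [this, map_zero])
    -- The adjoint of `X` is `-E X E`; hence the commuting part is skew, and the symmetry of the
    -- other part is decided by that of `ω`.
    have hX1 : ∀ v w, ⟪X v, w⟫_ℝ = -⟪v, E • X (E • w)⟫_ℝ := fun v w => by
      have := hX k v (E • w)
      rw [← hE] at this
      rw [hE, e_smul_e_smul] at this
      linarith
    have hX2 : ∀ v w, ⟪E • X (E • v), w⟫_ℝ = -⟪v, X w⟫_ℝ := fun v w => by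
      rw [hE, hS, ← hE, hX1, hE, hS, e_smul_e_smul, e_smul_e_smul]
    obtain ⟨x, hxa, hxb⟩ := hsurj a b (by
        apply hΨ.injective
        refine LinearMap.ext fun w => ext_inner_left ℝ fun v => ?_
        rw [← hΨ.inner_left, map_neg, LinearMap.neg_apply, inner_neg_right, ha, hA, hA, hT₁, hT₁,
          real_inner_smul_left, real_inner_smul_right, inner_add_left, inner_add_right, hX1, hX2]
        ring) (by
        apply hΨ.injective
        refine LinearMap.ext fun w => ext_inner_left ℝ fun v => ?_
        have h1 : X (ω • w) - E • X (E • ω • w) = ω • (X w - E • X (E • w)) := by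
          rw [hc ω hω, hEX ω hω, smul_sub]
        rw [← hΨ.inner_left, map_smul, LinearMap.smul_apply, hb, hB, hB, hT₂, hT₂, real_inner_smul_left,
          hωs, inner_sub_left, hX1, hX2, ← h1, real_inner_smul_right, real_inner_smul_right, inner_sub_right]
        linear_combination (2⁻¹ * (⟪v, X (ω • w)⟫_ℝ - ⟪v, E • X (E • ω • w)⟫_ℝ) - 2⁻¹ *
          (⟪v, X (ω • w)⟫_ℝ - ⟪v, E • X (E • ω • w)⟫_ℝ)) * hε)
    refine ⟨x, Subtype.ext <| LinearMap.ext fun w => ?_⟩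
    change Ψ (α x) w + ω • Ψ (β x) w = X w
    rw [hxa, hxb, ha, hb, hA, hB, hT₁, hT₂, smul_algebra_smul_comm, hωω', smul_smul, mul_assoc, hε, mul_one,
      ← smul_add, add_add_sub_cancel, ← two_smul ℝ, smul_smul, inv_mul_cancel₀ two_ne_zero, one_smul]

end EvenCore

end

section

open scoped InnerProductSpace

/-! ### Existence of commutant models for isotypic spaces. -/

section Models

variable {A : Type} [Ring A] [Algebra ℝ A] {st : A → A}
variable {W : Type} [NormedAddCommGroup W] [InnerProductSpace ℝ W] [FiniteDimensional ℝ W] [Module A W]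
  [IsScalarTower ℝ A W]

/-- A simple submodule inherits the inner product of `W`, so no invariant inner product has to be
constructed on an abstract simple module. -/
theorem exists_simple_isometry (hW : IsStarRep st W) {P : Submodule A W} (hP : P ≠ ⊥) :
    ∃ (L : Type) (_ : NormedAddCommGroup L) (_ : InnerProductSpace ℝ L) (_ : FiniteDimensional ℝ L)
      (_ : Module A L) (_ : IsScalarTower ℝ A L) (_ : IsSimpleModule A L) (ι : L →ₗ[A] W),
      IsStarRep st L ∧ (∀ x, ι x ∈ P) ∧ ∀ x y, ⟪ι x, ι y⟫_ℝ = ⟪x, y⟫_ℝ := by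
  have : IsArtinian A W := isArtinian_of_tower ℝ inferInstance
  obtain ⟨S, hS, hSP⟩ := (IsAtomic.eq_bot_or_exists_atom_le P).resolve_left hP
  have hSs : IsSimpleModule A S := isSimpleModule_iff_isAtom.2 hS
  refine ⟨S.restrictScalars ℝ, inferInstance, inferInstance, inferInstance, inferInstance, inferInstance,
    hSs, S.subtype, fun a v w => hW a v w, fun x => hSP x.2, fun x y => rfl⟩

/-- All simple submodules of `P` are isomorphic. -/
def IsIsotypicOn (P : Submodule A W) : Prop :=
  ∀ S T : Submodule A W, S ≤ P → T ≤ P → IsSimpleModule A S → IsSimpleModule A T → Nonempty (S ≃ₗ[A] T)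

omit [Algebra ℝ A] [InnerProductSpace ℝ W] [FiniteDimensional ℝ W] [IsScalarTower ℝ A W] in
theorem IsIsotypicOn.nonempty_equiv {P : Submodule A W} (hP : IsIsotypicOn P) {L : Type} [AddCommGroup L]
    [Module A L] [IsSimpleModule A L] {ι : L →ₗ[A] W} (hι : Function.Injective ι) (hιP : ∀ x, ι x ∈ P)
    (S : Submodule A W) (hS : S ≤ P) (hSs : IsSimpleModule A S) : Nonempty (L ≃ₗ[A] S) := by
  have e := LinearEquiv.ofInjective ι hι
  obtain ⟨f⟩ := hP (LinearMap.range ι) S (by rintro _ ⟨x, rfl⟩; exact hιP x) hS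
    (IsSimpleModule.congr e.symm) hSs
  exact ⟨e.trans f⟩

omit [Algebra ℝ A] [FiniteDimensional ℝ W] [IsScalarTower ℝ A W] in
theorem injective_of_isometry {L : Type} [NormedAddCommGroup L] [InnerProductSpace ℝ L] [Module A L]
    {ι : L →ₗ[A] W} (hι : ∀ x y, ⟪ι x, ι y⟫_ℝ = ⟪x, y⟫_ℝ) : Function.Injective ι := by
  rw [injective_iff_map_eq_zero]
  intro x hx
  rw [← inner_self_eq_zero (𝕜 := ℝ), ← hι, hx, inner_zero_left]

variable {K : Type} [DivisionRing K] [Algebra ℝ K] [StarRing K] [StarModule ℝ K]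

/-- Traces and norms of elements of `K` are real. -/
def HasRealNorm (K : Type) [Ring K] [Algebra ℝ K] [StarRing K] : Prop :=
  ∀ x : K, ∃ t n : ℝ, x + star x = algebraMap ℝ K t ∧ star x * x = algebraMap ℝ K n

theorem hasRealNorm_real : HasRealNorm ℝ := fun x =>
  ⟨x + x, x * x, by simp, by simp⟩

theorem hasRealNorm_complex : HasRealNorm ℂ := fun x =>
  ⟨2 * x.re, Complex.normSq x, by rw [Complex.star_def, Complex.add_conj]; simp, by
    rw [Complex.star_def]; exact Complex.normSq_eq_conj_mul_self.symm⟩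

theorem hasRealNorm_quaternion : HasRealNorm (Quaternion ℝ) := fun x =>
  ⟨2 * x.re, Quaternion.normSq x, by rw [Quaternion.self_add_star']; rfl, by
    rw [Quaternion.star_mul_self]; rfl⟩

omit [FiniteDimensional ℝ W] [StarModule ℝ K] in
theorem isCommutantModel_bot {κ : Type} [Fintype κ] [IsEmpty κ] :
    IsCommutantModel (⊥ : Submodule A W) (0 : Matrix κ κ K →ₗ[ℝ] Module.End A W) where
  map_mul X Y := by simp
  inner_left Y v w := by simp
  mem Y w := by simp
  orthogonal Y w _ := by simp
  injective X Y _ := Subsingleton.elim X Y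
  exists_eq X hX _ := ⟨0, LinearMap.ext fun w => ((Submodule.mem_bot A).1 (hX w)).symm⟩

/-- A frame built from one simple submodule has as many members as the length of `P`, and the
endomorphisms of that submodule form `K`. The zero space contains no simple submodule and needs the
empty model. -/
theorem exists_isCommutantModel (hW : IsStarRep st W) (hK : HasRealNorm K) {s : ℕ}
    (hA : IsMatrixSum A s K) {P : Submodule A W} (hP : IsIsotypicOn P) {n : ℕ}
    (hn : Module.length A P = n) :
    ∃ Ψ : Matrix (Fin n) (Fin n) K →ₗ[ℝ] Module.End A W, IsCommutantModel P Ψ := by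
  by_cases h0 : P = ⊥
  · subst h0
    have : n = 0 := by
      rw [Module.length_eq_zero] at hn
      exact_mod_cast hn.symm
    subst this
    exact ⟨0, isCommutantModel_bot⟩
  obtain ⟨L, _, _, _, _, _, _, ι, hL, hιP, hι⟩ := exists_simple_isometry hW h0
  obtain ⟨m, u, hu⟩ := exists_isFrame hL hW (hP.nonempty_equiv (injective_of_isometry hι) hιP)
  have hm := hu.length_eq hL hW
  rw [hn, Fintype.card_fin] at hm
  obtain rfl : n = m := by exact_mod_cast hm
  obtain ⟨θ⟩ := hA.nonempty_equiv_end L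
  exact ⟨_, hu.isCommutantModel hL hW θ (algEquiv_star hL hK θ)⟩

end Models

/-! ### Models in which an odd central element has square 1. -/

section OddCentral

variable {p q : ℕ}

/-- When every element acts like an even one, the two lattices of submodules are the same. -/
theorem length_eq_of_forall_exists {M : Type} [AddCommGroup M] [Module (R p q) M]
    (h : ∀ a : R p q, ∃ b : Rplus p q, ∀ m : M, a • m = b • m) :
    Module.length (R p q) M = Module.length (Rplus p q) M := by
  let f : Submodule (R p q) M ≃o Submodule (Rplus p q) M :=
    { toFun := fun N => N.restrictScalars (Rplus p q)
      invFun := fun N => { N with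
        smul_mem' := fun a m hm => by
          obtain ⟨b, hb⟩ := h a
          rw [hb]
          exact N.smul_mem b hm }
      left_inv := fun N => rfl
      right_inv := fun N => rfl
      map_rel_iff' := Iff.rfl }
  apply WithBot.coe_injective
  rw [Module.coe_length, Module.coe_length, Order.krullDim_eq_of_orderIso f]

variable {W : Type} [NormedAddCommGroup W] [InnerProductSpace ℝ W] [Module (R p q) W]
  [IsScalarTower ℝ (R p q) W]

/-- The eigenspace of a central element. -/
def centralEigenspace (W : Type) [NormedAddCommGroup W] [InnerProductSpace ℝ W] [Module (R p q) W]
    [IsScalarTower ℝ (R p q) W] {z : R p q} (hzc : ∀ x, z * x = x * z) (c : ℝ) :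
    Submodule (R p q) W where
  carrier := {w | z • w = c • w}
  add_mem' := fun {v w} hv hw => by
    change z • (v + w) = c • (v + w)
    rw [smul_add, smul_add, hv, hw]
  zero_mem' := by
    change z • (0 : W) = c • (0 : W)
    rw [smul_zero, smul_zero]
  smul_mem' := fun a w hw => by
    change z • (a • w) = c • (a • w)
    rw [smul_smul, hzc, mul_smul, hw, smul_algebra_smul_comm]

variable {z : R p q} {ε : ℝ}

theorem mem_centralEigenspace (hzc : ∀ x, z * x = x * z) {c : ℝ} {w : W} :
    w ∈ centralEigenspace W hzc c ↔ z • w = c • w := Iff.rfl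

/-- A generator equals `ε z (z e_k)` with `z e_k` even, so the odd part `b' e_k` is `z` times an
even element. -/
theorem exists_even_add_central (hpq : 1 ≤ p + q) (hz : grading p q z = -z) (hzc : ∀ x, z * x = x * z)
    (hzz : z * z = algebraMap ℝ _ ε) (hε : ε * ε = 1) (a : R p q) :
    ∃ b ∈ Rplus p q, ∃ b' ∈ Rplus p q, a = b + z * b' := by
  obtain ⟨k⟩ : Nonempty (Fin p ⊕ Fin q) := by
    rw [← Fintype.card_pos_iff, Fintype.card_sum, Fintype.card_fin, Fintype.card_fin]; omega
  obtain ⟨b, hb, b', hb', rfl⟩ := exists_even_add_odd k a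
  refine ⟨b, hb, ε • (b' * (z * e p q k)), Subalgebra.smul_mem _
    (mul_mem hb' (mul_e_mem_of_grading hpq hz k)) ε, ?_⟩
  have h1 : z * (b' * (z * e p q k)) = b' * (z * z * e p q k) := by
    rw [← mul_assoc z, hzc, mul_assoc, mul_assoc]
  rw [mul_smul_comm, h1, hzz, ← Algebra.smul_def, mul_smul_comm, smul_smul, hε, one_smul]

/-- On the eigenspace `b + z b'` acts as the even element `b + c b'`. The lengths over the full
algebra can thus be used to count the copies in frames over the even subalgebra. -/
theorem length_centralEigenspace (hpq : 1 ≤ p + q) (hz : grading p q z = -z)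
    (hzc : ∀ x, z * x = x * z) (hzz : z * z = algebraMap ℝ _ ε) (hε : ε * ε = 1) (c : ℝ)
    {N : Submodule (R p q) W} (hN : N ≤ centralEigenspace W hzc c) :
    Module.length (R p q) N = Module.length (Rplus p q) (N.restrictScalars (Rplus p q)) := by
  refine length_eq_of_forall_exists fun a => ?_
  obtain ⟨b, hb, b', hb', rfl⟩ := exists_even_add_central hpq hz hzc hzz hε a
  refine ⟨⟨b + c • b', add_mem hb (Subalgebra.smul_mem _ hb' c)⟩, fun m => Subtype.ext ?_⟩
  change (b + z * b') • (m : W) = (b + c • b') • (m : W)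
  rw [add_smul, mul_smul, add_smul, hN (N.smul_mem b' m.2), smul_assoc]

variable [FiniteDimensional ℝ W]
variable {K : Type} [DivisionRing K] [Algebra ℝ K] [StarRing K] [StarModule ℝ K]

omit [StarModule ℝ K] in
theorem conjTranspose_diagSign (a b : ℕ) : (diagSign K a b)ᴴ = (1 : ℝ) • diagSign K a b := by
  rw [one_smul, diagSign, Matrix.diagonal_conjTranspose]
  congr 1
  ext1 i
  rcases i with i | i <;> simp

/-- If an odd central element `z` has square `1`, then the even subalgebra has a commutant model in
which `z` is the diagonal matrix of signs. -/
theorem exists_isCommutantModel_diagSign (hpq : 1 ≤ p + q) (hS : IsSymmRep p q W) (hK : HasRealNorm K)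
    {s : ℕ} (hA : IsMatrixSum (Rplus p q) s K) (hz : grading p q z = -z) (hzc : ∀ x, z * x = x * z)
    (hzz : z * z = 1) (hzs : ∀ v w : W, ⟪z • v, w⟫_ℝ = ⟪v, z • w⟫_ℝ) {P : Submodule (R p q) W}
    (hP : IsIsotypicOn (P.restrictScalars (Rplus p q))) {a b : ℕ}
    (ha : Module.length (R p q) (P ⊓ centralEigenspace W hzc 1 : Submodule (R p q) W) = a)
    (hb : Module.length (R p q) (P ⊓ centralEigenspace W hzc (-1) : Submodule (R p q) W) = b) :
    ∃ Ψ : Matrix (Fin a ⊕ Fin b) (Fin a ⊕ Fin b) K →ₗ[ℝ] Module.End (Rplus p q) W,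
      IsCommutantModel (P.restrictScalars (Rplus p q)) Ψ ∧ ∀ w ∈ P, Ψ (diagSign K a b) w = z • w := by
  have hzz' : z * z = algebraMap ℝ (R p q) 1 := by rw [hzz, map_one]
  rw [length_centralEigenspace hpq hz hzc hzz' (one_mul 1) 1 inf_le_right] at ha
  rw [length_centralEigenspace hpq hz hzc hzz' (one_mul 1) (-1) inf_le_right] at hb
  by_cases h0 : P = ⊥
  · subst h0
    have ha0 : a = 0 := by
      rw [Module.length_eq_zero_iff.2 ?_] at ha
      · exact_mod_cast ha.symm
      · refine ⟨fun x y => Subtype.ext ?_⟩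
        rw [(Submodule.mem_bot (R p q)).1 x.2.1, (Submodule.mem_bot (R p q)).1 y.2.1]
    have hb0 : b = 0 := by
      rw [Module.length_eq_zero_iff.2 ?_] at hb
      · exact_mod_cast hb.symm
      · refine ⟨fun x y => Subtype.ext ?_⟩
        rw [(Submodule.mem_bot (R p q)).1 x.2.1, (Submodule.mem_bot (R p q)).1 y.2.1]
    subst ha0 hb0
    refine ⟨0, isCommutantModel_bot, fun w hw => ?_⟩
    rw [(Submodule.mem_bot (R p q)).1 hw, smul_zero]
    rfl
  have hW := hS.isStarRep_even
  obtain ⟨L, _, _, _, _, _, _, ι, hL, hιP, hι⟩ := exists_simple_isometry hW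
    (P := P.restrictScalars (Rplus p q)) (by simpa using h0)
  have hiso := hP.nonempty_equiv (injective_of_isometry hι) hιP
  -- Since `P` is isotypic over the even subalgebra, the same `L` serves for both eigenspaces of
  -- `z`; the signs then appear on the diagonal.
  obtain ⟨m, u, hu⟩ := exists_isFrame (P := (P ⊓ centralEigenspace W hzc 1).restrictScalars (Rplus p q))
    hL hW (fun S hS hSs => hiso S (fun x hx => (hS hx).1) hSs)
  obtain ⟨n, v, hv⟩ := exists_isFrame (P := (P ⊓ centralEigenspace W hzc (-1)).restrictScalars (Rplus p q))
    hL hW (fun S hS hSs => hiso S (fun x hx => (hS hx).1) hSs)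
  have hm := ha.symm.trans (hu.length_eq hL hW)
  rw [Fintype.card_fin] at hm
  obtain rfl : a = m := by exact_mod_cast hm
  have hn := hb.symm.trans (hv.length_eq hL hW)
  rw [Fintype.card_fin] at hn
  obtain rfl : b = n := by exact_mod_cast hn
  have huz : ∀ i x, z • u i x = u i x := fun i x => by
    have := (hu.mem i x).2
    rwa [SetLike.mem_coe, mem_centralEigenspace, one_smul] at this
  have hvz : ∀ i x, z • v i x = -v i x := fun i x => by
    have := (hv.mem i x).2
    rwa [SetLike.mem_coe, mem_centralEigenspace, neg_smul, one_smul] at this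
  have huv : ∀ i j x y, ⟪u i x, v j y⟫_ℝ = 0 := fun i j x y => by
    have h1 := hzs (u i x) (v j y)
    rw [huz, hvz, inner_neg_right] at h1
    linarith
  have hfr : IsFrame (P.restrictScalars (Rplus p q)) (Sum.elim u v) := by
    refine ⟨⟨?_, ?_⟩, fun w hw hw0 => ?_⟩
    · rintro (i | i) (j | j) x y
      · simp only [Sum.elim_inl, hu.orth, Sum.inl.injEq]
      · rw [if_neg (by simp)]; exact huv _ _ _ _
      · rw [if_neg (by simp), real_inner_comm]; exact huv _ _ _ _
      · simp only [Sum.elim_inr, hv.orth, Sum.inr.injEq]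
    · rintro (i | i) x
      · exact (hu.mem i x).1
      · exact (hv.mem i x).1
    -- The vectors `w + z w` and `w - z w` lie in the two eigenspaces and remain orthogonal to the
    -- respective frames, so both vanish.
    · have hw1 : w + z • w = 0 := by
        refine hu.complete _ ⟨P.add_mem hw (P.smul_mem z hw), ?_⟩ fun i x => ?_
        · rw [SetLike.mem_coe, mem_centralEigenspace, one_smul, smul_add, smul_smul, hzz, one_smul,
            add_comm]
        · rw [inner_add_right, ← hzs, huz]
          have := hw0 (.inl i) x
          rw [Sum.elim_inl] at this
          rw [this, add_zero]
      have hw2 : w - z • w = 0 := by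
        refine hv.complete _ ⟨P.sub_mem hw (P.smul_mem z hw), ?_⟩ fun i x => ?_
        · rw [SetLike.mem_coe, mem_centralEigenspace, neg_smul, one_smul, smul_sub, smul_smul, hzz, one_smul,
            neg_sub]
        · rw [inner_sub_right, ← hzs, hvz, inner_neg_left]
          have := hw0 (.inr i) x
          rw [Sum.elim_inr] at this
          rw [this, neg_zero, sub_zero]
      have h2 : (2 : ℝ) • w = 0 := by
        rw [two_smul]
        calc w + w = (w + z • w) + (w - z • w) := by abel
          _ = 0 := by rw [hw1, hw2, add_zero]
      exact (smul_eq_zero.1 h2).resolve_left two_ne_zero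
  obtain ⟨θ⟩ := hA.nonempty_equiv_end L
  refine ⟨_, hfr.isCommutantModel hL hW θ (algEquiv_star hL hK θ), fun w hw => ?_⟩
  refine hfr.eq_on hL hW ((matrixOp hL hW (Sum.elim u v) θ (diagSign K a b)).restrictScalars ℝ)
    (Algebra.lsmul ℝ ℝ W z) (fun i x => ?_) hw
  change matrixOp hL hW (Sum.elim u v) θ (diagSign K a b) (Sum.elim u v i x) = z • Sum.elim u v i x
  rw [hfr.matrixOp_apply, Finset.sum_eq_single i]
  · rcases i with i | i
    · simp [diagSign, huz]
    · simp [diagSign, hvz]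
  · intro j _ hj
    rw [diagSign, Matrix.diagonal_apply_ne _ hj, map_zero, LinearMap.zero_apply, map_zero]
  · simp

end OddCentral

end

section

open scoped InnerProductSpace Quaternion

/-! ### Models in which an odd central element has square -1. -/

section SymplecticModel

variable {p q : ℕ} {z : R p q}
variable {W : Type} [NormedAddCommGroup W] [InnerProductSpace ℝ W] [Module (R p q) W]
  [IsScalarTower ℝ (R p q) W]
variable {V : Type} [NormedAddCommGroup V] [InnerProductSpace ℝ V] [Module (R p q) V]
  [IsScalarTower ℝ (R p q) V]

/-- The action of a central element is linear. -/
def centralOp (V : Type) [AddCommGroup V] [Module (R p q) V] (hzc : ∀ x, z * x = x * z) :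
    Module.End (R p q) V where
  toFun v := z • v
  map_add' := smul_add z
  map_smul' a v := by rw [smul_smul, hzc, mul_smul, RingHom.id_apply]

omit [InnerProductSpace ℝ V] [IsScalarTower ℝ (R p q) V] in
/-- A nonzero subspace of a simple module stable under the even subalgebra generates the module under
an odd central element. -/
theorem forall_of_even_of_central (hpq : 1 ≤ p + q) (hz : grading p q z = -z)
    (hzc : ∀ x, z * x = x * z) (hzz : z * z = algebraMap ℝ _ (-1)) [IsSimpleModule (R p q) V]
    (N : Submodule (Rplus p q) V) (hN : N ≠ ⊥) {E : Type} [AddCommGroup E] (f : V →+ E)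
    (h1 : ∀ v ∈ N, f v = 0) (h2 : ∀ v ∈ N, f (z • v) = 0) (v : V) : f v = 0 := by
  -- This is the largest submodule over the full algebra inside the kernel of `f`. It contains `N`
  -- because every element has the form `b + z b'` with `b` and `b'` even, so by simplicity it is
  -- everything.
  let T : Submodule (R p q) V :=
    { carrier := {v | ∀ a : R p q, f (a • v) = 0}
      add_mem' := fun {v w} hv hw a => by rw [smul_add, map_add, hv, hw, add_zero]
      zero_mem' := fun a => by rw [smul_zero, map_zero]
      smul_mem' := fun a v hv b => by rw [smul_smul]; exact hv _ }
  have hNT : ∀ v ∈ N, v ∈ T := fun v hv a => by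
    obtain ⟨b, hb, b', hb', rfl⟩ := exists_even_add_central hpq hz hzc hzz (by norm_num) a
    have e1 : f (b • v) = 0 := h1 _ (N.smul_mem ⟨b, hb⟩ hv)
    have e2 : f (z • b' • v) = 0 := h2 _ (N.smul_mem ⟨b', hb'⟩ hv)
    rw [add_smul, map_add, mul_smul, e1, e2, add_zero]
  have hT : T = ⊤ := by
    refine (eq_bot_or_eq_top T).resolve_left fun h => hN ?_
    rw [eq_bot_iff]
    intro v hv
    have := hNT v hv
    rw [h] at this
    exact this
  have hv : v ∈ T := by rw [hT]; trivial
  have := hv 1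
  rwa [one_smul] at this

variable [FiniteDimensional ℝ W]

theorem J_conjTranspose (n : ℕ) : (Matrix.J (Fin n) ℝ)ᴴ = (-1 : ℝ) • Matrix.J (Fin n) ℝ := by
  rw [Matrix.conjTranspose_eq_transpose_of_trivial, Matrix.J_transpose, neg_one_smul]

set_option maxHeartbeats 1000000 in
/-- If an odd central element `z` has square `-1` and the commutants of the even subalgebra are real,
then the even subalgebra has a commutant model in which `z` is the symplectic matrix. -/
theorem exists_isCommutantModel_J (hpq : 1 ≤ p + q) (hS : IsSymmRep p q W) {s : ℕ}
    (hA : IsMatrixSum (Rplus p q) s ℝ) (hz : grading p q z = -z) (hzc : ∀ x, z * x = x * z)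
    (hzz : z * z = -1) (hzs : ∀ v w : W, ⟪z • v, w⟫_ℝ = -⟪v, z • w⟫_ℝ) {P : Submodule (R p q) W}
    (hP : IsIsotypicOn P) {n : ℕ} (hn : Module.length (R p q) P = n) :
    ∃ Ψ : Matrix (Fin n ⊕ Fin n) (Fin n ⊕ Fin n) ℝ →ₗ[ℝ] Module.End (Rplus p q) W,
      IsCommutantModel (P.restrictScalars (Rplus p q)) Ψ ∧
        ∀ w ∈ P, Ψ (Matrix.J (Fin n) ℝ) w = z • w := by
  by_cases h0 : P = ⊥
  · subst h0
    rw [Module.length_eq_zero] at hn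
    obtain rfl : n = 0 := by exact_mod_cast hn.symm
    refine ⟨0, isCommutantModel_bot, fun w hw => ?_⟩
    rw [(Submodule.mem_bot (R p q)).1 hw, smul_zero]
    rfl
  have hW := hS.isStarRep_even
  obtain ⟨V, _, _, _, _, _, _, ι, hV, hιP, hι⟩ := exists_simple_isometry hS.isStarRep h0
  obtain ⟨m, u, hu⟩ := exists_isFrame hV hS.isStarRep
    (hP.nonempty_equiv (injective_of_isometry hι) hιP)
  have hm := hn.symm.trans (hu.length_eq hV hS.isStarRep)
  rw [Fintype.card_fin] at hm
  obtain rfl : n = m := by exact_mod_cast hm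
  have hVS : IsSymmRep p q V := fun i v w => by rw [hV, transp_e]
  have : Nontrivial V := IsSimpleModule.nontrivial (R p q) V
  obtain ⟨L, _, _, _, _, _, _, j, hL, -, hj⟩ := exists_simple_isometry hVS.isStarRep_even
    (P := (⊤ : Submodule (Rplus p q) V)) top_ne_bot
  have : Nontrivial L := IsSimpleModule.nontrivial (Rplus p q) L
  have hjb : LinearMap.range j ≠ ⊥ := by
    obtain ⟨x, hx⟩ := exists_ne (0 : L)
    intro h
    apply hx
    apply injective_of_isometry hj
    have : j x ∈ LinearMap.range j := ⟨x, rfl⟩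
    rw [h] at this
    rwa [map_zero]
  obtain ⟨θ⟩ := hA.nonempty_equiv_end L
  have hθ : ∀ (r : ℝ) x, θ r x = r • x := fun r x => by
    rw [show r = algebraMap ℝ ℝ r from rfl, AlgEquiv.commutes]
    rfl
  have hzW : ∀ v w : W, ⟪z • v, z • w⟫_ℝ = ⟪v, w⟫_ℝ := fun v w => by
    rw [hzs, smul_smul, hzz, neg_smul, one_smul, inner_neg_right, neg_neg]
  have hzV : ∀ v w : V, ⟪z • v, w⟫_ℝ = -⟪v, z • w⟫_ℝ := fun v w => by
    rw [← hι, map_smul, hzs, ← map_smul, hι]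
  -- The compression of `z` to `L` is a skew endomorphism of `L`; the endomorphisms being real
  -- scalars, it is zero. Thus `L` and `z L` are orthogonal inside `V`.
  have hzj : ∀ x y, ⟪j x, z • j y⟫_ℝ = 0 := by
    let T : Module.End (Rplus p q) L := (adj hL hVS.isStarRep_even j).comp
      (((centralOp V hzc).restrictScalars (Rplus p q)).comp j)
    have hT : ∀ x y, ⟪x, T y⟫_ℝ = ⟪j x, z • j y⟫_ℝ := fun x y =>
      adj_inner_right hL hVS.isStarRep_even _ _ _
    obtain ⟨r, hr⟩ := θ.surjective T
    have hTr : ∀ x, T x = r • x := fun x => by rw [← hr, hθ]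
    obtain ⟨x, hx⟩ := exists_ne (0 : L)
    have h1 : ⟪x, T x⟫_ℝ = 0 := by
      have h2 := hzV (j x) (j x)
      rw [real_inner_comm] at h2
      rw [hT]
      linarith
    rw [hTr, real_inner_smul_right] at h1
    have hr0 : r = 0 := (mul_eq_zero.1 h1).resolve_right (inner_self_ne_zero.2 hx)
    intro x y
    rw [← hT, hTr, hr0, zero_smul, inner_zero_right]
  -- Each copy of `V` contributes the two copies `L` and `z L` of the even module, so the matrices
  -- have size `2 n`; `z` exchanges the two with a sign, which is the action of `J`.
  let v : Fin n ⊕ Fin n → (L →ₗ[Rplus p q] W) :=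
    Sum.elim (fun i => ((u i).restrictScalars (Rplus p q)).comp j)
      (fun i => ((centralOp W hzc).restrictScalars (Rplus p q)).comp
        (((u i).restrictScalars (Rplus p q)).comp j))
  have hv1 : ∀ i x, v (.inl i) x = u i (j x) := fun i x => rfl
  have hv2 : ∀ i x, v (.inr i) x = z • u i (j x) := fun i x => rfl
  have huv : ∀ i k x y, ⟪u i (j x), z • u k (j y)⟫_ℝ = 0 := fun i k x y => by
    rw [← map_smul, hu.orth]
    split_ifs
    · exact hzj x y
    · rfl
  clear_value v
  have hfr : IsFrame (P.restrictScalars (Rplus p q)) v := by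
    refine ⟨⟨?_, ?_⟩, fun w hw hw0 => ?_⟩
    · rintro (i | i) (k | k) x y
      · simp only [hv1, hu.orth, hj, Sum.inl.injEq]
      · rw [if_neg (by simp), hv1, hv2, huv]
      · rw [if_neg (by simp), hv1, hv2, real_inner_comm, huv]
      · simp only [hv2, hzW, hu.orth, hj, Sum.inr.injEq]
    · rintro (i | i) x
      · rw [hv1]; exact hu.mem i _
      · rw [hv2]; exact P.smul_mem z (hu.mem i _)
    · refine hu.complete w hw fun i x => ?_
      -- For completeness, a functional on `V` vanishing on `L` and `z L` vanishes altogether.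
      let f : V →+ ℝ :=
        { toFun := fun x => ⟪u i x, w⟫_ℝ
          map_zero' := by rw [map_zero, inner_zero_left]
          map_add' := fun x y => by rw [map_add, inner_add_left] }
      refine forall_of_even_of_central hpq hz hzc (by rw [hzz, map_neg, map_one]) _ hjb f ?_ ?_ x
      · rintro _ ⟨y, rfl⟩
        have := hw0 (.inl i) y
        rwa [hv1] at this
      · rintro _ ⟨y, rfl⟩
        change ⟪u i (z • j y), w⟫_ℝ = 0
        have := hw0 (.inr i) y
        rwa [map_smul, ← hv2]
  refine ⟨_, hfr.isCommutantModel hL hW θ (algEquiv_star hL hasRealNorm_real θ), fun w hw => ?_⟩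
  refine hfr.eq_on hL hW ((matrixOp hL hW v θ (Matrix.J (Fin n) ℝ)).restrictScalars ℝ)
    (Algebra.lsmul ℝ ℝ W z) (fun i x => ?_) hw
  change matrixOp hL hW v θ (Matrix.J (Fin n) ℝ) (v i x) = z • v i x
  rw [hfr.matrixOp_apply, Fintype.sum_sum_type]
  rcases i with i | i
  · calc _ = ∑ k, (0 : ℝ) • v (.inl k) x + ∑ k, (if k = i then 1 else 0 : ℝ) • v (.inr k) x := by
          congr 1 <;> refine Finset.sum_congr rfl fun k _ => ?_ <;>
            rw [hθ, LinearMap.map_smul_of_tower] <;> simp [Matrix.J, Matrix.one_apply]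
      _ = v (.inr i) x := by simp
      _ = _ := by rw [hv1, hv2]
  · calc _ = ∑ k, (if k = i then -1 else 0 : ℝ) • v (.inl k) x + ∑ k, (0 : ℝ) • v (.inr k) x := by
          congr 1 <;> refine Finset.sum_congr rfl fun k _ => ?_ <;>
            rw [hθ, LinearMap.map_smul_of_tower] <;> by_cases hk : k = i <;> simp [Matrix.J, Matrix.one_apply, hk]
      _ = -v (.inl i) x := by simp
      _ = _ := by rw [hv1, hv2, smul_smul, hzz, neg_smul, one_smul]

/-- If an odd central element has square `-1` and the commutants of the even subalgebra are
quaternionic, then it acts on a simple module as the quaternion `j`. -/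
theorem exists_equiv_end_quaternion (hpq : 1 ≤ p + q) (hVS : IsSymmRep p q V) [FiniteDimensional ℝ V]
    [IsSimpleModule (R p q) V] {s : ℕ} (hA : IsMatrixSum (Rplus p q) s (Quaternion ℝ))
    (hz : grading p q z = -z) (hzc : ∀ x, z * x = x * z) (hzz : z * z = -1) :
    IsSimpleModule (Rplus p q) V ∧ ∃ θ : Quaternion ℝ ≃ₐ[ℝ] Module.End (Rplus p q) V,
      ∀ v, θ (quat 0 0 1 0) v = z • v := by
  have : Nontrivial V := IsSimpleModule.nontrivial (R p q) V
  obtain ⟨L, _, _, _, _, _, _, ι, hL, -, hι⟩ := exists_simple_isometry hVS.isStarRep_even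
    (P := (⊤ : Submodule (Rplus p q) V)) top_ne_bot
  have : Nontrivial L := IsSimpleModule.nontrivial (Rplus p q) L
  have hιi := injective_of_isometry hι
  obtain ⟨θ⟩ := hA.nonempty_equiv_end L
  have hzV : ∀ v : V, z • z • v = -v := fun v => by rw [smul_smul, hzz, neg_smul, one_smul]
  set j : Quaternion ℝ := quat 0 0 1 0 with hj
  set i : Quaternion ℝ := quat 0 1 0 0 with hi
  have hjj : j * j = -1 := by ext <;> simp [hj]
  have hij : i * j = -(j * i) := by ext <;> simp [hi, hj]
  have hii : i * i = -1 := by ext <;> simp [hi]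
  have hθjj : ∀ x, θ j (θ j x) = -x := fun x => by
    rw [← Module.End.mul_apply, ← map_mul, hjj, map_neg, map_one]; rfl
  have hθii : ∀ x, θ i (θ i x) = -x := fun x => by
    rw [← Module.End.mul_apply, ← map_mul, hii, map_neg, map_one]; rfl
  have hθij : ∀ x, θ i (θ j x) = -θ j (θ i x) := fun x => by
    rw [← Module.End.mul_apply, ← map_mul, hij, map_neg, map_mul]; rfl
  -- The averaged map `ι - z ι j` intertwines `j` with `z`, since both square to `-1`. If it
  -- vanishes, then `ι = z ι j`, and composing with `i`, which anticommutes with `j`, corrects the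
  -- sign.
  obtain ⟨f, hf0, hf⟩ : ∃ f : L →ₗ[Rplus p q] V, f ≠ 0 ∧ ∀ x, z • f x = f (θ j x) := by
    by_cases h : ∀ x, ι x = z • ι (θ j x)
    · refine ⟨ι.comp (θ i), fun h0 => ?_, fun x => ?_⟩
      · obtain ⟨x, hx⟩ := exists_ne (0 : L)
        apply hx
        have h1 : ι (θ i (θ i x)) = 0 := LinearMap.congr_fun h0 (θ i x)
        rw [hθii, map_neg, neg_eq_zero] at h1
        apply hιi
        rw [h1, map_zero]
      · change z • ι (θ i x) = ι (θ i (θ j x))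
        rw [h (θ i x), hzV, hθij, map_neg]
    · refine ⟨ι - ((centralOp V hzc).restrictScalars (Rplus p q)).comp (ι.comp (θ j)), fun h0 => h fun x => ?_,
        fun x => ?_⟩
      · have h1 := LinearMap.congr_fun h0 x
        exact sub_eq_zero.1 h1
      · change z • (ι x - z • ι (θ j x)) = ι (θ j x) - z • ι (θ j (θ j x))
        rw [smul_sub, hzV, hθjj, map_neg, smul_neg]
        abel
  have hfi : Function.Injective f := (LinearMap.injective_or_eq_zero f).resolve_right hf0
  -- The range of `f` is stable under `z` by the intertwining property, as well as under even
  -- elements, so it is a nonzero submodule of a simple module.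
  have hfs : Function.Surjective f := by
    have hb : LinearMap.range f ≠ ⊥ := by rwa [Ne, LinearMap.range_eq_bot]
    let π : V →+ V ⧸ LinearMap.range f := (LinearMap.range f).mkQ.toAddMonoidHom
    intro v
    have hπ : ∀ v, π v = 0 ↔ v ∈ LinearMap.range f := fun v =>
      Submodule.Quotient.mk_eq_zero (LinearMap.range f)
    refine (hπ v).1 (forall_of_even_of_central hpq hz hzc (by rw [hzz, map_neg, map_one]) _ hb π ?_ ?_ v)
    · intro v hv
      exact (hπ v).2 hv
    · rintro _ ⟨x, rfl⟩
      rw [hπ, hf]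
      exact ⟨_, rfl⟩
  let F : L ≃ₗ[Rplus p q] V := LinearEquiv.ofBijective f ⟨hfi, hfs⟩
  refine ⟨IsSimpleModule.congr F.symm, θ.trans (F.conjAlgEquiv ℝ), fun v => ?_⟩
  obtain ⟨x, rfl⟩ := F.surjective v
  change F (θ j (F.symm (F x))) = z • f x
  rw [F.symm_apply_apply, hf]
  rfl

theorem diagonal_j_conjTranspose (n : ℕ) : (Matrix.diagonal fun _ : Fin n => quat 0 0 1 0)ᴴ =
    (-1 : ℝ) • Matrix.diagonal fun _ : Fin n => quat 0 0 1 0 := by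
  rw [Matrix.diagonal_conjTranspose, neg_one_smul, Matrix.diagonal_neg]
  congr 1
  ext1 i
  rw [Pi.star_apply]
  ext <;> simp

/-- If an odd central element `z` has square `-1` and the commutants of the even subalgebra are
quaternionic, then the even subalgebra has a commutant model in which `z` is the scalar `j`. -/
theorem exists_isCommutantModel_j (hpq : 1 ≤ p + q) (hS : IsSymmRep p q W) {s : ℕ}
    (hA : IsMatrixSum (Rplus p q) s (Quaternion ℝ)) (hz : grading p q z = -z) (hzc : ∀ x, z * x = x * z)
    (hzz : z * z = -1) {P : Submodule (R p q) W} (hP : IsIsotypicOn P) {n : ℕ}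
    (hn : Module.length (R p q) P = n) :
    ∃ Ψ : Matrix (Fin n) (Fin n) (Quaternion ℝ) →ₗ[ℝ] Module.End (Rplus p q) W,
      IsCommutantModel (P.restrictScalars (Rplus p q)) Ψ ∧
        ∀ w ∈ P, Ψ (Matrix.diagonal fun _ => quat 0 0 1 0) w = z • w := by
  by_cases h0 : P = ⊥
  · subst h0
    rw [Module.length_eq_zero] at hn
    obtain rfl : n = 0 := by exact_mod_cast hn.symm
    refine ⟨0, isCommutantModel_bot, fun w hw => ?_⟩
    rw [(Submodule.mem_bot (R p q)).1 hw, smul_zero]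
    rfl
  have hW := hS.isStarRep_even
  obtain ⟨V, _, _, _, _, _, _, ι, hV, hιP, hι⟩ := exists_simple_isometry hS.isStarRep h0
  obtain ⟨m, u, hu⟩ := exists_isFrame hV hS.isStarRep
    (hP.nonempty_equiv (injective_of_isometry hι) hιP)
  have hm := hn.symm.trans (hu.length_eq hV hS.isStarRep)
  rw [Fintype.card_fin] at hm
  obtain rfl : n = m := by exact_mod_cast hm
  have hVS : IsSymmRep p q V := fun i v w => by rw [hV, transp_e]
  obtain ⟨_, θ, hθ⟩ := exists_equiv_end_quaternion hpq hVS hA hz hzc hzz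
  -- The simple module stays simple over the even subalgebra, so a frame over the full algebra
  -- already is one over the even subalgebra and the size remains `n`.
  have hfr : IsFrame (P.restrictScalars (Rplus p q)) fun i => (u i).restrictScalars (Rplus p q) :=
    ⟨⟨hu.orth, hu.mem⟩, hu.complete⟩
  have hV' := hVS.isStarRep_even
  refine ⟨_, hfr.isCommutantModel hV' hW θ (algEquiv_star hV' hasRealNorm_quaternion θ), fun w hw => ?_⟩
  refine hfr.eq_on hV' hW ((matrixOp hV' hW _ θ (Matrix.diagonal fun _ => quat 0 0 1 0)).restrictScalars ℝ)
    (Algebra.lsmul ℝ ℝ W z) (fun i x => ?_) hw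
  change matrixOp hV' hW _ θ (Matrix.diagonal fun _ => quat 0 0 1 0) ((u i).restrictScalars (Rplus p q) x) =
    z • u i x
  rw [hfr.matrixOp_apply, Finset.sum_eq_single i]
  · rw [Matrix.diagonal_apply_eq, hθ]
    exact map_smul (u i) z x
  · intro k _ hk
    rw [Matrix.diagonal_apply_ne _ hk, map_zero, LinearMap.zero_apply, map_zero]
  · simp

end SymplecticModel

end

section

open scoped Quaternion

/-! ### Concrete forms of the classical Lie algebras. -/

section ClassicalAlgebras

theorem mem_skewHerm {K : Type} [Ring K] [StarRing K] [Algebra ℝ K] [StarModule ℝ K] {n : Type} [Fintype n]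
    [DecidableEq n] {J X : Matrix n n K} : X ∈ skewHerm K J ↔ Xᴴ * J + J * X = 0 := Iff.rfl

theorem skewHerm_real_eq {n : Type} [Fintype n] [DecidableEq n] (J : Matrix n n ℝ) :
    skewHerm ℝ J = skewAdjointMatricesLieSubalgebra J := by
  ext X
  rw [mem_skewHerm, mem_skewAdjointMatricesLieSubalgebra, mem_skewAdjointMatricesSubmodule,
    Matrix.IsSkewAdjoint, Matrix.IsAdjointPair, Matrix.conjTranspose_eq_transpose_of_trivial, mul_neg,
    eq_neg_iff_add_eq_zero]

theorem skewHerm_diagSign_real (a b : ℕ) : skewHerm ℝ (diagSign ℝ a b) = so a b := skewHerm_real_eq _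

theorem skewHerm_J_real (k : ℕ) : skewHerm ℝ (Matrix.J (Fin k) ℝ) = spR k := skewHerm_real_eq _

theorem mem_toReal {n : Type} [Fintype n] [DecidableEq n] {L : LieSubalgebra ℂ (Matrix n n ℂ)}
    {X : Matrix n n ℂ} : X ∈ toReal L ↔ X ∈ L := Iff.rfl

theorem mem_spC {k : ℕ} {X : Matrix (Fin k ⊕ Fin k) (Fin k ⊕ Fin k) ℂ} :
    X ∈ spC k ↔ Xᵀ * Matrix.J (Fin k) ℂ = -(Matrix.J (Fin k) ℂ * X) := by
  rw [mem_toReal, LieAlgebra.Symplectic.sp, mem_skewAdjointMatricesLieSubalgebra,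
    mem_skewAdjointMatricesSubmodule, Matrix.IsSkewAdjoint, Matrix.IsAdjointPair, mul_neg]

theorem mem_soStar {k : ℕ} {X : Matrix (Fin k ⊕ Fin k) (Fin k ⊕ Fin k) ℂ} :
    X ∈ soStar k ↔ Xᵀ = -X ∧ Xᴴ * Matrix.J (Fin k) ℂ + Matrix.J (Fin k) ℂ * X = 0 := by
  rw [soStar, LieSubalgebra.mem_inf, mem_toReal, LieAlgebra.Orthogonal.mem_so, mem_skewHerm]

theorem quatFst_add (x y : Quaternion ℝ) : quatFst (x + y) = quatFst x + quatFst y := by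
  apply Complex.ext <;> simp [quatFst]

theorem quatSnd_add (x y : Quaternion ℝ) : quatSnd (x + y) = quatSnd x + quatSnd y := by
  apply Complex.ext <;> simp [quatSnd]

theorem quatFst_star (x : Quaternion ℝ) : quatFst (star x) = star (quatFst x) := by
  apply Complex.ext <;> simp [quatFst]

theorem quatSnd_star (x : Quaternion ℝ) : quatSnd (star x) = -quatSnd x := by
  apply Complex.ext <;> simp [quatSnd]

theorem quatFst_smul (r : ℝ) (x : Quaternion ℝ) : quatFst (r • x) = r • quatFst x := by
  apply Complex.ext <;> simp [quatFst]

theorem quatSnd_smul (r : ℝ) (x : Quaternion ℝ) : quatSnd (r • x) = r • quatSnd x := by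
  apply Complex.ext <;> simp [quatSnd]

theorem quatFst_sum {ι : Type} (s : Finset ι) (f : ι → Quaternion ℝ) :
    quatFst (∑ i ∈ s, f i) = ∑ i ∈ s, quatFst (f i) :=
  map_sum (⟨⟨quatFst, rfl⟩, quatFst_add⟩ : Quaternion ℝ →+ ℂ) f s

theorem quatSnd_sum {ι : Type} (s : Finset ι) (f : ι → Quaternion ℝ) :
    quatSnd (∑ i ∈ s, f i) = ∑ i ∈ s, quatSnd (f i) :=
  map_sum (⟨⟨quatSnd, rfl⟩, quatSnd_add⟩ : Quaternion ℝ →+ ℂ) f s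

/-- The quaternion `c₁ + c₂ j`. -/
def quatMk (c₁ c₂ : ℂ) : Quaternion ℝ := quat c₁.re c₁.im c₂.re c₂.im

theorem quatFst_mk (c₁ c₂ : ℂ) : quatFst (quatMk c₁ c₂) = c₁ := rfl

theorem quatSnd_mk (c₁ c₂ : ℂ) : quatSnd (quatMk c₁ c₂) = c₂ := rfl

theorem quat_ext_complex {x y : Quaternion ℝ} (h1 : quatFst x = quatFst y) (h2 : quatSnd x = quatSnd y) :
    x = y :=
  QuaternionAlgebra.ext (congrArg Complex.re h1) (congrArg Complex.im h1) (congrArg Complex.re h2)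
    (congrArg Complex.im h2)

variable {k : ℕ}

/-- The complex form of a quaternionic matrix. -/
def complexForm : Matrix (Fin k) (Fin k) (Quaternion ℝ) →ₗ[ℝ]
    Matrix (Fin k ⊕ Fin k) (Fin k ⊕ Fin k) ℂ where
  toFun Y := Matrix.fromBlocks (Y.map quatFst) (Y.map quatSnd) (-(Y.map quatSnd).map star)
    ((Y.map quatFst).map star)
  map_add' X Y := by
    ext (i | i) (j | j) <;> simp [quatFst_add, quatSnd_add]
    ring
  map_smul' r X := by
    ext (i | i) (j | j) <;> simp [quatFst_smul, quatSnd_smul]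

theorem complexForm_apply (Y : Matrix (Fin k) (Fin k) (Quaternion ℝ)) : complexForm Y =
    Matrix.fromBlocks (Y.map quatFst) (Y.map quatSnd) (-(Y.map quatSnd).map star)
      ((Y.map quatFst).map star) := rfl

theorem complexForm_mul (X Y : Matrix (Fin k) (Fin k) (Quaternion ℝ)) :
    complexForm (X * Y) = complexForm X * complexForm Y := by
  rw [complexForm_apply, complexForm_apply, complexForm_apply, Matrix.fromBlocks_multiply]
  congr 1 <;> ext i j <;>
    simp [Matrix.mul_apply, quatFst_sum, quatSnd_sum, quatFst_mul, quatSnd_mul, Finset.sum_add_distrib,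
      Finset.sum_sub_distrib] <;> ring

theorem complexForm_conjTranspose (Y : Matrix (Fin k) (Fin k) (Quaternion ℝ)) :
    complexForm Yᴴ = (complexForm Y)ᴴ := by
  rw [complexForm_apply, complexForm_apply]
  ext (i | i) (j | j) <;> simp [quatFst_star, quatSnd_star]

theorem J_eq : Matrix.J (Fin k) ℂ = Matrix.fromBlocks 0 (-1) 1 0 := rfl

/-- A complex form commutes with the quaternionic structure, that is, `conj(A) J = J A`; applied to
the conjugate transpose this converts transposition into quaternionic conjugate transposition. -/
theorem complexForm_transpose_mul_J (Y : Matrix (Fin k) (Fin k) (Quaternion ℝ)) :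
    (complexForm Y)ᵀ * Matrix.J (Fin k) ℂ = Matrix.J (Fin k) ℂ * complexForm Yᴴ := by
  rw [complexForm_apply, complexForm_apply, J_eq, Matrix.fromBlocks_transpose, Matrix.fromBlocks_multiply,
    Matrix.fromBlocks_multiply]
  congr 1 <;> ext i j <;> simp [quatFst_star, quatSnd_star]

theorem complexForm_j : complexForm (Matrix.diagonal fun _ : Fin k => quat 0 0 1 0) =
    -Matrix.J (Fin k) ℂ := by
  have h0 : (0 : ℝ) = (0 : ℂ).re := rfl
  rw [complexForm_apply, J_eq, Matrix.fromBlocks_neg]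
  congr 1 <;> ext i j <;> by_cases h : i = j <;>
    simp [h, quatFst, quatSnd, Matrix.one_apply, Complex.ext_iff]

theorem J_mul_left_injective {X Y : Matrix (Fin k ⊕ Fin k) (Fin k ⊕ Fin k) ℂ}
    (h : Matrix.J (Fin k) ℂ * X = Matrix.J (Fin k) ℂ * Y) : X = Y := by
  have := congrArg (fun Z => Matrix.J (Fin k) ℂ * Z) h
  simpa only [← mul_assoc, Matrix.J_squared, neg_mul, one_mul, neg_inj] using this

theorem mul_J_right_injective {X Y : Matrix (Fin k ⊕ Fin k) (Fin k ⊕ Fin k) ℂ}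
    (h : X * Matrix.J (Fin k) ℂ = Y * Matrix.J (Fin k) ℂ) : X = Y := by
  have := congrArg (fun Z => Z * Matrix.J (Fin k) ℂ) h
  simpa only [mul_assoc, Matrix.J_squared, mul_neg, mul_one, neg_inj] using this

theorem complexForm_injective : Function.Injective (complexForm (k := k)) := by
  intro X Y h
  ext1 i j
  apply quat_ext_complex
  · exact congrFun (congrFun h (.inl i)) (.inl j)
  · exact congrFun (congrFun h (.inl i)) (.inr j)

/-- The scalar `j` becomes `-J`, so skewness relative to `j` is directly the second defining
condition of `soStar`. The first one, `ᵗX = -X`, is then automatic for complex forms. -/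
theorem mem_skewHerm_j_iff (Y : Matrix (Fin k) (Fin k) (Quaternion ℝ)) :
    Y ∈ skewHerm (Quaternion ℝ) (Matrix.diagonal fun _ : Fin k => quat 0 0 1 0) ↔
      complexForm Y ∈ soStar k := by
  have h1 : Y ∈ skewHerm (Quaternion ℝ) (Matrix.diagonal fun _ : Fin k => quat 0 0 1 0) ↔
      (complexForm Y)ᴴ * Matrix.J (Fin k) ℂ + Matrix.J (Fin k) ℂ * complexForm Y = 0 := by
    rw [mem_skewHerm, ← complexForm_injective.eq_iff, map_add, complexForm_mul, complexForm_mul,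
      complexForm_conjTranspose, complexForm_j, map_zero, mul_neg, neg_mul, ← neg_add, neg_eq_zero]
  rw [h1, mem_soStar, iff_and_self]
  intro h
  apply mul_J_right_injective
  rw [complexForm_transpose_mul_J, complexForm_conjTranspose]
  have h2 := congrArg (fun Z => Z * Matrix.J (Fin k) ℂ) (eq_neg_of_add_eq_zero_left h)
  simp only [mul_assoc, Matrix.J_squared, mul_neg, mul_one, neg_mul, neg_inj] at h2
  rw [h2, ← mul_assoc, Matrix.J_squared, neg_one_mul, neg_mul]

theorem nonempty_soStar_equiv (k : ℕ) : Nonempty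
    (skewHerm (Quaternion ℝ) (Matrix.diagonal fun _ : Fin k => quat 0 0 1 0) ≃ₗ⁅ℝ⁆ soStar k) := by
  let f : skewHerm (Quaternion ℝ) (Matrix.diagonal fun _ : Fin k => quat 0 0 1 0) →ₗ⁅ℝ⁆ soStar k :=
    { toFun := fun Y => ⟨complexForm Y.1, (mem_skewHerm_j_iff Y.1).1 Y.2⟩
      map_add' := fun X Y => Subtype.ext (map_add complexForm X.1 Y.1)
      map_smul' := fun r X => Subtype.ext (map_smul complexForm r X.1)
      map_lie' := fun {X Y} => Subtype.ext <| by
        change complexForm (X.1 * Y.1 - Y.1 * X.1) = complexForm X.1 * complexForm Y.1 -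
          complexForm Y.1 * complexForm X.1
        rw [map_sub, complexForm_mul, complexForm_mul] }
  refine ⟨LieEquiv.ofBijective f ⟨fun X Y h => Subtype.ext (complexForm_injective
    (congrArg Subtype.val h)), fun X => ?_⟩⟩
  obtain ⟨X, hX⟩ := X
  have hX' := mem_soStar.1 hX
  -- With this substitution the second condition reads `conj(X) J = J X`, which says exactly that
  -- the blocks of `X` have quaternionic shape.
  have hstar : Xᴴ = -X.map star := by
    rw [Matrix.conjTranspose, hX'.1]
    ext i j
    simp
  let Y : Matrix (Fin k) (Fin k) (Quaternion ℝ) := Matrix.of fun i j =>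
    quatMk (X (.inl i) (.inl j)) (X (.inl i) (.inr j))
  have hY : complexForm Y = X := by
    have h := hX'.2
    rw [hstar, ← Matrix.fromBlocks_toBlocks X, J_eq, Matrix.fromBlocks_map, Matrix.fromBlocks_neg,
      Matrix.fromBlocks_multiply, Matrix.fromBlocks_multiply, Matrix.fromBlocks_add,
      ← Matrix.fromBlocks_zero, Matrix.fromBlocks_inj] at h
    obtain ⟨h1, h2, -, -⟩ := h
    ext (i | i) (j | j)
    · rfl
    · rfl
    · have := congrFun (congrFun h1 i) j
      simp [Matrix.toBlocks₁₂, Matrix.toBlocks₂₁] at this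
      simp [complexForm_apply, Y, quatSnd_mk]
      linear_combination this
    · have := congrFun (congrFun h2 i) j
      simp [Matrix.toBlocks₁₁, Matrix.toBlocks₂₂] at this
      simp [complexForm_apply, Y, quatFst_mk]
      linear_combination this
  exact ⟨⟨Y, (mem_skewHerm_j_iff Y).2 (by rw [hY]; exact hX)⟩, Subtype.ext hY⟩

/-- The complexification of the space of quaternionic matrices is the space of complex matrices. -/
theorem complexForm_add_I_smul_injective {a b a' b' : Matrix (Fin k) (Fin k) (Quaternion ℝ)}
    (h : complexForm a + Complex.I • complexForm b = complexForm a' + Complex.I • complexForm b') :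
    a = a' ∧ b = b' := by
  simp only [complexForm_apply, Matrix.fromBlocks_smul, Matrix.fromBlocks_add, Matrix.fromBlocks_inj] at h
  obtain ⟨h1, h2, h3, h4⟩ := h
  have e1 : ∀ i j, quatFst (a i j) = quatFst (a' i j) ∧ quatFst (b i j) = quatFst (b' i j) := by
    intro i j
    have h1 := congrFun (congrFun h1 i) j
    have h4 := congrArg star (congrFun (congrFun h4 i) j)
    simp at h1 h4
    have h5 : quatFst (a i j) = quatFst (a' i j) := by linear_combination (h1 + h4) / 2
    refine ⟨h5, ?_⟩
    apply mul_left_cancel₀ Complex.I_ne_zero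
    linear_combination h1 - h5
  have e2 : ∀ i j, quatSnd (a i j) = quatSnd (a' i j) ∧ quatSnd (b i j) = quatSnd (b' i j) := by
    intro i j
    have h1 := congrFun (congrFun h2 i) j
    have h4 := congrArg star (congrFun (congrFun h3 i) j)
    simp at h1 h4
    have h5 : quatSnd (a i j) = quatSnd (a' i j) := by linear_combination (h1 - h4) / 2
    refine ⟨h5, ?_⟩
    apply mul_left_cancel₀ Complex.I_ne_zero
    linear_combination h1 - h5
  exact ⟨by ext1 i j; exact quat_ext_complex (e1 i j).1 (e2 i j).1,
    by ext1 i j; exact quat_ext_complex (e1 i j).2 (e2 i j).2⟩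

/-- The quaternionic real part of a complex matrix of even size. -/
def quatRe : Matrix (Fin k ⊕ Fin k) (Fin k ⊕ Fin k) ℂ →ₗ[ℝ] Matrix (Fin k) (Fin k) (Quaternion ℝ) where
  toFun X := Matrix.of fun i j => quatMk ((X (.inl i) (.inl j) + star (X (.inr i) (.inr j))) / 2)
    ((X (.inl i) (.inr j) - star (X (.inr i) (.inl j))) / 2)
  map_add' X Y := by
    ext1 i j
    apply quat_ext_complex <;> simp [quatFst_add, quatSnd_add, quatFst_mk, quatSnd_mk] <;> ring
  map_smul' r X := by
    ext1 i j
    apply quat_ext_complex <;> simp [quatFst_smul, quatSnd_smul, quatFst_mk, quatSnd_mk] <;> ring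

theorem quatRe_spec (X : Matrix (Fin k ⊕ Fin k) (Fin k ⊕ Fin k) ℂ) :
    complexForm (quatRe X) + Complex.I • complexForm (quatRe (-Complex.I • X)) = X := by
  ext (i | i) (j | j) <;> simp [complexForm_apply, quatRe, quatFst_mk, quatSnd_mk, map_ofNat]
  · linear_combination (-(X (.inl i) (.inl j)) + (starRingEnd ℂ) (X (.inr i) (.inr j))) / 2 * Complex.I_mul_I
  · linear_combination (-(X (.inl i) (.inr j)) - (starRingEnd ℂ) (X (.inr i) (.inl j))) / 2 * Complex.I_mul_I
  · linear_combination (-(X (.inr i) (.inl j)) - (starRingEnd ℂ) (X (.inl i) (.inr j))) / 2 * Complex.I_mul_I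
  · linear_combination (-(X (.inr i) (.inr j)) + (starRingEnd ℂ) (X (.inl i) (.inl j))) / 2 * Complex.I_mul_I

theorem complexForm_add_I_smul_mul (a b a' b' : Matrix (Fin k) (Fin k) (Quaternion ℝ)) :
    (complexForm a + Complex.I • complexForm b) * (complexForm a' + Complex.I • complexForm b') =
      complexForm (a * a' - b * b') + Complex.I • complexForm (a * b' + b * a') := by
  rw [map_sub, map_add, complexForm_mul, complexForm_mul, complexForm_mul, complexForm_mul, add_mul, mul_add,
    mul_add, Matrix.smul_mul, Matrix.mul_smul, Matrix.smul_mul, Matrix.mul_smul, smul_smul, Complex.I_mul_I,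
    neg_smul, one_smul, smul_add]
  abel

/-- The adjoint relative to `J` is the complex linear extension of the quaternionic conjugate
transpose, so the symplectic condition separates into one on each component: `sp(k, ℂ)` is the
complexification of the compact form. -/
theorem complexForm_add_I_smul_mem_spC (a b : Matrix (Fin k) (Fin k) (Quaternion ℝ)) :
    complexForm a + Complex.I • complexForm b ∈ spC k ↔ aᴴ = -a ∧ bᴴ = -b := by
  have h1 : (complexForm a + Complex.I • complexForm b)ᵀ * Matrix.J (Fin k) ℂ =
      Matrix.J (Fin k) ℂ * (complexForm aᴴ + Complex.I • complexForm bᴴ) := by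
    rw [Matrix.transpose_add, Matrix.transpose_smul, add_mul, Matrix.smul_mul, complexForm_transpose_mul_J,
      complexForm_transpose_mul_J, mul_add, Matrix.mul_smul]
  rw [mem_spC, h1, ← mul_neg]
  constructor
  · intro h
    apply complexForm_add_I_smul_injective
    rw [J_mul_left_injective h, map_neg, map_neg, smul_neg, neg_add]
  · rintro ⟨ha, hb⟩
    rw [ha, hb, map_neg, map_neg, smul_neg, neg_add]

end ClassicalAlgebras

/-! ### The Lie algebras produced by an anticommuting even element. -/

section EvenCoreApplications

open scoped InnerProductSpace

variable {p q : ℕ} {ω : R p q} {k : ℕ}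
variable {W : Type} [NormedAddCommGroup W] [InnerProductSpace ℝ W] [Module (R p q) W]
  [IsScalarTower ℝ (R p q) W]

/-- With `ω² = -1`, the operator `a + ω b` behaves like the complex matrix `a + i b`, both
components being real and skew-symmetric. -/
theorem nonempty_equiv_soC (hpq : 1 ≤ p + q) (hS : IsSymmRep p q W) (hω : ω ∈ Rplus p q)
    (hωe : ∀ i, e p q i * ω = -(ω * e p q i)) (hωω : ω * ω = -1)
    (hωs : ∀ v w : W, ⟪ω • v, w⟫_ℝ = -⟪v, ω • w⟫_ℝ)
    {Ψ : Matrix (Fin k) (Fin k) ℝ →ₗ[ℝ] Module.End (R p q) W} (hΨ : IsCommutantModel ⊤ Ψ) :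
    Nonempty (hOn (⊤ : Submodule (R p q) W) ≃ₗ⁅ℝ⁆ soC k) := by
  let α : soC k →ₗ[ℝ] Matrix (Fin k) (Fin k) ℝ :=
    { toFun := fun X => X.1.map Complex.re
      map_add' := fun X Y => by ext; simp
      map_smul' := fun r X => by ext; simp }
  let β : soC k →ₗ[ℝ] Matrix (Fin k) (Fin k) ℝ :=
    { toFun := fun X => X.1.map Complex.im
      map_add' := fun X Y => by ext; simp
      map_smul' := fun r X => by ext; simp }
  have hα : ∀ X i j, α X i j = (X.1 i j).re := fun X i j => rfl
  have hβ : ∀ X i j, β X i j = (X.1 i j).im := fun X i j => rfl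
  have hmem : ∀ X : Matrix (Fin k) (Fin k) ℂ, X ∈ soC k ↔ Xᵀ = -X := fun X => by
    rw [mem_toReal, LieAlgebra.Orthogonal.mem_so]
  have hneg : ∀ (X : soC k) i j, X.1 j i = -X.1 i j := fun X i j =>
    congrFun (congrFun ((hmem X.1).1 X.2) i) j
  have hlie : ∀ (X Y : soC k) i j, (⁅X, Y⁆ : soC k).1 i j =
      ∑ l, X.1 i l * Y.1 l j - ∑ l, Y.1 i l * X.1 l j := fun X Y i j => by
    change (X.1 * Y.1 - Y.1 * X.1) i j = _
    rw [Matrix.sub_apply, Matrix.mul_apply, Matrix.mul_apply]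
  refine nonempty_equiv_of_anticomm hpq hS hω hωe (ε := -1) (by rw [hωω, map_neg, map_one]) (by norm_num)
    (fun v w => by rw [hωs, neg_one_mul]) hΨ α β ?_ ?_ ?_ ?_ ?_ ?_
  · intro X Y
    ext i j
    simp only [Matrix.add_apply, Matrix.sub_apply, Matrix.smul_apply, Matrix.mul_apply, hα, hβ, hlie,
      Complex.sub_re, Complex.re_sum, Complex.mul_re, Finset.sum_sub_distrib, smul_eq_mul]
    ring
  · intro X Y
    ext i j
    simp only [Matrix.add_apply, Matrix.sub_apply, Matrix.mul_apply, hα, hβ, hlie,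
      Complex.sub_im, Complex.im_sum, Complex.mul_im, Finset.sum_add_distrib]
    ring
  · intro X
    ext i j
    rw [Matrix.conjTranspose_apply, Matrix.neg_apply, hα, hα, hneg X i j]
    simp
  · intro X
    ext i j
    rw [Matrix.conjTranspose_apply, Matrix.smul_apply, hβ, hβ, hneg X i j]
    simp
  · intro X h1 h2
    apply Subtype.ext
    ext i j
    exact Complex.ext (congrFun (congrFun h1 i) j) (congrFun (congrFun h2 i) j)
  · intro a b ha hb
    refine ⟨⟨Matrix.of fun i j => ⟨a i j, b i j⟩, (hmem _).2 ?_⟩, rfl, rfl⟩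
    ext i j
    have h1 := congrFun (congrFun ha i) j
    have h2 := congrFun (congrFun hb i) j
    simp at h1 h2
    apply Complex.ext <;> simp [h1, h2]

/-- Again `ω` plays the imaginary unit, now commuting with quaternionic coefficients; `quatRe`
extracts the two components of a complex matrix of size `2k`. -/
theorem nonempty_equiv_spC (hpq : 1 ≤ p + q) (hS : IsSymmRep p q W) (hω : ω ∈ Rplus p q)
    (hωe : ∀ i, e p q i * ω = -(ω * e p q i)) (hωω : ω * ω = -1)
    (hωs : ∀ v w : W, ⟪ω • v, w⟫_ℝ = -⟪v, ω • w⟫_ℝ)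
    {Ψ : Matrix (Fin k) (Fin k) (Quaternion ℝ) →ₗ[ℝ] Module.End (R p q) W} (hΨ : IsCommutantModel ⊤ Ψ) :
    Nonempty (hOn (⊤ : Submodule (R p q) W) ≃ₗ⁅ℝ⁆ spC k) := by
  let α : spC k →ₗ[ℝ] Matrix (Fin k) (Fin k) (Quaternion ℝ) :=
    quatRe.comp (spC k).toSubmodule.subtype
  let β : spC k →ₗ[ℝ] Matrix (Fin k) (Fin k) (Quaternion ℝ) :=
    { toFun := fun X => quatRe (-Complex.I • X.1)
      map_add' := fun X Y => by
        rw [← map_add, ← smul_add]; rfl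
      map_smul' := fun r X => by
        rw [RingHom.id_apply, ← map_smul, smul_comm]; rfl }
  have hspec : ∀ X : spC k, complexForm (α X) + Complex.I • complexForm (β X) = X.1 := fun X =>
    quatRe_spec X.1
  have hskew : ∀ X : spC k, (α X)ᴴ = -α X ∧ (β X)ᴴ = -β X := fun X => by
    rw [← complexForm_add_I_smul_mem_spC, hspec]
    exact X.2
  have hlie : ∀ X Y : spC k, α ⁅X, Y⁆ = (α X * α Y - β X * β Y) - (α Y * α X - β Y * β X) ∧
      β ⁅X, Y⁆ = (α X * β Y + β X * α Y) - (α Y * β X + β Y * α X) := fun X Y => by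
    apply complexForm_add_I_smul_injective
    rw [hspec]
    change X.1 * Y.1 - Y.1 * X.1 = _
    rw [← hspec X, ← hspec Y, complexForm_add_I_smul_mul, complexForm_add_I_smul_mul, map_sub complexForm
      (α X * α Y - β X * β Y), map_sub complexForm (α X * β Y + β X * α Y), smul_sub]
    abel
  refine nonempty_equiv_of_anticomm hpq hS hω hωe (ε := -1) (by rw [hωω, map_neg, map_one]) (by norm_num)
    (fun v w => by rw [hωs, neg_one_mul]) hΨ α β ?_ ?_ (fun X => (hskew X).1) ?_ ?_ ?_
  · intro X Y
    rw [(hlie X Y).1, neg_one_smul]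
    abel
  · intro X Y
    rw [(hlie X Y).2]
    abel
  · intro X
    rw [(hskew X).2, neg_one_smul]
  · intro X h1 h2
    apply Subtype.ext
    rw [← hspec, h1, h2, map_zero, smul_zero, add_zero]
    rfl
  · intro a b ha hb
    rw [neg_one_smul] at hb
    let X : spC k := ⟨_, (complexForm_add_I_smul_mem_spC a b).2 ⟨ha, hb⟩⟩
    exact ⟨X, complexForm_add_I_smul_injective (hspec X)⟩

/-- With `ω² = 1`, the bracket of the operators `a + ω b` is that of the matrices `a + b`, and every
matrix is uniquely the sum of a skew-Hermitian and a Hermitian one. -/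
theorem nonempty_equiv_gl (hpq : 1 ≤ p + q) (hS : IsSymmRep p q W) (hω : ω ∈ Rplus p q)
    (hωe : ∀ i, e p q i * ω = -(ω * e p q i)) (hωω : ω * ω = 1)
    (hωs : ∀ v w : W, ⟪ω • v, w⟫_ℝ = ⟪v, ω • w⟫_ℝ)
    {K : Type} [Ring K] [StarRing K] [Algebra ℝ K] [StarModule ℝ K]
    {Ψ : Matrix (Fin k) (Fin k) K →ₗ[ℝ] Module.End (R p q) W} (hΨ : IsCommutantModel ⊤ Ψ) :
    Nonempty (hOn (⊤ : Submodule (R p q) W) ≃ₗ⁅ℝ⁆ gl k K) := by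
  let α : gl k K →ₗ[ℝ] Matrix (Fin k) (Fin k) K :=
    { toFun := fun X => (2⁻¹ : ℝ) • (X - Xᴴ)
      map_add' := fun X Y => by rw [Matrix.conjTranspose_add, ← smul_add]; congr 1; abel
      map_smul' := fun r X => by
        rw [Matrix.conjTranspose_smul, star_trivial, ← smul_sub, smul_comm, RingHom.id_apply] }
  let β : gl k K →ₗ[ℝ] Matrix (Fin k) (Fin k) K :=
    { toFun := fun X => (2⁻¹ : ℝ) • (X + Xᴴ)
      map_add' := fun X Y => by rw [Matrix.conjTranspose_add, ← smul_add]; congr 1; abel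
      map_smul' := fun r X => by
        rw [Matrix.conjTranspose_smul, star_trivial, ← smul_add, smul_comm, RingHom.id_apply] }
  have hα : ∀ X, α X = (2⁻¹ : ℝ) • (X - Xᴴ) := fun X => rfl
  have hβ : ∀ X, β X = (2⁻¹ : ℝ) • (X + Xᴴ) := fun X => rfl
  have hsum : ∀ X, α X + β X = X := fun X => by
    rw [hα, hβ, ← smul_add, sub_add_add_cancel, ← two_smul ℝ, smul_smul, inv_mul_cancel₀ two_ne_zero, one_smul]
  have hαs : ∀ X, (α X)ᴴ = -α X := fun X => by
    rw [hα, Matrix.conjTranspose_smul, star_trivial, Matrix.conjTranspose_sub,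
      Matrix.conjTranspose_conjTranspose, ← smul_neg, neg_sub]
  have hβs : ∀ X, (β X)ᴴ = β X := fun X => by
    rw [hβ, Matrix.conjTranspose_smul, star_trivial, Matrix.conjTranspose_add,
      Matrix.conjTranspose_conjTranspose, add_comm]
  have huniq : ∀ X a b, aᴴ = -a → bᴴ = b → a + b = X → α X = a ∧ β X = b := fun X a b ha hb h => by
    subst h
    rw [hα, hβ, Matrix.conjTranspose_add, ha, hb]
    constructor
    · rw [show a + b - (-a + b) = (2 : ℝ) • a by rw [two_smul]; abel, smul_smul,
        inv_mul_cancel₀ two_ne_zero, one_smul]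
    · rw [show a + b + (-a + b) = (2 : ℝ) • b by rw [two_smul]; abel, smul_smul,
        inv_mul_cancel₀ two_ne_zero, one_smul]
  have hlie : ∀ X Y : gl k K, α ⁅X, Y⁆ = (α X * α Y - α Y * α X) + (β X * β Y - β Y * β X) ∧
      β ⁅X, Y⁆ = (α X * β Y - α Y * β X) + (β X * α Y - β Y * α X) := fun X Y => by
    apply huniq
    · simp only [Matrix.conjTranspose_add, Matrix.conjTranspose_sub, Matrix.conjTranspose_mul, hαs, hβs]
      noncomm_ring
    · simp only [Matrix.conjTranspose_add, Matrix.conjTranspose_sub, Matrix.conjTranspose_mul, hαs, hβs]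
      noncomm_ring
    · have h : ⁅X, Y⁆ = (α X + β X) * (α Y + β Y) - (α Y + β Y) * (α X + β X) := by
        rw [hsum, hsum, Ring.lie_def]
      rw [h]
      noncomm_ring
  refine nonempty_equiv_of_anticomm hpq hS hω hωe (ε := 1) (by rw [hωω, map_one]) (by norm_num)
    (fun v w => by rw [hωs, one_mul]) hΨ α β ?_ (fun X Y => (hlie X Y).2) hαs ?_ ?_ ?_
  · intro X Y
    rw [(hlie X Y).1, one_smul]
  · intro X
    rw [hβs, one_smul]
  · intro X h1 h2
    rw [← hsum X, h1, h2, add_zero]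
  · intro a b ha hb
    rw [one_smul] at hb
    exact ⟨a + b, huniq _ a b ha hb rfl⟩

end EvenCoreApplications

end

section

/-! ### Irreducible representations distinguished by signs of central elements. -/

section Signs

variable {A : Type} [Ring A]

/-- The element `a` acts on `U` as the sign `s`. -/
def ActsBy (a : A) (s : ℤˣ) (U : Type) [AddCommGroup U] [Module A U] : Prop := ∀ u : U, a • u = s • u

variable {U U' : Type} [AddCommGroup U] [Module A U] [AddCommGroup U'] [Module A U'] {c : A} {s t : ℤˣ}

theorem ActsBy.congr (h : ActsBy c s U) (f : U ≃ₗ[A] U') : ActsBy c s U' := fun u => by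
  obtain ⟨v, rfl⟩ := f.surjective u
  rw [← map_smul, h, Units.smul_def, Units.smul_def, map_zsmul]

theorem ActsBy.neg (h : ActsBy c s U) : ActsBy (-c) (-s) U := fun u => by
  rw [neg_smul, h, Units.smul_def, Units.smul_def, Units.val_neg, neg_smul]

/-- The vectors fixed by `c` form a submodule. If it is zero, every `u + c u`, being fixed,
vanishes, and `c` acts as `-1`. -/
theorem exists_actsBy [IsSimpleModule A U] (hc : ∀ x, c * x = x * c) (hcc : c * c = 1) :
    ∃ s, ActsBy c s U := by
  let K : Submodule A U :=
    { carrier := {u | c • u = u}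
      add_mem' := fun {u v} hu hv => by
        change c • (u + v) = u + v
        rw [smul_add, hu, hv]
      zero_mem' := smul_zero c
      smul_mem' := fun a u hu => by
        change c • a • u = a • u
        rw [smul_smul, hc, mul_smul, hu] }
  rcases eq_bot_or_eq_top K with h | h
  · refine ⟨-1, fun u => ?_⟩
    have : u + c • u ∈ K := by
      change c • (u + c • u) = u + c • u
      rw [smul_add, smul_smul, hcc, one_smul, add_comm]
    rw [h, Submodule.mem_bot] at this
    rw [Units.smul_def, Units.val_neg, Units.val_one, neg_one_smul]
    exact (neg_eq_of_add_eq_zero_right this).symm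
  · refine ⟨1, fun u => ?_⟩
    have : u ∈ K := by rw [h]; trivial
    rw [one_smul]
    exact this

theorem ActsBy.unique [Algebra ℝ A] [Nontrivial U] (h : ActsBy c s U) (h' : ActsBy c t U) : s = t := by
  by_contra hst
  obtain ⟨u, hu⟩ := exists_ne (0 : U)
  apply hu
  have h1 : u = -u := by
    have h2 : s • u = t • u := by rw [← h, ← h']
    rcases Int.units_eq_one_or s with rfl | rfl <;> rcases Int.units_eq_one_or t with rfl | rfl
    · exact absurd rfl hst
    · simpa [Units.smul_def] using h2
    · simpa [Units.smul_def] using h2.symm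
    · exact absurd rfl hst
  have h2 : (algebraMap ℝ A 2) • u = 0 := by
    rw [show (2 : ℝ) = 1 + 1 by norm_num, map_add, map_one, add_smul, one_smul]
    nth_rewrite 1 [h1]
    rw [neg_add_cancel]
  have h3 : (algebraMap ℝ A 2⁻¹) • (algebraMap ℝ A 2) • u = 0 := by rw [h2, smul_zero]
  rwa [smul_smul, ← map_mul, inv_mul_cancel₀ two_ne_zero, map_one, one_smul] at h3

/-- Take the quotient by a maximal left ideal containing `1 - f`; the ideal generated by `1 - f` is
proper because `f ≠ 0`. -/
theorem exists_simple_of_idempotent {f : A} (hf : ∀ x, f * x = x * f) (hff : f * f = f) (h0 : f ≠ 0) :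
    ∃ U : ModuleCat.{0} A, IsSimpleModule A U ∧ ∀ u : U, f • u = u := by
  let I : Submodule A A := Submodule.span A {1 - f}
  have hI : I ≠ ⊤ := by
    intro h
    have h1 : (1 : A) ∈ I := by rw [h]; trivial
    obtain ⟨a, ha⟩ := Submodule.mem_span_singleton.1 h1
    apply h0
    have h2 : f = a * ((1 - f) * f) := by
      rw [← mul_assoc, show a * (1 - f) = 1 from ha, one_mul]
    rw [h2, sub_mul, one_mul, hff, sub_self, mul_zero]
  obtain ⟨M, hM, hIM⟩ := (IsCoatomic.eq_top_or_exists_le_coatom I).resolve_left hI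
  refine ⟨ModuleCat.of A (A ⧸ M), isSimpleModule_iff_isCoatom.2 hM, fun u => ?_⟩
  obtain ⟨x, rfl⟩ := Submodule.Quotient.mk_surjective M u
  change (Submodule.Quotient.mk (f * x) : A ⧸ M) = Submodule.Quotient.mk x
  rw [Submodule.Quotient.eq]
  have : f * x - x = -(x * (1 - f)) := by rw [hf, mul_sub, mul_one]; abel
  rw [this]
  exact M.neg_mem (hIM (I.smul_mem x (Submodule.mem_span_singleton_self _)))

variable [Algebra ℝ A]

/-- The central idempotents `(1 ± c) / 2` are both nonzero, and each acts as the identity on some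
simple module. -/
theorem exists_simple_actsBy (hc : ∀ x, c * x = x * c) (hcc : c * c = 1) (h1 : c ≠ 1) (h2 : c ≠ -1)
    (s : ℤˣ) : ∃ U : ModuleCat.{0} A, IsSimpleModule A U ∧ ActsBy c s U := by
  have key : ∀ c : A, (∀ x, c * x = x * c) → c * c = 1 → c ≠ -1 →
      ∃ U : ModuleCat.{0} A, IsSimpleModule A U ∧ ActsBy c 1 U := by
    intro c hc hcc h2
    obtain ⟨U, hU, hfU⟩ := exists_simple_of_idempotent (f := (2⁻¹ : ℝ) • (1 + c))
      (fun x => by rw [smul_mul_assoc, mul_smul_comm, add_mul, mul_add, one_mul, mul_one, hc])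
      (by
        rw [smul_mul_smul_comm, add_mul, mul_add, mul_add, hcc, one_mul, one_mul, mul_one, ← add_assoc,
          add_assoc 1 c c, add_comm _ (1 : A), ← add_assoc, ← two_smul ℝ (1 : A), ← two_smul ℝ c,
          ← smul_add, smul_smul]
        norm_num)
      (fun h0 => h2 (eq_neg_of_add_eq_zero_right
        ((smul_eq_zero.1 h0).resolve_left (inv_ne_zero two_ne_zero))))
    refine ⟨U, hU, fun u => ?_⟩
    rw [one_smul]
    have h3 : c * ((2⁻¹ : ℝ) • (1 + c)) = (2⁻¹ : ℝ) • (1 + c) := by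
      rw [mul_smul_comm, mul_add, hcc, mul_one, add_comm]
    rw [← hfU u, smul_smul, h3]
  rcases Int.units_eq_one_or s with rfl | rfl
  · exact key c hc hcc h2
  · obtain ⟨U, hU, h⟩ := key (-c) (fun x => by rw [neg_mul, hc, mul_neg]) (by rw [neg_mul_neg, hcc])
      (fun h => h1 (neg_injective h))
    refine ⟨U, hU, ?_⟩
    have := h.neg
    rwa [neg_neg] at this

/-- The two irreducible representations are distinguished by a central element of square `1`. -/
theorem IsIrrepList.exists_sign {V : Fin 2 → ModuleCat.{0} A} (hV : IsIrrepList V)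
    (hc : ∀ x, c * x = x * c) (hcc : c * c = 1) (h1 : c ≠ 1) (h2 : c ≠ -1) :
    ∃ s, ActsBy c s (V 0) ∧ ActsBy c (-s) (V 1) := by
  have hsurj : ∀ s, ∃ i, ActsBy c s (V i) := fun s => by
    obtain ⟨U, hU, hs⟩ := exists_simple_actsBy hc hcc h1 h2 s
    obtain ⟨i, ⟨f⟩⟩ := hV.exhaust U hU
    exact ⟨i, hs.congr f⟩
  have := hV.simple 0
  have := hV.simple 1
  obtain ⟨s, hs⟩ := exists_actsBy (U := V 0) hc hcc
  refine ⟨s, hs, ?_⟩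
  obtain ⟨i, hi⟩ := hsurj (-s)
  fin_cases i
  · have : Nontrivial (V 0) := IsSimpleModule.nontrivial A (V 0)
    have := hs.unique hi
    rcases Int.units_eq_one_or s with rfl | rfl <;> exact absurd this (by decide)
  · exact hi

theorem IsIrrepList.nonempty_equiv_iff {V : Fin 2 → ModuleCat.{0} A} (hV : IsIrrepList V)
    (h0 : ActsBy c s (V 0)) (h1 : ActsBy c (-s) (V 1)) (U : Type) [AddCommGroup U] [Module A U]
    [hU : IsSimpleModule A U] :
    (ActsBy c s U ↔ Nonempty (U ≃ₗ[A] V 0)) ∧ (ActsBy c (-s) U ↔ Nonempty (U ≃ₗ[A] V 1)) := by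
  have : Nontrivial U := IsSimpleModule.nontrivial A U
  have hs : s ≠ -s := by rcases Int.units_eq_one_or s with rfl | rfl <;> decide
  obtain ⟨i, ⟨f⟩⟩ := hV.exhaust (ModuleCat.of A U) hU
  have f' : U ≃ₗ[A] V i := f
  refine ⟨⟨fun h => ?_, fun ⟨g⟩ => h0.congr g.symm⟩, ⟨fun h => ?_, fun ⟨g⟩ => h1.congr g.symm⟩⟩
  · fin_cases i
    · exact ⟨f'⟩
    · exact absurd (h.unique (h1.congr f'.symm)) hs
  · fin_cases i
    · exact absurd ((h0.congr f'.symm).unique h) hs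
    · exact ⟨f'⟩

theorem IsIrrepList.nonempty_equiv_of_actsBy {V : Fin 2 → ModuleCat.{0} A} (hV : IsIrrepList V)
    (hc : ∀ x, c * x = x * c) (hcc : c * c = 1) (h1 : c ≠ 1) (h2 : c ≠ -1)
    [IsSimpleModule A U] [IsSimpleModule A U'] (hU : ActsBy c t U) (hU' : ActsBy c t U') :
    Nonempty (U ≃ₗ[A] U') := by
  obtain ⟨s, hs, hs'⟩ := hV.exists_sign hc hcc h1 h2
  have : t = s ∨ t = -s := by
    rcases Int.units_eq_one_or s with rfl | rfl <;> rcases Int.units_eq_one_or t with rfl | rfl <;> decide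
  rcases this with rfl | rfl
  · obtain ⟨f⟩ := (hV.nonempty_equiv_iff hs hs' U).1.1 hU
    obtain ⟨g⟩ := (hV.nonempty_equiv_iff hs hs' U').1.1 hU'
    exact ⟨f.trans g.symm⟩
  · obtain ⟨f⟩ := (hV.nonempty_equiv_iff hs hs' U).2.1 hU
    obtain ⟨g⟩ := (hV.nonempty_equiv_iff hs hs' U').2.1 hU'
    exact ⟨f.trans g.symm⟩

/-- Four irreducible representations are distinguished by two central elements of square `1`. -/
theorem IsIrrepList.exists_signs {V : Fin 4 → ModuleCat.{0} A} (hV : IsIrrepList V) {z : A}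
    (hz : ∀ x, z * x = x * z) (hzz : z * z = 1) (hc : ∀ x, c * x = x * c) (hcc : c * c = 1)
    (hne : ∀ a b : ℝ, a * a = 1 → b * b = 1 → (1 + a • z) * (1 + b • c) ≠ 0) :
    ∃ σ : Fin 4 ≃ ℤˣ × ℤˣ, ∀ i, ActsBy c (σ i).1 (V i) ∧ ActsBy z (σ i).2 (V i) := by
  have hs := hV.simple
  have hex : ∀ i, ∃ x : ℤˣ × ℤˣ, ActsBy c x.1 (V i) ∧ ActsBy z x.2 (V i) := fun i => by
    obtain ⟨s, h1⟩ := exists_actsBy (U := V i) hc hcc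
    obtain ⟨t, h2⟩ := exists_actsBy (U := V i) hz hzz
    exact ⟨(s, t), h1, h2⟩
  choose σ hσ using hex
  -- Every pair of signs occurs, because the product of the matching idempotents `(1 + t z) / 2` and
  -- `(1 + s c) / 2` is nonzero. Four modules and four pairs then give a bijection.
  have hsurj : Function.Surjective σ := by
    rintro ⟨s, t⟩
    have hsr : ∀ s : ℤˣ, ((s : ℤ) : ℝ) * ((s : ℤ) : ℝ) = 1 := fun s => by
      rw [← Int.cast_mul, ← Units.val_mul, Int.units_mul_self]; simp
    have hid : ∀ (c : A) (a : ℝ), c * c = 1 → a * a = 1 →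
        ((2⁻¹ : ℝ) • (1 + a • c)) * ((2⁻¹ : ℝ) • (1 + a • c)) = (2⁻¹ : ℝ) • (1 + a • c) := by
      intro c a hcc ha
      have : (1 + a • c) * (1 + a • c) = (2 : ℝ) • (1 + a • c) := by
        simp only [add_mul, mul_add, one_mul, mul_one, smul_mul_smul_comm, hcc, ha, one_smul, two_smul]
        abel
      rw [smul_mul_smul_comm, this, smul_smul]
      norm_num
    have hcen : ∀ (c : A) (a : ℝ), (∀ x, c * x = x * c) →
        ∀ x, ((2⁻¹ : ℝ) • (1 + a • c)) * x = x * ((2⁻¹ : ℝ) • (1 + a • c)) := by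
      intro c a hc x
      rw [smul_mul_assoc, mul_smul_comm, add_mul, mul_add, one_mul, mul_one, smul_mul_assoc, mul_smul_comm, hc]
    set F := (2⁻¹ : ℝ) • (1 + ((t : ℤ) : ℝ) • z) with hF
    set G := (2⁻¹ : ℝ) • (1 + ((s : ℤ) : ℝ) • c) with hG
    have hFc := hcen z ((t : ℤ) : ℝ) hz
    have hGc := hcen c ((s : ℤ) : ℝ) hc
    rw [← hF] at hFc
    rw [← hG] at hGc
    have hFF := hid z ((t : ℤ) : ℝ) hzz (hsr t)
    have hGG := hid c ((s : ℤ) : ℝ) hcc (hsr s)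
    rw [← hF] at hFF
    rw [← hG] at hGG
    obtain ⟨U, hU, hFU⟩ := exists_simple_of_idempotent (f := F * G)
      (fun x => by rw [mul_assoc, hGc, ← mul_assoc, hFc, mul_assoc])
      (by rw [mul_assoc, ← mul_assoc G, ← hFc G, mul_assoc F G, hGG, ← mul_assoc, hFF])
      (by
        rw [hF, hG, smul_mul_smul_comm]
        intro h0
        rcases smul_eq_zero.1 h0 with h | h
        · norm_num at h
        · exact hne _ _ (hsr t) (hsr s) h)
    have hact : ∀ (c : A) (s : ℤˣ), c * c = 1 →
        (∀ u : U, ((2⁻¹ : ℝ) • (1 + ((s : ℤ) : ℝ) • c)) • u = u) → ActsBy c s U := by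
      intro c s hcc h u
      have h1 : c * ((2⁻¹ : ℝ) • (1 + ((s : ℤ) : ℝ) • c)) =
          ((s : ℤ) : ℝ) • ((2⁻¹ : ℝ) • (1 + ((s : ℤ) : ℝ) • c)) := by
        rw [mul_smul_comm, mul_add, mul_smul_comm, hcc, mul_one, smul_comm _ (2⁻¹ : ℝ),
          smul_add ((s : ℤ) : ℝ), smul_smul ((s : ℤ) : ℝ) ((s : ℤ) : ℝ) c, hsr, one_smul, add_comm]
      have h2 := h u
      rw [← h2, smul_smul, h1, Int.cast_smul_eq_zsmul, Units.smul_def, smul_assoc]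
    obtain ⟨i, ⟨f⟩⟩ := hV.exhaust U hU
    have hFu : ∀ u : U, F • u = u := fun u => by
      rw [← hFU u, smul_smul, ← mul_assoc, hFF]
    have hGu : ∀ u : U, G • u = u := fun u => by
      rw [← hFU u, smul_smul, ← mul_assoc, hGc, mul_assoc, hGG]
    have : Nontrivial (V i) := IsSimpleModule.nontrivial A (V i)
    refine ⟨i, Prod.ext ?_ ?_⟩
    · exact (hσ i).1.unique ((hact c s hcc hGu).congr f)
    · exact (hσ i).2.unique ((hact z t hzz hFu).congr f)
  have hbij : Function.Bijective σ := (Fintype.bijective_iff_surjective_and_card σ).2 ⟨hsurj, by decide⟩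
  exact ⟨Equiv.ofBijective σ hbij, hσ⟩

-- In a semisimple module `N` is the sum of its simple submodules, so knowing which simple
-- submodules lie in `N` identifies it.
omit [Algebra ℝ A] in
theorem isotypicComponent_eq_of_forall [IsSemisimpleModule A U] [IsSimpleModule A U'] (N : Submodule A U)
    (h : ∀ S : Submodule A U, IsSimpleModule A S → (S ≤ N ↔ Nonempty (S ≃ₗ[A] U'))) :
    isotypicComponent A U U' = N := by
  apply le_antisymm
  · refine sSup_le ?_
    rintro S ⟨f⟩
    exact (h S (IsSimpleModule.congr f)).2 ⟨f⟩
  · rw [← IsSemisimpleModule.sSup_simples_le N]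
    refine sSup_le ?_
    rintro S ⟨hS, hSN⟩
    exact le_sSup ((h S hS).1 hSN)

end Signs

end

section

open scoped InnerProductSpace

/-! ### Odd central, even central and anticentral elements. -/

section SpecialElements

variable {p q : ℕ}

/-- An odd central element of square `ε = ±1`. -/
structure IsOddCentral (z : R p q) (ε : ℝ) : Prop where
  odd : grading p q z = -z
  central : ∀ x, z * x = x * z
  sq : z * z = algebraMap ℝ _ ε
  transp_eq : transp p q z = ε • z

/-- A nontrivial even central element of square `1`. -/
structure IsEvenCentral (c : R p q) : Prop where
  mem : c ∈ Rplus p q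
  central : ∀ x, c * x = x * c
  sq : c * c = 1
  transp_eq : transp p q c = c
  ne_one : c ≠ 1
  ne_neg_one : c ≠ -1

/-- An even element of square `ε = ±1` anticommuting with the generators. -/
structure IsEvenAnticentral (ω : R p q) (ε : ℝ) : Prop where
  mem : ω ∈ Rplus p q
  anticomm : ∀ i, e p q i * ω = -(ω * e p q i)
  sq : ω * ω = algebraMap ℝ _ ε
  transp_eq : transp p q ω = ε • ω

theorem transp_neg (a : R p q) : transp p q (-a) = -transp p q a := by
  have h := transp_add a (-a)
  rw [add_neg_cancel, show transp p q (0 : R p q) = 0 by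
    rw [← map_zero (algebraMap ℝ (R p q)), transp_algebraMap]] at h
  exact (neg_eq_of_add_eq_zero_right h.symm).symm

theorem IsOddCentral.neg {z : R p q} {ε : ℝ} (h : IsOddCentral z ε) : IsOddCentral (-z) ε where
  odd := by rw [map_neg, h.odd]
  central x := by rw [neg_mul, h.central, mul_neg]
  sq := by rw [neg_mul_neg, h.sq]
  transp_eq := by rw [transp_neg, h.transp_eq, smul_neg]

theorem IsOddCentral.ne_algebraMap {z : R p q} {ε : ℝ} (h : IsOddCentral z ε) {r : ℝ} (hr : r ≠ 0) :
    z ≠ algebraMap ℝ _ r := by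
  intro h1
  have h2 := h.odd
  rw [h1, AlgHom.commutes, ← map_neg] at h2
  have h3 := (algebraMap ℝ (R p q)).injective h2
  apply hr
  linarith

theorem IsEvenCentral.neg {c : R p q} (h : IsEvenCentral c) : IsEvenCentral (-c) where
  mem := neg_mem h.mem
  central x := by rw [neg_mul, h.central, mul_neg]
  sq := by rw [neg_mul_neg, h.sq]
  transp_eq := by rw [transp_neg, h.transp_eq]
  ne_one h1 := h.ne_neg_one (by rw [← h1, neg_neg])
  ne_neg_one h1 := h.ne_one (neg_injective h1)

variable {W : Type} [NormedAddCommGroup W] [InnerProductSpace ℝ W] [Module (R p q) W]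
  [IsScalarTower ℝ (R p q) W]

theorem IsSymmRep.inner_of_transp (hS : IsSymmRep p q W) {z : R p q} {ε : ℝ}
    (h : transp p q z = ε • z) (v w : W) : ⟪z • v, w⟫_ℝ = ε * ⟪v, z • w⟫_ℝ := by
  rw [hS.isStarRep, h, smul_assoc, real_inner_smul_right]

/-- The Lie algebra splits along the eigenspaces of an even central element. -/
theorem nonempty_equiv_prod (hS : IsSymmRep p q W) {c : R p q} (hc : IsEvenCentral c) :
    Nonempty (hOn (⊤ : Submodule (R p q) W) ≃ₗ⁅ℝ⁆
      (hOn (centralEigenspace W hc.central 1) × hOn (centralEigenspace W hc.central (-1)))) := by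
  have hcs : ∀ v w : W, ⟪c • v, w⟫_ℝ = ⟪v, c • w⟫_ℝ := fun v w => by
    rw [hS.isStarRep, hc.transp_eq]
  have hcc : ∀ w : W, c • c • w = w := fun w => by rw [smul_smul, hc.sq, one_smul]
  -- For `a = ±1` this is the orthogonal projection onto an eigenspace of `c`. It commutes with the
  -- generators since `c` is central, and with the Lie algebra since `c` is even.
  let π : ℝ → Module.End ℝ W := fun a =>
    (2⁻¹ : ℝ) • (LinearMap.id + a • (Algebra.lsmul ℝ ℝ W c : Module.End ℝ W))
  have hπ : ∀ a w, π a w = (2⁻¹ : ℝ) • (w + a • c • w) := fun a w => rfl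
  have hπE : ∀ a, a * a = 1 → ∀ w, π a w ∈ centralEigenspace W hc.central a := fun a ha w => by
    rw [mem_centralEigenspace, hπ, smul_algebra_smul_comm, smul_add, smul_algebra_smul_comm, hcc,
      smul_comm a (2⁻¹ : ℝ), smul_add a, smul_smul a a, ha, one_smul, add_comm]
  have hπs : ∀ a v w, ⟪π a v, w⟫_ℝ = ⟪v, π a w⟫_ℝ := fun a v w => by
    rw [hπ, hπ, real_inner_smul_left, real_inner_smul_right, inner_add_left, inner_add_right,
      real_inner_smul_left, real_inner_smul_right, hcs]
  have hπid : ∀ a, a * a = 1 → ∀ w ∈ centralEigenspace W hc.central a, π a w = w := fun a ha w hw => by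
    rw [hπ, (mem_centralEigenspace hc.central).1 hw, smul_smul, ha, one_smul, ← two_smul ℝ, smul_smul,
      inv_mul_cancel₀ two_ne_zero, one_smul]
  have hπ0 : ∀ a, a * a = 1 → ∀ w ∈ centralEigenspace W hc.central (-a), π a w = 0 := fun a ha w hw => by
    rw [hπ, (mem_centralEigenspace hc.central).1 hw, smul_smul, mul_neg, ha, neg_one_smul, add_neg_cancel,
      smul_zero]
  have hπorth : ∀ a, a * a = 1 → ∀ w, (∀ y ∈ centralEigenspace W hc.central a, ⟪w, y⟫_ℝ = 0) → π a w = 0 :=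
    fun a ha w hw => by
      rw [← inner_self_eq_zero (𝕜 := ℝ), hπs, hπid a ha _ (hπE a ha w)]
      exact hw _ (hπE a ha w)
  have hπe : ∀ a i w, e p q i • π a w = π a (e p q i • w) := fun a i w => by
    rw [hπ, hπ, smul_algebra_smul_comm, smul_add, smul_algebra_smul_comm, smul_smul, ← hc.central, mul_smul]
  have hπX : ∀ a (X : hOn (⊤ : Submodule (R p q) W)) w, π a (X.1 w) = X.1 (π a w) := fun a X w => by
    rw [hπ, hπ, map_smul, map_add, map_smul, commute_of_skew hS X.2.1 hc.mem]
  have hmem : ∀ a, a * a = 1 → ∀ X : hOn (⊤ : Submodule (R p q) W),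
      π a * X.1 ∈ hOn (centralEigenspace W hc.central a) := fun a ha X => by
    refine ⟨fun i v w => ?_, fun w => hπE a ha _, fun w hw => ?_⟩
    · rw [Module.End.mul_apply, Module.End.mul_apply, hπs, ← hπe, hπX, hπe, ← hπe]
      exact X.2.1 i v (π a w)
    · rw [Module.End.mul_apply, hπX, hπorth a ha w hw, map_zero]
  have hsum : ∀ w, π 1 w + π (-1) w = w := fun w => by
    rw [hπ, hπ, ← smul_add, one_smul, neg_one_smul, add_add_add_comm, add_neg_cancel, add_zero, ← two_smul ℝ,
      smul_smul, inv_mul_cancel₀ two_ne_zero, one_smul]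
  have ha1 : (1 : ℝ) * 1 = 1 := one_mul 1
  have ha2 : (-1 : ℝ) * -1 = 1 := by norm_num
  have hlie : ∀ a, a * a = 1 → ∀ X Y : hOn (⊤ : Submodule (R p q) W), ∀ w,
      π a (X.1 (Y.1 w) - Y.1 (X.1 w)) = π a (X.1 (π a (Y.1 w))) - π a (Y.1 (π a (X.1 w))) :=
    fun a ha X Y w => by
      rw [map_sub, hπX a X (π a (Y.1 w)), hπX a Y (π a (X.1 w)), hπid a ha _ (hπE a ha _),
        hπid a ha _ (hπE a ha _), hπX, hπX, hπX]
  let f : hOn (⊤ : Submodule (R p q) W) →ₗ⁅ℝ⁆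
      (hOn (centralEigenspace W hc.central 1) × hOn (centralEigenspace W hc.central (-1))) :=
    { toFun := fun X => (⟨π 1 * X.1, hmem 1 ha1 X⟩, ⟨π (-1) * X.1, hmem (-1) ha2 X⟩)
      map_add' := fun X Y => Prod.ext (Subtype.ext (mul_add _ _ _)) (Subtype.ext (mul_add _ _ _))
      map_smul' := fun r X => Prod.ext (Subtype.ext (mul_smul_comm _ _ _))
        (Subtype.ext (mul_smul_comm _ _ _))
      map_lie' := fun {X Y} => Prod.ext (Subtype.ext (LinearMap.ext fun w => hlie 1 ha1 X Y w))
        (Subtype.ext (LinearMap.ext fun w => hlie (-1) ha2 X Y w)) }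
  refine ⟨LieEquiv.ofBijective f ⟨fun X Y h => ?_, fun X => ?_⟩⟩
  · apply Subtype.ext
    refine LinearMap.ext fun w => ?_
    have h1 : π 1 (X.1 w) = π 1 (Y.1 w) := LinearMap.congr_fun (congrArg (fun x => x.1.1) h) w
    have h2 : π (-1) (X.1 w) = π (-1) (Y.1 w) := LinearMap.congr_fun (congrArg (fun x => x.2.1) h) w
    rw [← hsum (X.1 w), ← hsum (Y.1 w), h1, h2]
  · obtain ⟨⟨X, hX1, hX2, hX3⟩, ⟨Y, hY1, hY2, hY3⟩⟩ := X
    refine ⟨⟨X + Y, fun i v w => ?_, fun w => trivial, fun w hw => ?_⟩, Prod.ext (Subtype.ext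
      (LinearMap.ext fun w => ?_)) (Subtype.ext (LinearMap.ext fun w => ?_))⟩
    · rw [LinearMap.add_apply, LinearMap.add_apply, inner_add_left, smul_add, inner_add_right]
      linarith [hX1 i v w, hY1 i v w]
    · have : w = 0 := inner_self_eq_zero.1 (hw w trivial)
      rw [this, map_zero]
    · change π 1 (X w + Y w) = X w
      rw [map_add, hπid 1 ha1 _ (hX2 w), hπ0 1 ha1 _ (hY2 w), add_zero]
    · change π (-1) (X w + Y w) = Y w
      rw [map_add, hπid (-1) ha2 _ (hY2 w), hπ0 (-1) ha2 _ (by rw [neg_neg]; exact hX2 w), zero_add]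

end SpecialElements

/-! ### From special elements to classical Lie algebras. -/

section Rows

variable {p q : ℕ}

/-- The multiplicity of `V` in `W`. -/
def multIn (V : ModuleCat.{0} (R p q)) (W : Type) [AddCommGroup W] [Module (R p q) W] : ℕ :=
  (Module.length (R p q) (isotypicComponent (R p q) W V)).toNat

variable {W : Type} [NormedAddCommGroup W] [InnerProductSpace ℝ W] [FiniteDimensional ℝ W]
  [Module (R p q) W] [IsScalarTower ℝ (R p q) W]

theorem length_eq_coe_toNat (P : Submodule (R p q) W) :
    Module.length (R p q) P = ((Module.length (R p q) P).toNat : ℕ) := by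
  have : IsArtinian (R p q) W := isArtinian_of_tower ℝ inferInstance
  have : IsNoetherian (R p q) W := isNoetherian_of_tower ℝ inferInstance
  exact (ENat.natCast_toNat Module.length_ne_top).symm

theorem length_eq_multIn {V : ModuleCat.{0} (R p q)} {P : Submodule (R p q) W}
    (h : isotypicComponent (R p q) W V = P) : Module.length (R p q) P = (multIn V W : ℕ) := by
  subst h
  exact length_eq_coe_toNat _

-- With only two irreducible representations, the sign of `c` determines the class of a simple
-- submodule.
omit [FiniteDimensional ℝ W] in
theorem isIsotypicOn_of_actsBy {A : Type} [Ring A] [Algebra ℝ A] [Module A W] [IsScalarTower ℝ A W]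
    {V : Fin 2 → ModuleCat.{0} A} (hV : IsIrrepList V) {c : A} (hc : ∀ x, c * x = x * c) (hcc : c * c = 1)
    (h1 : c ≠ 1) (h2 : c ≠ -1) {P : Submodule A W} {s : ℤˣ} (hP : ∀ w ∈ P, c • w = s • w) :
    IsIsotypicOn P := fun S T hS hT hSs hTs =>
  hV.nonempty_equiv_of_actsBy hc hcc h1 h2 (t := s) (fun u => Subtype.ext (hP u (hS u.2)))
    (fun u => Subtype.ext (hP u (hT u.2)))

omit [FiniteDimensional ℝ W] in
theorem isIsotypicOn_of_unique {A : Type} [Ring A] [Algebra ℝ A] [Module A W] [IsScalarTower ℝ A W]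
    {V : Fin 1 → ModuleCat.{0} A} (hV : IsIrrepList V) (P : Submodule A W) :
    IsIsotypicOn P := fun S T _ _ hSs hTs => by
  obtain ⟨i, ⟨f⟩⟩ := hV.exhaust (ModuleCat.of A S) hSs
  obtain ⟨j, ⟨g⟩⟩ := hV.exhaust (ModuleCat.of A T) hTs
  obtain rfl : i = j := Subsingleton.elim i j
  have f' : S ≃ₗ[A] V i := f
  have g' : T ≃ₗ[A] V i := g
  exact ⟨f'.trans g'.symm⟩

omit [InnerProductSpace ℝ W] [FiniteDimensional ℝ W] [IsScalarTower ℝ (R p q) W] in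
theorem isotypicComponent_eq_top_of_unique [IsSemisimpleRing (R p q)] {V : Fin 1 → ModuleCat.{0} (R p q)}
    (hV : IsIrrepList V) : isotypicComponent (R p q) W (V 0) = ⊤ := by
  have := hV.simple 0
  refine isotypicComponent_eq_of_forall _ fun S hS => ⟨fun _ => ?_, fun _ => le_top⟩
  obtain ⟨i, ⟨f⟩⟩ := hV.exhaust (ModuleCat.of _ S) hS
  obtain rfl : i = 0 := Subsingleton.elim _ _
  exact ⟨f⟩

omit [FiniteDimensional ℝ W] in
theorem sign_smul_real (s : ℤˣ) (w : W) : s • w = ((s : ℤ) : ℝ) • w := by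
  rw [Int.cast_smul_eq_zsmul]; rfl

theorem le_centralEigenspace_iff {c : R p q} (hc : ∀ x, c * x = x * c) (s : ℤˣ) {r : ℝ} (hr : r = (s : ℤ))
    (S : Submodule (R p q) W) : S ≤ centralEigenspace W hc r ↔ ActsBy c s S := by
  constructor
  · intro h u
    apply Subtype.ext
    change c • (u : W) = ((s • u : S) : W)
    have h1 := (mem_centralEigenspace hc).1 (h u.2)
    rw [h1, hr, ← sign_smul_real]
    rfl
  · intro h w hw
    rw [mem_centralEigenspace, hr, ← sign_smul_real]
    exact congrArg Subtype.val (h ⟨w, hw⟩)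

variable (hpq : 1 ≤ p + q) (hS : IsSymmRep p q W)

section OneIrrep

variable {V : Fin 1 → ModuleCat.{0} (R p q)} (hV : IsIrrepList V)
include hS hV

/-- All simple submodules are isomorphic, so the whole space is isotypic and its length is the
multiplicity. -/
theorem exists_model_of_unique {K : Type} [DivisionRing K] [Algebra ℝ K] [StarRing K] [StarModule ℝ K]
    (hK : HasRealNorm K) {s : ℕ} (hA : IsMatrixSum (R p q) s K) :
    ∃ Ψ : Matrix (Fin (multIn (V 0) W)) (Fin (multIn (V 0) W)) K →ₗ[ℝ] Module.End (R p q) W,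
      IsCommutantModel ⊤ Ψ := by
  have := hA.isSemisimpleRing
  exact exists_isCommutantModel hS.isStarRep hK hA (isIsotypicOn_of_unique hV ⊤)
    (length_eq_multIn (isotypicComponent_eq_top_of_unique hV))

include hpq

theorem hOn_equiv_soC {ω : R p q} (hω : IsEvenAnticentral ω (-1)) {s : ℕ} (hA : IsMatrixSum (R p q) s ℝ) :
    Nonempty (hOn (⊤ : Submodule (R p q) W) ≃ₗ⁅ℝ⁆ soC (multIn (V 0) W)) := by
  obtain ⟨Ψ, hΨ⟩ := exists_model_of_unique hS hV hasRealNorm_real hA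
  exact nonempty_equiv_soC hpq hS hω.mem hω.anticomm (by rw [hω.sq, map_neg, map_one])
    (fun v w => by rw [hS.inner_of_transp hω.transp_eq, neg_one_mul]) hΨ

theorem hOn_equiv_spC {ω : R p q} (hω : IsEvenAnticentral ω (-1)) {s : ℕ}
    (hA : IsMatrixSum (R p q) s (Quaternion ℝ)) :
    Nonempty (hOn (⊤ : Submodule (R p q) W) ≃ₗ⁅ℝ⁆ spC (multIn (V 0) W)) := by
  obtain ⟨Ψ, hΨ⟩ := exists_model_of_unique hS hV hasRealNorm_quaternion hA
  exact nonempty_equiv_spC hpq hS hω.mem hω.anticomm (by rw [hω.sq, map_neg, map_one])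
    (fun v w => by rw [hS.inner_of_transp hω.transp_eq, neg_one_mul]) hΨ

theorem hOn_equiv_gl {ω : R p q} (hω : IsEvenAnticentral ω 1) {K : Type} [DivisionRing K] [Algebra ℝ K]
    [StarRing K] [StarModule ℝ K] (hK : HasRealNorm K) {s : ℕ} (hA : IsMatrixSum (R p q) s K) :
    Nonempty (hOn (⊤ : Submodule (R p q) W) ≃ₗ⁅ℝ⁆ gl (multIn (V 0) W) K) := by
  obtain ⟨Ψ, hΨ⟩ := exists_model_of_unique hS hV hK hA
  exact nonempty_equiv_gl hpq hS hω.mem hω.anticomm (by rw [hω.sq, map_one])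
    (fun v w => by rw [hS.inner_of_transp hω.transp_eq, one_mul]) hΨ

end OneIrrep

include hpq hS

/-- An arbitrary isotypic `P` is allowed so that the result serves both for the whole space and for
the two eigenspaces of an even central element. -/
theorem hOn_equiv_spR {z : R p q} (hz : IsOddCentral z (-1)) {s : ℕ} (hA : IsMatrixSum (Rplus p q) s ℝ)
    {P : Submodule (R p q) W} (hP : IsIsotypicOn P) {n : ℕ} (hn : Module.length (R p q) P = n) :
    Nonempty (hOn P ≃ₗ⁅ℝ⁆ spR n) := by
  have hzs : ∀ v w : W, ⟪z • v, w⟫_ℝ = -1 * ⟪v, z • w⟫_ℝ := fun v w => hS.inner_of_transp hz.transp_eq v w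
  obtain ⟨Ψ, hΨ, hJ⟩ := exists_isCommutantModel_J hpq hS hA hz.odd hz.central
    (by rw [hz.sq, map_neg, map_one]) (fun v w => by rw [hzs, neg_one_mul]) hP hn
  rw [← skewHerm_J_real]
  exact nonempty_equiv_skewHerm hpq hS hz.odd hz.central hz.sq (by norm_num) hzs hΨ hJ
    (J_conjTranspose n)

theorem hOn_equiv_soStar {z : R p q} (hz : IsOddCentral z (-1)) {s : ℕ}
    (hA : IsMatrixSum (Rplus p q) s (Quaternion ℝ)) {P : Submodule (R p q) W} (hP : IsIsotypicOn P) {n : ℕ}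
    (hn : Module.length (R p q) P = n) : Nonempty (hOn P ≃ₗ⁅ℝ⁆ soStar n) := by
  have hzs : ∀ v w : W, ⟪z • v, w⟫_ℝ = -1 * ⟪v, z • w⟫_ℝ := fun v w => hS.inner_of_transp hz.transp_eq v w
  obtain ⟨Ψ, hΨ, hJ⟩ := exists_isCommutantModel_j hpq hS hA hz.odd hz.central
    (by rw [hz.sq, map_neg, map_one]) hP hn
  obtain ⟨f⟩ := nonempty_equiv_skewHerm hpq hS hz.odd hz.central hz.sq (by norm_num) hzs hΨ hJ
    (diagonal_j_conjTranspose n)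
  obtain ⟨g⟩ := nonempty_soStar_equiv n
  exact ⟨f.trans g⟩

theorem hOn_equiv_skewHerm_diagSign {z : R p q} (hz : IsOddCentral z 1) {K : Type} [DivisionRing K]
    [Algebra ℝ K] [StarRing K] [StarModule ℝ K] (hK : HasRealNorm K) {s : ℕ}
    (hA : IsMatrixSum (Rplus p q) s K) {P : Submodule (R p q) W}
    (hP : IsIsotypicOn (P.restrictScalars (Rplus p q))) {a b : ℕ}
    (ha : Module.length (R p q) (P ⊓ centralEigenspace W hz.central 1 : Submodule (R p q) W) = a)
    (hb : Module.length (R p q) (P ⊓ centralEigenspace W hz.central (-1) : Submodule (R p q) W) = b) :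
    Nonempty (hOn P ≃ₗ⁅ℝ⁆ skewHerm K (diagSign K a b)) := by
  have hzs : ∀ v w : W, ⟪z • v, w⟫_ℝ = 1 * ⟪v, z • w⟫_ℝ := fun v w => hS.inner_of_transp hz.transp_eq v w
  obtain ⟨Ψ, hΨ, hJ⟩ := exists_isCommutantModel_diagSign hpq hS hK hA hz.odd hz.central
    (by rw [hz.sq, map_one]) (fun v w => by rw [hzs, one_mul]) hP ha hb
  exact nonempty_equiv_skewHerm hpq hS hz.odd hz.central hz.sq (by norm_num) hzs hΨ hJ
    (conjTranspose_diagSign a b)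

theorem hOn_top_equiv_spR {z : R p q} (hz : IsOddCentral z (-1)) [IsSemisimpleRing (R p q)] {s : ℕ}
    (hA : IsMatrixSum (Rplus p q) s ℝ) {V : Fin 1 → ModuleCat.{0} (R p q)} (hV : IsIrrepList V) :
    Nonempty (hOn (⊤ : Submodule (R p q) W) ≃ₗ⁅ℝ⁆ spR (multIn (V 0) W)) :=
  hOn_equiv_spR hpq hS hz hA (isIsotypicOn_of_unique hV ⊤)
    (length_eq_multIn (isotypicComponent_eq_top_of_unique hV))

theorem hOn_top_equiv_soStar {z : R p q} (hz : IsOddCentral z (-1)) [IsSemisimpleRing (R p q)] {s : ℕ}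
    (hA : IsMatrixSum (Rplus p q) s (Quaternion ℝ)) {V : Fin 1 → ModuleCat.{0} (R p q)}
    (hV : IsIrrepList V) :
    Nonempty (hOn (⊤ : Submodule (R p q) W) ≃ₗ⁅ℝ⁆ soStar (multIn (V 0) W)) :=
  hOn_equiv_soStar hpq hS hz hA (isIsotypicOn_of_unique hV ⊤)
    (length_eq_multIn (isotypicComponent_eq_top_of_unique hV))

end Rows

end

section

open scoped InnerProductSpace

/-- The product of two isomorphisms of Lie algebras. -/
def lieEquivProd {L₁ L₂ M₁ M₂ : Type} [LieRing L₁] [LieAlgebra ℝ L₁] [LieRing L₂] [LieAlgebra ℝ L₂]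
    [LieRing M₁] [LieAlgebra ℝ M₁] [LieRing M₂] [LieAlgebra ℝ M₂] (f : L₁ ≃ₗ⁅ℝ⁆ M₁) (g : L₂ ≃ₗ⁅ℝ⁆ M₂) :
    (L₁ × L₂) ≃ₗ⁅ℝ⁆ (M₁ × M₂) where
  __ := LinearEquiv.prodCongr f.toLinearEquiv g.toLinearEquiv
  map_lie' {x y} := Prod.ext (f.map_lie x.1 y.1) (g.map_lie x.2 y.2)

/-! ### Two and four irreducible representations. -/

section SeveralIrreps

variable {p q : ℕ}

/-- Where `z` acts by a sign, every element acts like an even one, so simplicity passes to the even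
subalgebra. -/
theorem isSimpleModule_even_of_actsBy (hpq : 1 ≤ p + q) {z : R p q} (hz : IsOddCentral z 1) {s : ℤˣ}
    {U : Type} [AddCommGroup U] [Module (R p q) U] [IsSimpleModule (R p q) U] (h : ActsBy z s U) :
    IsSimpleModule (Rplus p q) U := by
  rw [← Module.length_eq_one_iff, ← length_eq_of_forall_exists, Module.length_eq_one_iff]
  · infer_instance
  · intro a
    obtain ⟨b, hb, b', hb', rfl⟩ := exists_even_add_central hpq hz.odd hz.central hz.sq (one_mul 1) a
    rcases Int.units_eq_one_or s with rfl | rfl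
    · refine ⟨⟨b + b', add_mem hb hb'⟩, fun u => ?_⟩
      change (b + z * b') • u = (b + b') • u
      rw [add_smul, mul_smul, add_smul, h, one_smul]
    · refine ⟨⟨b - b', sub_mem hb hb'⟩, fun u => ?_⟩
      change (b + z * b') • u = (b - b') • u
      rw [add_smul, mul_smul, sub_smul, h, Units.smul_def, Units.val_neg, Units.val_one, neg_one_smul,
        sub_eq_add_neg]

theorem IsEvenCentral.even_ne {c : R p q} (hc : IsEvenCentral c) :
    (∀ x : Rplus p q, (⟨c, hc.mem⟩ : Rplus p q) * x = x * ⟨c, hc.mem⟩) ∧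
    (⟨c, hc.mem⟩ : Rplus p q) * ⟨c, hc.mem⟩ = 1 ∧ (⟨c, hc.mem⟩ : Rplus p q) ≠ 1 ∧
      (⟨c, hc.mem⟩ : Rplus p q) ≠ -1 :=
  ⟨fun x => Subtype.ext (hc.central x), Subtype.ext hc.sq, fun h => hc.ne_one (congrArg Subtype.val h),
    fun h => hc.ne_neg_one (congrArg Subtype.val h)⟩

theorem IsOddCentral.ne_one {z : R p q} (hz : IsOddCentral z 1) : z ≠ 1 ∧ z ≠ -1 := by
  constructor
  · have := hz.ne_algebraMap (r := 1) (by norm_num)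
    rwa [map_one] at this
  · have := hz.ne_algebraMap (r := -1) (by norm_num)
    rwa [map_neg, map_one] at this

/-- The grading changes the sign of `z` and fixes `c`. If the product vanished, adding its image
would give `2 (1 + b c) = 0`, making `c` a scalar `±1`. -/
theorem one_add_mul_one_add_ne_zero {z c : R p q} (hz : IsOddCentral z 1) (hc : IsEvenCentral c) (a b : ℝ)
    (ha : a * a = 1) (hb : b * b = 1) : (1 + a • z) * (1 + b • c) ≠ 0 := by
  intro h
  have hbc : 1 + b • c ≠ 0 := by
    intro h1
    rcases mul_self_eq_one_iff.1 hb with rfl | rfl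
    · rw [one_smul] at h1
      exact hc.ne_neg_one (eq_neg_of_add_eq_zero_right h1)
    · rw [neg_one_smul, ← sub_eq_add_neg, sub_eq_zero] at h1
      exact hc.ne_one h1.symm
  have h2 := congrArg (grading p q) h
  rw [map_mul, map_add, map_add, map_one, map_smul, map_smul, hz.odd, grading_of_mem hc.mem, map_zero] at h2
  apply hbc
  have h3 : (2 : ℝ) • (1 + b • c) = 0 := by
    have h4 : (2 : ℝ) • (1 + b • c) = (1 + a • z) * (1 + b • c) + (1 + a • -z) * (1 + b • c) := by
      rw [← add_mul, smul_neg, add_add_add_comm, add_neg_cancel, add_zero, two_smul, add_mul, one_mul]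
    rw [h4, h, h2, add_zero]
  exact (smul_eq_zero.1 h3).resolve_left two_ne_zero

/-- The four irreducible representations restrict in pairs to the even subalgebra. -/
theorem hasPairedIrreps (hpq : 1 ≤ p + q) {z c : R p q} (hz : IsOddCentral z 1) (hc : IsEvenCentral c)
    {K K' : Type} [DivisionRing K] [Algebra ℝ K] [DivisionRing K'] [Algebra ℝ K']
    (hA : IsMatrixSum (R p q) 4 K) (hA' : IsMatrixSum (Rplus p q) 2 K') : HasPairedIrreps p q := by
  obtain ⟨V, hV⟩ := hA.exists_irreps
  obtain ⟨U, hU⟩ := hA'.exists_irreps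
  obtain ⟨σ, hσ⟩ := hV.exists_signs hz.central (by rw [hz.sq, map_one]) hc.central hc.sq
    (one_add_mul_one_add_ne_zero hz hc)
  -- The first entry is the sign of `c` and the second that of `z`. Consecutive pairs share the sign
  -- of `c`, which is what the even subalgebra still sees.
  let τ : Fin 4 → ℤˣ × ℤˣ := ![(1, 1), (1, -1), (-1, 1), (-1, -1)]
  have hτ : Function.Bijective τ := by decide
  let V' : Fin 4 → ModuleCat.{0} (R p q) := fun k => V (σ.symm (τ k))
  have hsimple : ∀ k, IsSimpleModule (R p q) (V' k) := fun k => hV.simple _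
  have hV'c : ∀ k, ActsBy c (τ k).1 (V' k) := fun k => by
    have := (hσ (σ.symm (τ k))).1
    rwa [Equiv.apply_symm_apply] at this
  have hV'z : ∀ k, ActsBy z (τ k).2 (V' k) := fun k => by
    have := (hσ (σ.symm (τ k))).2
    rwa [Equiv.apply_symm_apply] at this
  have hV' : IsIrrepList V' :=
    { simple := hsimple
      not_equiv := fun i j hij => hV.not_equiv _ _ fun h => hij (hτ.1 (σ.symm.injective h))
      exhaust := fun U hU => by
        obtain ⟨i, ⟨f⟩⟩ := hV.exhaust U hU
        obtain ⟨k, hk⟩ := hτ.2 (σ i)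
        refine ⟨k, ?_⟩
        have : σ.symm (τ k) = i := by rw [hk, Equiv.symm_apply_apply]
        change Nonempty (U ≃ₗ[R p q] V (σ.symm (τ k)))
        rw [this]
        exact ⟨f⟩ }
  have hsimple' : ∀ k, IsSimpleModule (Rplus p q) (V' k) := fun k =>
    isSimpleModule_even_of_actsBy hpq hz (hV'z k)
  obtain ⟨h1, h2, h3, h4⟩ := hc.even_ne
  have hc' : ∀ k, ActsBy (⟨c, hc.mem⟩ : Rplus p q) (τ k).1 (V' k) := fun k => hV'c k
  have hequiv : ∀ i j, (τ i).1 = (τ j).1 → Nonempty (V' i ≃ₗ[Rplus p q] V' j) := fun i j hij => by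
    have h := hc' i
    rw [hij] at h
    exact hU.nonempty_equiv_of_actsBy h1 h2 h3 h4 h (hc' j)
  refine ⟨V', hV', ⟨hequiv 0 1 rfl, hequiv 2 3 rfl⟩, ⟨fun i => ?_, fun i j hij => ⟨fun f => ?_⟩,
    fun X hX => ?_⟩⟩
  · fin_cases i
    · exact hsimple' 0
    · exact hsimple' 2
  · have : Nontrivial (V' 0) := IsSimpleModule.nontrivial (R p q) (V' 0)
    have key : ∀ f : V' 0 ≃ₗ[Rplus p q] V' 2, False := fun f => by
      have h5 := ((hc' 2).congr f.symm).unique (hc' 0)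
      exact absurd h5 (by decide)
    fin_cases i <;> fin_cases j
    · exact hij rfl
    · exact key f
    · exact key f.symm
    · exact hij rfl
  · obtain ⟨s, hs⟩ := exists_actsBy (U := X) h1 h2
    rcases Int.units_eq_one_or s with rfl | rfl
    · have := hsimple' 0
      have h5 : Nonempty (X ≃ₗ[Rplus p q] V' 0) := hU.nonempty_equiv_of_actsBy h1 h2 h3 h4 hs (hc' 0)
      exact ⟨0, h5⟩
    · have := hsimple' 2
      have h5 : Nonempty (X ≃ₗ[Rplus p q] V' 2) := hU.nonempty_equiv_of_actsBy h1 h2 h3 h4 hs (hc' 2)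
      exact ⟨1, h5⟩

variable {W : Type} [NormedAddCommGroup W] [InnerProductSpace ℝ W] [FiniteDimensional ℝ W]
  [Module (R p q) W] [IsScalarTower ℝ (R p q) W]

theorem isotypicComponent_eq_centralEigenspace [IsSemisimpleRing (R p q)]
    {V : Fin 2 → ModuleCat.{0} (R p q)} (hV : IsIrrepList V) {c : R p q} (hc : ∀ x, c * x = x * c)
    (h0 : ActsBy c 1 (V 0)) (h1 : ActsBy c (-1) (V 1)) :
    isotypicComponent (R p q) W (V 0) = centralEigenspace W hc 1 ∧
      isotypicComponent (R p q) W (V 1) = centralEigenspace W hc (-1) := by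
  have := hV.simple 0
  have := hV.simple 1
  constructor
  · refine isotypicComponent_eq_of_forall _ fun S hS => ?_
    rw [le_centralEigenspace_iff hc 1 (by simp)]
    exact (hV.nonempty_equiv_iff h0 h1 S).1
  · refine isotypicComponent_eq_of_forall _ fun S hS => ?_
    rw [le_centralEigenspace_iff hc (-1) (by simp)]
    exact (hV.nonempty_equiv_iff h0 h1 S).2

theorem isIsotypicOn_centralEigenspace {A : Type} [Ring A] [Algebra ℝ A] [Module A W] [IsScalarTower ℝ A W]
    {V : Fin 2 → ModuleCat.{0} A} (hV : IsIrrepList V) {c : A} (hc : ∀ x, c * x = x * c) (hcc : c * c = 1)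
    (h1 : c ≠ 1) (h2 : c ≠ -1) {P : Submodule A W} {r : ℝ} (hr : r * r = 1) (hP : ∀ w ∈ P, c • w = r • w) :
    IsIsotypicOn P := by
  rcases mul_self_eq_one_iff.1 hr with rfl | rfl
  · exact isIsotypicOn_of_actsBy hV hc hcc h1 h2 (s := 1) fun w hw => by rw [hP w hw, one_smul, one_smul]
  · exact isIsotypicOn_of_actsBy hV hc hcc h1 h2 (s := -1) fun w hw => by
      rw [hP w hw, sign_smul_real]; simp

variable (hpq : 1 ≤ p + q) (hS : IsSymmRep p q W) [IsSemisimpleRing (R p q)]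
variable {K : Type} [DivisionRing K] [Algebra ℝ K] [StarRing K] [StarModule ℝ K]

include hpq hS

/-- The list `V` comes in an arbitrary order; replacing `z` by `-z` when necessary arranges that `z`
acts as `1` on the first module. -/
theorem hOn_equiv_of_two {z : R p q} (hz : IsOddCentral z 1) (hK : HasRealNorm K)
    (hA : IsMatrixSum (Rplus p q) 1 K) {V : Fin 2 → ModuleCat.{0} (R p q)} (hV : IsIrrepList V) :
    Nonempty (hOn (⊤ : Submodule (R p q) W) ≃ₗ⁅ℝ⁆
      skewHerm K (diagSign K (multIn (V 0) W) (multIn (V 1) W))) := by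
  obtain ⟨V', hV'⟩ := hA.exists_irreps
  have key : ∀ z : R p q, IsOddCentral z 1 → ActsBy z 1 (V 0) → ActsBy z (-1) (V 1) →
      Nonempty (hOn (⊤ : Submodule (R p q) W) ≃ₗ⁅ℝ⁆
        skewHerm K (diagSign K (multIn (V 0) W) (multIn (V 1) W))) := fun z hz h0 h1 => by
    obtain ⟨e0, e1⟩ := isotypicComponent_eq_centralEigenspace (W := W) hV hz.central h0 h1
    refine hOn_equiv_skewHerm_diagSign hpq hS hz hK hA (isIsotypicOn_of_unique hV' _) ?_ ?_
    · rw [top_inf_eq]; exact length_eq_multIn e0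
    · rw [top_inf_eq]; exact length_eq_multIn e1
  obtain ⟨s, h0, h1⟩ := hV.exists_sign hz.central (by rw [hz.sq, map_one]) hz.ne_one.1 hz.ne_one.2
  rcases Int.units_eq_one_or s with rfl | rfl
  · exact key z hz h0 h1
  · exact key (-z) hz.neg (by simpa using h0.neg) (by simpa using h1.neg)

/-- If two irreducible representations are distinguished by an even central element, then the Lie algebra
is a product. -/
theorem hOn_equiv_prod_of_two {c : R p q} (hc : IsEvenCentral c)
    {V : Fin 2 → ModuleCat.{0} (R p q)} (hV : IsIrrepList V) {g : ℕ → Type} [∀ n, LieRing (g n)]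
    [∀ n, LieAlgebra ℝ (g n)]
    (hg : ∀ (P : Submodule (R p q) W) (n : ℕ), IsIsotypicOn P → Module.length (R p q) P = n →
      Nonempty (hOn P ≃ₗ⁅ℝ⁆ g n)) :
    Nonempty (hOn (⊤ : Submodule (R p q) W) ≃ₗ⁅ℝ⁆ (g (multIn (V 0) W) × g (multIn (V 1) W))) := by
  have key : ∀ c : R p q, IsEvenCentral c → ActsBy c 1 (V 0) → ActsBy c (-1) (V 1) →
      Nonempty (hOn (⊤ : Submodule (R p q) W) ≃ₗ⁅ℝ⁆ (g (multIn (V 0) W) × g (multIn (V 1) W))) :=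
    fun c hc h0 h1 => by
      obtain ⟨e0, e1⟩ := isotypicComponent_eq_centralEigenspace (W := W) hV hc.central h0 h1
      obtain ⟨f⟩ := nonempty_equiv_prod hS hc
      obtain ⟨f1⟩ := hg _ _ (isIsotypicOn_centralEigenspace hV hc.central hc.sq hc.ne_one hc.ne_neg_one
        (one_mul 1) fun w hw => hw) (length_eq_multIn e0)
      obtain ⟨f2⟩ := hg _ _ (isIsotypicOn_centralEigenspace hV hc.central hc.sq hc.ne_one hc.ne_neg_one
        (by norm_num) fun w hw => hw) (length_eq_multIn e1)
      exact ⟨f.trans (lieEquivProd f1 f2)⟩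
  obtain ⟨s, h0, h1⟩ := hV.exists_sign hc.central hc.sq hc.ne_one hc.ne_neg_one
  rcases Int.units_eq_one_or s with rfl | rfl
  · exact key c hc h0 h1
  · exact key (-c) hc.neg (by simpa using h0.neg) (by simpa using h1.neg)

omit hpq hS in
theorem isotypicComponent_eq_inf {V : Fin 4 → ModuleCat.{0} (R p q)} (hV : IsIrrepList V) {z c : R p q}
    (hz : ∀ x, z * x = x * z) (hc : ∀ x, c * x = x * c) {σ : Fin 4 → ℤˣ × ℤˣ}
    (hσi : Function.Injective σ) (hσ : ∀ i, ActsBy c (σ i).1 (V i) ∧ ActsBy z (σ i).2 (V i)) {i : Fin 4}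
    {r r' : ℝ} (hr : r = ((σ i).1 : ℤ)) (hr' : r' = ((σ i).2 : ℤ)) :
    isotypicComponent (R p q) W (V i) = centralEigenspace W hc r ⊓ centralEigenspace W hz r' := by
  have := hV.simple i
  refine isotypicComponent_eq_of_forall _ fun S hS => ?_
  rw [le_inf_iff, le_centralEigenspace_iff hc _ hr, le_centralEigenspace_iff hz _ hr']
  constructor
  · rintro ⟨h1, h2⟩
    obtain ⟨j, ⟨f⟩⟩ := hV.exhaust (ModuleCat.of _ S) hS
    have f' : S ≃ₗ[R p q] V j := f
    have : Nontrivial S := IsSimpleModule.nontrivial (R p q) S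
    have hij : σ i = σ j := Prod.ext (h1.unique ((hσ j).1.congr f'.symm)) (h2.unique ((hσ j).2.congr f'.symm))
    rw [hσi hij]
    exact ⟨f'⟩
  · rintro ⟨f⟩
    exact ⟨(hσ i).1.congr f.symm, (hσ i).2.congr f.symm⟩

/-- On an eigenspace of `c` all simple submodules agree over the even subalgebra, and the two
remaining classes over the full algebra are its parts where `z` is `1` and `-1`. -/
theorem hOn_centralEigenspace_equiv {z c : R p q} (hz : IsOddCentral z 1) (hc : IsEvenCentral c)
    (hK : HasRealNorm K) (hA : IsMatrixSum (Rplus p q) 2 K) {V : Fin 4 → ModuleCat.{0} (R p q)}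
    (hV : IsIrrepList V) {σ : Fin 4 → ℤˣ × ℤˣ} (hσi : Function.Injective σ)
    (hσ : ∀ i, ActsBy c (σ i).1 (V i) ∧ ActsBy z (σ i).2 (V i)) {i j : Fin 4} (hij : i ≠ j)
    (h1 : (σ i).1 = (σ j).1) {r : ℝ} (hr : r = ((σ i).1 : ℤ)) :
    Nonempty (hOn (centralEigenspace W hc.central r) ≃ₗ⁅ℝ⁆
      skewHerm K (diagSign K (multIn (V i) W) (multIn (V j) W))) := by
  obtain ⟨U, hU⟩ := hA.exists_irreps
  obtain ⟨e1, e2, e3, e4⟩ := hc.even_ne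
  have hrr : r * r = 1 := by
    rw [hr, ← Int.cast_mul, ← Units.val_mul, Int.units_mul_self]; simp
  have hiso : IsIsotypicOn ((centralEigenspace W hc.central r).restrictScalars (Rplus p q)) :=
    isIsotypicOn_centralEigenspace hU e1 e2 e3 e4 hrr fun w hw => hw
  have key : ∀ (z : R p q) (σ : Fin 4 → ℤˣ × ℤˣ), IsOddCentral z 1 → Function.Injective σ →
      (∀ i, ActsBy c (σ i).1 (V i) ∧ ActsBy z (σ i).2 (V i)) → (σ i).1 = (σ j).1 → r = ((σ i).1 : ℤ) →
      (σ i).2 = 1 → Nonempty (hOn (centralEigenspace W hc.central r) ≃ₗ⁅ℝ⁆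
        skewHerm K (diagSign K (multIn (V i) W) (multIn (V j) W))) := by
    intro z σ hz hσi hσ h1 hr hi
    have hj : (σ j).2 = -1 := by
      rcases Int.units_eq_one_or (σ j).2 with h | h
      · exact absurd (hσi (Prod.ext h1 (hi.trans h.symm))) hij
      · exact h
    refine hOn_equiv_skewHerm_diagSign hpq hS hz hK hA hiso ?_ ?_
    · exact length_eq_multIn (isotypicComponent_eq_inf hV hz.central hc.central hσi hσ hr (by rw [hi]; simp))
    · exact length_eq_multIn (isotypicComponent_eq_inf hV hz.central hc.central hσi hσ (h1 ▸ hr)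
        (by rw [hj]; simp))
  rcases Int.units_eq_one_or (σ i).2 with h | h
  · exact key z σ hz hσi hσ h1 hr h
  · refine key (-z) (fun i => ((σ i).1, -(σ i).2)) hz.neg (fun a b hab => hσi ?_)
      (fun i => ⟨(hσ i).1, (hσ i).2.neg⟩) h1 hr (by simp [h])
    rw [Prod.mk.injEq, neg_inj] at hab
    exact Prod.ext hab.1 hab.2

theorem hOn_equiv_of_four {z c : R p q} (hz : IsOddCentral z 1) (hc : IsEvenCentral c)
    (hK : HasRealNorm K) (hA : IsMatrixSum (Rplus p q) 2 K) {V : Fin 4 → ModuleCat.{0} (R p q)}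
    (hV : IsIrrepList V) (hP : IsPaired V) :
    Nonempty (hOn (⊤ : Submodule (R p q) W) ≃ₗ⁅ℝ⁆
      (skewHerm K (diagSign K (multIn (V 0) W) (multIn (V 1) W)) ×
        skewHerm K (diagSign K (multIn (V 2) W) (multIn (V 3) W)))) := by
  have hVs := hV.simple
  have key : ∀ c : R p q, IsEvenCentral c → ActsBy c 1 (V 0) →
      Nonempty (hOn (⊤ : Submodule (R p q) W) ≃ₗ⁅ℝ⁆
      (skewHerm K (diagSign K (multIn (V 0) W) (multIn (V 1) W)) ×
        skewHerm K (diagSign K (multIn (V 2) W) (multIn (V 3) W)))) := by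
    intro c hc h0
    obtain ⟨σ, hσ⟩ := hV.exists_signs hz.central (by rw [hz.sq, map_one]) hc.central hc.sq
      (one_add_mul_one_add_ne_zero hz hc)
    have hnt : ∀ i, Nontrivial (V i) := fun i => IsSimpleModule.nontrivial (R p q) (V i)
    have hs0 : (σ 0).1 = 1 := (hσ 0).1.unique h0
    obtain ⟨⟨f⟩, ⟨g⟩⟩ := hP
    -- Since `c` is even, its sign is visible in the restriction and is shared by paired modules.
    have h01 : (σ 0).1 = (σ 1).1 := by
      have h2 : ActsBy (⟨c, hc.mem⟩ : Rplus p q) (σ 0).1 (res (V 0)) := (hσ 0).1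
      exact (show ActsBy c (σ 0).1 (V 1) from h2.congr f).unique (hσ 1).1
    have h23 : (σ 2).1 = (σ 3).1 := by
      have h2 : ActsBy (⟨c, hc.mem⟩ : Rplus p q) (σ 2).1 (res (V 2)) := (hσ 2).1
      exact (show ActsBy c (σ 2).1 (V 3) from h2.congr g).unique (hσ 3).1
    -- The first two modules already use both signs of `z` together with `c = 1`, so the third must
    -- have `c = -1`.
    have hs2 : (σ 2).1 = -1 := by
      rcases Int.units_eq_one_or (σ 2).1 with h | h
      · exfalso
        have e1 : ∀ i j, (σ i).1 = (σ j).1 → (σ i).2 = (σ j).2 → i = j := fun i j h h' =>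
          σ.injective (Prod.ext h h')
        rcases Int.units_eq_one_or (σ 0).2 with a | a <;> rcases Int.units_eq_one_or (σ 1).2 with b | b <;>
          rcases Int.units_eq_one_or (σ 2).2 with d | d
        all_goals first
          | exact absurd (e1 0 1 h01 (a.trans b.symm)) (by decide)
          | exact absurd (e1 0 2 (hs0.trans h.symm) (a.trans d.symm)) (by decide)
          | exact absurd (e1 1 2 (h01.symm.trans (hs0.trans h.symm)) (b.trans d.symm)) (by decide)
      · exact h
    obtain ⟨F⟩ := nonempty_equiv_prod hS hc
    obtain ⟨f1⟩ := hOn_centralEigenspace_equiv hpq hS hz hc hK hA hV σ.injective hσ (i := 0) (j := 1)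
      (by decide) h01 (r := 1) (by rw [hs0]; simp)
    obtain ⟨f2⟩ := hOn_centralEigenspace_equiv hpq hS hz hc hK hA hV σ.injective hσ (i := 2) (j := 3)
      (by decide) h23 (r := -1) (by rw [hs2]; simp)
    exact ⟨F.trans (lieEquivProd f1 f2)⟩
  obtain ⟨s, hs⟩ := exists_actsBy (U := V 0) hc.central hc.sq
  rcases Int.units_eq_one_or s with rfl | rfl
  · exact key c hc hs
  · exact key (-c) hc.neg (by simpa using hs.neg)

end SeveralIrreps

end

section

/-! ### Volume elements of the two factors. -/

section VolumeElements

variable {p q : ℕ}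

/-- The square of the product of `n` anticommuting elements of square `1`. -/
def volSign (n : ℕ) : ℝ := if n % 4 < 2 then 1 else -1

theorem volSign_mul_self (n : ℕ) : volSign n * volSign n = 1 := by
  unfold volSign
  split_ifs <;> norm_num

/-- Transposition reverses the product, so the factors cancel in pairs from the middle outwards. -/
theorem transp_prod_ofFn_mul {n : ℕ} (g : Fin n → R p q) (hg : ∀ i, transp p q (g i) = g i)
    (hsq : ∀ i, g i * g i = 1) : transp p q (List.ofFn g).prod * (List.ofFn g).prod = 1 := by
  induction n with
  | zero =>
    rw [List.ofFn_zero, List.prod_nil, mul_one, ← map_one (algebraMap ℝ (R p q)), transp_algebraMap]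
  | succ n ih =>
    rw [List.ofFn_succ, List.prod_cons, transp_mul, hg, mul_assoc, ← mul_assoc (g 0), hsq, one_mul]
    exact ih _ (fun _ => hg _) fun _ => hsq _

theorem map_prod_ofFn_of_smul {n : ℕ} (f : R p q →ₐ[ℝ] R p q) (g : Fin n → R p q) {a : ℝ}
    (hf : ∀ i, f (g i) = a • g i) : f (List.ofFn g).prod = a ^ n • (List.ofFn g).prod := by
  induction n with
  | zero => rw [List.ofFn_zero, List.prod_nil, map_one, pow_zero, one_smul]
  | succ n ih =>
    rw [List.ofFn_succ, List.prod_cons, map_mul, hf, ih _ fun _ => hf _, smul_mul_smul_comm, pow_succ']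

variable (p q) in
/-- The product of the generators of the first factor. -/
def volL : R p q := (List.ofFn fun i => e p q (.inl i)).prod

variable (p q) in
/-- The product of the generators of the second factor. -/
def volR : R p q := (List.ofFn fun j => e p q (.inr j)).prod

theorem volL_sq : volL p q * volL p q = algebraMap ℝ _ (volSign p) := by
  rw [volL, prod_ofFn_sq _ (fun _ => e_sq _) fun _ _ h => e_inl_anticomm h, volSign]
  split_ifs
  · rw [map_one]
  · rw [map_neg, map_one]

theorem volR_sq : volR p q * volR p q = algebraMap ℝ _ (volSign q) := by
  rw [volR, prod_ofFn_sq _ (fun _ => e_sq _) fun _ _ h => e_inr_anticomm h, volSign]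
  split_ifs
  · rw [map_one]
  · rw [map_neg, map_one]

theorem transp_eq_smul {x : R p q} {ε : ℝ} (h1 : transp p q x * x = 1)
    (h2 : x * x = algebraMap ℝ _ ε) (hε : ε * ε = 1) : transp p q x = ε • x := by
  have h3 : transp p q x * (x * x) = x := by rw [← mul_assoc, h1, one_mul]
  rw [h2, ← Algebra.commutes, ← Algebra.smul_def] at h3
  rw [← congrArg (ε • ·) h3, smul_smul, hε, one_smul]

theorem transp_volL : transp p q (volL p q) = volSign p • volL p q :=
  transp_eq_smul (transp_prod_ofFn_mul _ (fun _ => transp_e _) fun _ => e_sq _) volL_sq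
    (volSign_mul_self p)

theorem transp_volR : transp p q (volR p q) = volSign q • volR p q :=
  transp_eq_smul (transp_prod_ofFn_mul _ (fun _ => transp_e _) fun _ => e_sq _) volR_sq
    (volSign_mul_self q)

theorem grading_volL : grading p q (volL p q) = (-1 : ℝ) ^ p • volL p q :=
  map_prod_ofFn_of_smul _ _ fun i => by rw [grading_e, neg_one_smul]

theorem grading_volR : grading p q (volR p q) = (-1 : ℝ) ^ q • volR p q :=
  map_prod_ofFn_of_smul _ _ fun i => by rw [grading_e, neg_one_smul]

theorem e_inl_volL (i : Fin p) :
    e p q (.inl i) * volL p q = (-1) ^ (p + 1) * (volL p q * e p q (.inl i)) :=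
  gen_mul_prod_ofFn _ (fun _ _ h => e_inl_anticomm h) i

theorem e_inr_volR (j : Fin q) :
    e p q (.inr j) * volR p q = (-1) ^ (q + 1) * (volR p q * e p q (.inr j)) :=
  gen_mul_prod_ofFn _ (fun _ _ h => e_inr_anticomm h) j

theorem e_inr_volL (j : Fin q) : e p q (.inr j) * volL p q = volL p q * e p q (.inr j) :=
  commute_prod_ofFn _ _ fun i => (e_inl_inr_comm i j).symm

theorem e_inl_volR (i : Fin p) : e p q (.inl i) * volR p q = volR p q * e p q (.inl i) :=
  commute_prod_ofFn _ _ fun j => e_inl_inr_comm i j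

theorem volL_volR_comm : volL p q * volR p q = volR p q * volL p q :=
  commute_prod_ofFn _ _ fun j => (e_inr_volL j).symm

theorem central_of_commute_e {z : R p q} (h : ∀ i, e p q i * z = z * e p q i) (x : R p q) :
    z * x = x * z := by
  induction x using R_induction with
  | halg r => exact (Algebra.commutes r z).symm
  | hgen i => exact (h i).symm
  | hadd x y hx hy => rw [mul_add, add_mul, hx, hy]
  | hmul x y hx hy => rw [← mul_assoc, hx, mul_assoc, hy, mul_assoc]

theorem volL_central (hp : p % 2 = 1) : ∀ x, volL p q * x = x * volL p q :=
  central_of_commute_e fun i => by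
    rcases i with i | j
    · rw [e_inl_volL, (Nat.even_iff.2 (by omega) : Even (p + 1)).neg_one_pow, one_mul]
    · exact e_inr_volL j

theorem volR_central (hq : q % 2 = 1) : ∀ x, volR p q * x = x * volR p q :=
  central_of_commute_e fun i => by
    rcases i with i | j
    · exact e_inl_volR i
    · rw [e_inr_volR, (Nat.even_iff.2 (by omega) : Even (q + 1)).neg_one_pow, one_mul]

theorem isOddCentral_volL (hp : p % 2 = 1) {ε : ℝ} (hε : volSign p = ε) :
    IsOddCentral (volL p q) ε where
  odd := by rw [grading_volL, (Nat.odd_iff.2 hp).neg_one_pow, neg_one_smul]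
  central := volL_central hp
  sq := hε ▸ volL_sq
  transp_eq := hε ▸ transp_volL

theorem isOddCentral_volR (hq : q % 2 = 1) {ε : ℝ} (hε : volSign q = ε) :
    IsOddCentral (volR p q) ε where
  odd := by rw [grading_volR, (Nat.odd_iff.2 hq).neg_one_pow, neg_one_smul]
  central := volR_central hq
  sq := hε ▸ volR_sq
  transp_eq := hε ▸ transp_volR

theorem volL_mul_volR_sq : volL p q * volR p q * (volL p q * volR p q) =
    algebraMap ℝ _ (volSign p * volSign q) := by
  rw [mul_assoc, ← mul_assoc (volR p q), ← volL_volR_comm, mul_assoc, volR_sq, ← mul_assoc, volL_sq,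
    map_mul]

theorem transp_volL_mul_volR : transp p q (volL p q * volR p q) =
    (volSign p * volSign q) • (volL p q * volR p q) := by
  rw [transp_mul, transp_volL, transp_volR, smul_mul_smul_comm, ← volL_volR_comm, mul_comm (volSign p)]

theorem volL_mul_volR_mem (hpq : 1 ≤ p + q) (h : p % 2 = q % 2) :
    volL p q * volR p q ∈ Rplus p q := by
  rw [mem_Rplus_iff hpq, map_mul, grading_volL, grading_volR, smul_mul_smul_comm, ← pow_add,
    (Nat.even_iff.2 (by omega) : Even (p + q)).neg_one_pow, one_smul]

/-- Each volume element is central because its factor has an odd number of generators. The grading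
fixes their product, so to see that it is not a scalar one changes the signs of the first factor
only, which negates it. -/
theorem isEvenCentral_volL_mul_volR (hpq : 1 ≤ p + q) (hp : p % 2 = 1) (h : p % 4 = q % 4) :
    IsEvenCentral (volL p q * volR p q) := by
  have hq : q % 2 = 1 := by omega
  have hs : volSign p * volSign q = 1 := by
    rw [show volSign q = volSign p by rw [volSign, volSign, h], volSign_mul_self]
  have hsq : volL p q * volR p q * (volL p q * volR p q) = 1 := by rw [volL_mul_volR_sq, hs, map_one]
  have hmap : scaling p q (a := -1) (b := 1) (by norm_num) (by norm_num) (volL p q * volR p q) =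
      -(volL p q * volR p q) := by
    rw [map_mul, volL, volR, map_prod_ofFn_of_smul _ _ (scaling_inl _ _),
      map_prod_ofFn_of_smul _ _ (scaling_inr _ _), (Nat.odd_iff.2 hp).neg_one_pow, one_pow, one_smul,
      neg_one_smul, neg_mul]
  have hne : ∀ r : ℝ, r ≠ 0 → volL p q * volR p q ≠ algebraMap ℝ _ r := fun r hr h1 => by
    rw [h1, AlgHom.commutes, ← map_neg] at hmap
    have := (algebraMap ℝ (R p q)).injective hmap
    exact hr (by linarith)
  exact
    { mem := volL_mul_volR_mem hpq (by omega)
      central := fun x => by rw [mul_assoc, volR_central hq, ← mul_assoc, volL_central hp, mul_assoc]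
      sq := hsq
      transp_eq := by rw [transp_volL_mul_volR, hs, one_smul]
      ne_one := fun h1 => hne 1 one_ne_zero (by rw [h1, map_one])
      ne_neg_one := fun h1 => hne (-1) (by norm_num) (by rw [h1, map_neg, map_one]) }

/-- A generator anticommutes with the volume element of its own factor, which has an even number of
generators, and commutes with the other one. -/
theorem isEvenAnticentral_volL_mul_volR (hpq : 1 ≤ p + q) (hp : p % 2 = 0) (hq : q % 2 = 0) {ε : ℝ}
    (hε : volSign p * volSign q = ε) : IsEvenAnticentral (volL p q * volR p q) ε where
  mem := volL_mul_volR_mem hpq (by omega)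
  anticomm i := by
    rcases i with i | j
    · rw [← mul_assoc, e_inl_volL, (Nat.odd_iff.2 (by omega) : Odd (p + 1)).neg_one_pow, neg_one_mul,
        neg_mul, mul_assoc, e_inl_volR, mul_assoc]
    · rw [← mul_assoc, e_inr_volL, mul_assoc, e_inr_volR,
        (Nat.odd_iff.2 (by omega) : Odd (q + 1)).neg_one_pow, neg_one_mul, mul_neg, mul_assoc]
  sq := hε ▸ volL_mul_volR_sq
  transp_eq := hε ▸ transp_volL_mul_volR

end VolumeElements

end

section

/-! ### Reductivity. -/

section CentralRadical

variable {n : Type} [Fintype n] [DecidableEq n] (L : LieSubalgebra ℝ (Matrix n n ℝ))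

omit [DecidableEq n] in
theorem eq_zero_of_trace_mul_transpose {Z : Matrix n n ℝ} (h : (Z * Zᵀ).trace = 0) : Z = 0 := by
  rw [← Matrix.conjTranspose_eq_transpose_of_trivial] at h
  exact Matrix.trace_mul_conjTranspose_self_eq_zero_iff.1 h

theorem trace_lie_mul (X Y Z : Matrix n n ℝ) : (⁅X, Y⁆ * Z).trace = (X * ⁅Y, Z⁆).trace := by
  rw [Ring.lie_def, Ring.lie_def, sub_mul, mul_sub, Matrix.trace_sub, Matrix.trace_sub, mul_assoc,
    mul_assoc Y, Matrix.trace_mul_comm Y, mul_assoc]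

variable {L} in
/-- The automorphism `X ↦ -ᵗX` of a Lie algebra of matrices closed under transposition. -/
def cartanInvolution (hT : ∀ X ∈ L, Xᵀ ∈ L) : L →ₗ⁅ℝ⁆ L where
  toFun X := ⟨-X.1ᵀ, neg_mem (hT _ X.2)⟩
  map_add' X Y := Subtype.ext (by simp [add_comm])
  map_smul' r X := Subtype.ext (by simp)
  map_lie' {X Y} := Subtype.ext (by
    simp only [LieSubalgebra.coe_bracket, Ring.lie_def, Matrix.transpose_sub, Matrix.transpose_mul]
    noncomm_ring)

/-- A Lie algebra of real matrices that is closed under transposition is reductive. -/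
theorem hasCentralRadical_of_transpose_mem (hT : ∀ X ∈ L, Xᵀ ∈ L) :
    LieAlgebra.HasCentralRadical ℝ L := by
  let τ := cartanInvolution hT
  have hτ : ∀ X : L, (τ X).1 = -X.1ᵀ := fun _ => rfl
  have hττ : ∀ X, τ (τ X) = X := fun X => Subtype.ext (by simp [hτ])
  -- By invariance of the trace form, `tr([X,Y] ᵗ[X,Y]) = -tr(X [Y, τ[X,Y]])`, and the left side
  -- vanishes only for `[X,Y] = 0`.
  have hzero : ∀ X Y : L, ⁅Y, τ ⁅X, Y⁆⁆ = 0 → ⁅X, Y⁆ = 0 := fun X Y h => by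
    apply Subtype.ext
    apply eq_zero_of_trace_mul_transpose
    have h1 : ⁅Y.1, -(⁅X, Y⁆ : L).1ᵀ⁆ = 0 := congrArg Subtype.val h
    rw [← neg_eq_zero, ← Matrix.trace_neg, ← mul_neg, LieSubalgebra.coe_bracket, trace_lie_mul,
      ← LieSubalgebra.coe_bracket, h1, mul_zero, Matrix.trace_zero]
  let D : ℕ → LieIdeal ℝ L := fun k =>
    LieAlgebra.derivedSeriesOfIdeal ℝ L k (LieAlgebra.radical ℝ L)
  have hD : ∀ k, D (k + 1) = ⁅D k, D k⁆ := fun k => LieAlgebra.derivedSeriesOfIdeal_succ ℝ L _ k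
  -- The preimage of the radical under the involution is again a solvable ideal, hence contained in
  -- the radical. The derived series of the radical is then stable under `τ`.
  have hrad : ∀ X ∈ D 0, τ X ∈ D 0 := by
    have hsol : LieAlgebra.IsSolvable ((LieAlgebra.radical ℝ L).comap τ) := by
      let f : (LieAlgebra.radical ℝ L).comap τ →ₗ⁅ℝ⁆ LieAlgebra.radical ℝ L :=
        { toFun := fun X => ⟨τ X.1, X.2⟩
          map_add' := fun X Y => Subtype.ext (map_add τ X.1 Y.1)
          map_smul' := fun r X => Subtype.ext (map_smul τ r X.1)
          map_lie' := fun {X Y} => Subtype.ext (LieHom.map_lie τ X.1 Y.1) }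
      refine Function.Injective.lieAlgebra_isSolvable (f := f) fun X Y h => Subtype.ext ?_
      rw [← hττ X.1, ← hττ Y.1]
      exact congrArg τ (congrArg Subtype.val h)
    intro X hX
    refine (LieAlgebra.LieIdeal.solvable_iff_le_radical ℝ L _).1 hsol (x := τ X) ?_
    rw [LieIdeal.mem_comap, hττ]
    exact hX
  have hstab : ∀ k, D k ≤ (D k).comap τ := fun k => by
    induction k with
    | zero => exact fun X hX => hrad X hX
    | succ k ih =>
      rw [hD]
      exact (LieSubmodule.mono_lie ih ih).trans (LieIdeal.comap_bracket_le τ)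
  -- For `Y` in `D k`, the element `[Y, τ[X,Y]]` is a bracket of two elements of `D k` and so
  -- vanishes. A vanishing derived term thus forces the previous one to be central.
  have hcentral : ∀ k, D (k + 1) = ⊥ → ∀ X : L, ∀ Y ∈ D k, ⁅X, Y⁆ = 0 := fun k hk X Y hY => by
    apply hzero
    have : ⁅Y, τ ⁅X, Y⁆⁆ ∈ D (k + 1) := by
      rw [hD]
      exact LieSubmodule.lie_mem_lie hY (hstab k (lie_mem_right ℝ L _ X Y hY))
    rwa [hk, LieSubmodule.mem_bot] at this
  -- Here `D (k + 1)` is central and contains `τ[X,Y]` for `X, Y` in `D k`, so `hzero` kills these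
  -- brackets. Descending, the radical is abelian, and one more use of `hcentral` makes it central.
  have hdown : ∀ k, D (k + 2) = ⊥ → D (k + 1) = ⊥ := fun k hk => by
    rw [hD, LieSubmodule.lie_eq_bot_iff]
    intro X hX Y hY
    apply hzero
    refine hcentral (k + 1) hk Y _ (hstab _ ?_)
    rw [hD]
    exact LieSubmodule.lie_mem_lie hX hY
  have h1 : D 1 = ⊥ := by
    obtain ⟨k, hk⟩ := LieAlgebra.IsSolvable.solvable (R := ℝ) (L := LieAlgebra.radical ℝ L)
    rw [LieIdeal.derivedSeries_eq_bot_iff] at hk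
    have hk' : D (k + 1) = ⊥ := by
      rw [hD]
      rw [show D k = ⊥ from hk, LieSubmodule.lie_bot]
    clear hk
    induction k with
    | zero => exact hk'
    | succ k ih => exact ih (hdown k hk')
  refine LieAlgebra.hasCentralRadical_of_radical_le ℝ L fun Y hY => ?_
  rw [LieModule.mem_maxTrivSubmodule]
  exact fun X => hcentral 0 h1 X Y hY

end CentralRadical

/-! ### The representation space with its standard inner product. -/

section RepSpace

open scoped InnerProductSpace

variable {p q m : ℕ} (ρ : R p q →ₐ[ℝ] Matrix (Fin m) (Fin m) ℝ)

instance : Module ℝ (RepSpace ρ) := inferInstanceAs (Module ℝ (Fin m → ℝ))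

instance : FiniteDimensional ℝ (RepSpace ρ) := inferInstanceAs (FiniteDimensional ℝ (Fin m → ℝ))

instance : IsScalarTower ℝ (R p q) (RepSpace ρ) where
  smul_assoc r a w := (congrArg (fun A : Matrix (Fin m) (Fin m) ℝ => A *ᵥ (w : Fin m → ℝ))
    (map_smul ρ r a)).trans (Matrix.smul_mulVec r (ρ a) (w : Fin m → ℝ))

/-- The standard inner product on the representation space. -/
@[reducible]
def RepSpace.innerCore : InnerProductSpace.Core ℝ (RepSpace ρ) where
  inner v w := dotProduct (v : Fin m → ℝ) (w : Fin m → ℝ)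
  conj_inner_symm v w := dotProduct_comm (w : Fin m → ℝ) (v : Fin m → ℝ)
  re_inner_nonneg v := show 0 ≤ dotProduct (v : Fin m → ℝ) (v : Fin m → ℝ) from
    Finset.sum_nonneg fun i _ => mul_self_nonneg ((v : Fin m → ℝ) i)
  add_left u v w := add_dotProduct (u : Fin m → ℝ) (v : Fin m → ℝ) (w : Fin m → ℝ)
  smul_left v w r := smul_dotProduct r (v : Fin m → ℝ) (w : Fin m → ℝ)
  definite _ h := dotProduct_self_eq_zero.1 h

instance : NormedAddCommGroup (RepSpace ρ) := (RepSpace.innerCore ρ).toNormedAddCommGroup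

instance : InnerProductSpace ℝ (RepSpace ρ) := InnerProductSpace.ofCore (RepSpace.innerCore ρ).toCore

variable {ρ}

theorem isSymmRep_repSpace (hρ : ∀ i, (ρ (e p q i)).IsSymm) : IsSymmRep p q (RepSpace ρ) :=
  fun i v w => by
    have key : ∀ v w : Fin m → ℝ, dotProduct (ρ (e p q i) *ᵥ v) w = dotProduct v (ρ (e p q i) *ᵥ w) :=
      fun v w => by rw [Matrix.dotProduct_mulVec, ← Matrix.mulVec_transpose, (hρ i).eq]
    exact key v w

/-- From `S² = 1` one gets `ᵗX = -S X S`, which satisfies the same condition at `S`. -/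
theorem transpose_mem_h (X : Matrix (Fin m) (Fin m) ℝ) (hX : X ∈ h ρ) :
    Xᵀ ∈ h ρ := fun i => by
  have hS : ρ (e p q i) * ρ (e p q i) = 1 := by rw [← map_mul, e_sq, map_one]
  have h1 : Xᵀ * ρ (e p q i) = -(ρ (e p q i) * X) := eq_neg_of_add_eq_zero_left (hX i)
  have h2 : Xᵀ = -(ρ (e p q i) * X * ρ (e p q i)) := by
    rw [← neg_mul, ← h1, mul_assoc, hS, mul_one]
  rw [Matrix.transpose_transpose, h2, mul_neg, mul_assoc, ← mul_assoc (ρ (e p q i)) (ρ (e p q i)), hS,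
    one_mul, add_neg_cancel]

variable (ρ) in
theorem nonempty_h_equiv_hOn :
    Nonempty (h ρ ≃ₗ⁅ℝ⁆ hOn (⊤ : Submodule (R p q) (RepSpace ρ))) := by
  let T : Matrix (Fin m) (Fin m) ℝ ≃ₐ[ℝ] Module.End ℝ (RepSpace ρ) :=
    (Matrix.toLinAlgEquiv' : Matrix (Fin m) (Fin m) ℝ ≃ₐ[ℝ] Module.End ℝ (Fin m → ℝ))
  have hmem : ∀ X, X ∈ h ρ ↔
      T X ∈ hOn (⊤ : Submodule (R p q) (RepSpace ρ)) := fun X => by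
    have key : ∀ i (v w : Fin m → ℝ), dotProduct (X *ᵥ v) (ρ (e p q i) *ᵥ w) +
        dotProduct v (ρ (e p q i) *ᵥ (X *ᵥ w)) =
          dotProduct v ((Xᵀ * ρ (e p q i) + ρ (e p q i) * X) *ᵥ w) := fun i v w => by
      rw [Matrix.add_mulVec, dotProduct_add, ← Matrix.mulVec_mulVec, ← Matrix.mulVec_mulVec,
        Matrix.dotProduct_mulVec v Xᵀ, Matrix.vecMul_transpose]
    rw [mem_hOn]
    constructor
    · intro hX
      refine ⟨fun i v w => ?_, fun w => trivial, fun w hw => ?_⟩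
      · exact (key i v w).trans (by
          rw [hX i]
          exact (congrArg _ (Matrix.zero_mulVec _)).trans (dotProduct_zero _))
      · have : w = 0 := inner_self_eq_zero.1 (hw w trivial)
        rw [this, map_zero]
    · intro hX i
      refine Matrix.ext_of_mulVec_single fun j => ?_
      rw [Matrix.zero_mulVec]
      refine dotProduct_self_eq_zero.1 ?_
      rw [← key]
      exact hX.1 i _ _
  let f : h ρ →ₗ⁅ℝ⁆ hOn (⊤ : Submodule (R p q) (RepSpace ρ)) :=
    { toFun := fun X => ⟨T X.1, (hmem X.1).1 X.2⟩
      map_add' := fun X Y => Subtype.ext (map_add T X.1 Y.1)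
      map_smul' := fun r X => Subtype.ext (map_smul T r X.1)
      map_lie' := fun {X Y} => Subtype.ext (by
        change T (X.1 * Y.1 - Y.1 * X.1) = T X.1 * T Y.1 - T Y.1 * T X.1
        rw [map_sub, map_mul, map_mul]) }
  refine ⟨LieEquiv.ofBijective f ⟨fun X Y hXY => Subtype.ext (T.injective (congrArg Subtype.val hXY)),
    fun Y => ?_⟩⟩
  obtain ⟨X, hX⟩ := T.surjective Y.1
  exact ⟨⟨X, (hmem X).2 (by rw [hX]; exact Y.2)⟩, Subtype.ext hX⟩

end RepSpace

end

section

/-! ### Matrix types of the tensor product and of its even subalgebra. -/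

section AlgebraTypes

variable {p q : ℕ}

theorem isMatrixSum_R_of_factors {s t u : ℕ} {K L N : Type} [Ring K] [Algebra ℝ K] [Ring L] [Algebra ℝ L]
    [Ring N] [Algebra ℝ N] (hp : IsMatrixSum (CliffordAlgebra (sumSq p)) s K)
    (hq : IsMatrixSum (CliffordAlgebra (sumSq q)) t L) (hKL : IsMatrixSum (L ⊗[ℝ] K) u N) (n : ℕ)
    (hn : t * (s * u) = n) : IsMatrixSum (R p q) n N :=
  hn ▸ hp.tensor hq hKL

theorem isMatrixSum_R_comm {n : ℕ} {N : Type} [Ring N] [Algebra ℝ N] (hA : IsMatrixSum (R p q) n N) :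
    IsMatrixSum (R q p) n N :=
  hA.of_equiv (Algebra.TensorProduct.comm ℝ _ _)

theorem isMatrixSum_R_one_real (hm : (p % 8 = 0 ∨ p % 8 = 2) ∧ (q % 8 = 0 ∨ q % 8 = 2) ∨
    (p % 8 = 4 ∨ p % 8 = 6) ∧ (q % 8 = 4 ∨ q % 8 = 6)) : IsMatrixSum (R p q) 1 ℝ := by
  rcases hm with ⟨hp, hq⟩ | ⟨hp, hq⟩
  · exact isMatrixSum_R_of_factors ((hasCliffordType_sumSq p).1 hp) ((hasCliffordType_sumSq q).1 hq)
      (isMatrixSum_real_tensor ℝ) 1 rfl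
  · exact isMatrixSum_R_of_factors ((hasCliffordType_sumSq p).2.2.2.1 hp)
      ((hasCliffordType_sumSq q).2.2.2.1 hq) isMatrixSum_quaternion_tensor_quaternion 1 rfl

theorem isMatrixSum_R_one_complex (hm : p % 2 = 0 ∧ (q % 8 = 3 ∨ q % 8 = 7) ∨
    (p % 8 = 3 ∨ p % 8 = 7) ∧ q % 2 = 0) : IsMatrixSum (R p q) 1 ℂ := by
  have key : ∀ {p q : ℕ}, p % 2 = 0 ∧ (q % 8 = 3 ∨ q % 8 = 7) → IsMatrixSum (R p q) 1 ℂ := by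
    rintro p q ⟨hp, hq⟩
    have hq' := (hasCliffordType_sumSq q).2.2.1 hq
    rcases (by omega : (p % 8 = 0 ∨ p % 8 = 2) ∨ (p % 8 = 4 ∨ p % 8 = 6)) with hp | hp
    · exact isMatrixSum_R_of_factors ((hasCliffordType_sumSq p).1 hp) hq' (isMatrixSum_tensor_real ℂ) 1 rfl
    · exact isMatrixSum_R_of_factors ((hasCliffordType_sumSq p).2.2.2.1 hp) hq'
        isMatrixSum_complex_tensor_quaternion 1 rfl
  rcases hm with hm | hm
  · exact key hm
  · exact isMatrixSum_R_comm (key hm.symm)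

theorem isMatrixSum_R_one_quaternion (hm : (p % 8 = 0 ∨ p % 8 = 2) ∧ (q % 8 = 4 ∨ q % 8 = 6) ∨
    (p % 8 = 4 ∨ p % 8 = 6) ∧ (q % 8 = 0 ∨ q % 8 = 2)) : IsMatrixSum (R p q) 1 (Quaternion ℝ) := by
  rcases hm with ⟨hp, hq⟩ | ⟨hp, hq⟩
  · exact isMatrixSum_R_of_factors ((hasCliffordType_sumSq p).1 hp)
      ((hasCliffordType_sumSq q).2.2.2.1 hq) (isMatrixSum_tensor_real _) 1 rfl
  · exact isMatrixSum_R_of_factors ((hasCliffordType_sumSq p).2.2.2.1 hp)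
      ((hasCliffordType_sumSq q).1 hq) (isMatrixSum_real_tensor _) 1 rfl

theorem isMatrixSum_R_two_real (hm : ((p % 8 = 0 ∨ p % 8 = 2) ∧ q % 8 = 1 ∨
    (p % 8 = 4 ∨ p % 8 = 6) ∧ q % 8 = 5) ∨ ((q % 8 = 0 ∨ q % 8 = 2) ∧ p % 8 = 1 ∨
    (q % 8 = 4 ∨ q % 8 = 6) ∧ p % 8 = 5)) : IsMatrixSum (R p q) 2 ℝ := by
  have key : ∀ {p q : ℕ}, ((p % 8 = 0 ∨ p % 8 = 2) ∧ q % 8 = 1 ∨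
      (p % 8 = 4 ∨ p % 8 = 6) ∧ q % 8 = 5) → IsMatrixSum (R p q) 2 ℝ := by
    rintro p q (⟨hp, hq⟩ | ⟨hp, hq⟩)
    · exact isMatrixSum_R_of_factors ((hasCliffordType_sumSq p).1 hp) ((hasCliffordType_sumSq q).2.1 hq)
        (isMatrixSum_tensor_real ℝ) 2 rfl
    · exact isMatrixSum_R_of_factors ((hasCliffordType_sumSq p).2.2.2.1 hp)
        ((hasCliffordType_sumSq q).2.2.2.2 hq) isMatrixSum_quaternion_tensor_quaternion 2 rfl
  rcases hm with hm | hm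
  · exact key hm
  · exact isMatrixSum_R_comm (key hm)

theorem isMatrixSum_R_two_complex (hm : p % 4 = 1 ∧ q % 4 = 3 ∨ p % 4 = 3 ∧ q % 2 = 1) :
    IsMatrixSum (R p q) 2 ℂ := by
  have key : ∀ {p q : ℕ}, p % 4 = 1 → q % 4 = 3 → IsMatrixSum (R p q) 2 ℂ := by
    intro p q hp hq
    have hq' := (hasCliffordType_sumSq q).2.2.1 (by omega)
    rcases (by omega : p % 8 = 1 ∨ p % 8 = 5) with hp | hp
    · exact isMatrixSum_R_of_factors ((hasCliffordType_sumSq p).2.1 hp) hq' (isMatrixSum_tensor_real ℂ) 2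
        rfl
    · exact isMatrixSum_R_of_factors ((hasCliffordType_sumSq p).2.2.2.2 hp) hq'
        isMatrixSum_complex_tensor_quaternion 2 rfl
  rcases hm with ⟨hp, hq⟩ | ⟨hp, hq⟩
  · exact key hp hq
  · rcases (by omega : q % 4 = 1 ∨ q % 4 = 3) with hq | hq
    · exact isMatrixSum_R_comm (key hq hp)
    · exact isMatrixSum_R_of_factors ((hasCliffordType_sumSq p).2.2.1 (by omega))
        ((hasCliffordType_sumSq q).2.2.1 (by omega)) isMatrixSum_complex_tensor_complex 2 rfl

theorem isMatrixSum_R_two_quaternion (hm : ((p % 8 = 0 ∨ p % 8 = 2) ∧ q % 8 = 5 ∨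
    (p % 8 = 4 ∨ p % 8 = 6) ∧ q % 8 = 1) ∨ ((q % 8 = 0 ∨ q % 8 = 2) ∧ p % 8 = 5 ∨
    (q % 8 = 4 ∨ q % 8 = 6) ∧ p % 8 = 1)) : IsMatrixSum (R p q) 2 (Quaternion ℝ) := by
  have key : ∀ {p q : ℕ}, ((p % 8 = 0 ∨ p % 8 = 2) ∧ q % 8 = 5 ∨
      (p % 8 = 4 ∨ p % 8 = 6) ∧ q % 8 = 1) → IsMatrixSum (R p q) 2 (Quaternion ℝ) := by
    rintro p q (⟨hp, hq⟩ | ⟨hp, hq⟩)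
    · exact isMatrixSum_R_of_factors ((hasCliffordType_sumSq p).1 hp)
        ((hasCliffordType_sumSq q).2.2.2.2 hq) (isMatrixSum_tensor_real _) 2 rfl
    · exact isMatrixSum_R_of_factors ((hasCliffordType_sumSq p).2.2.2.1 hp)
        ((hasCliffordType_sumSq q).2.1 hq) (isMatrixSum_real_tensor _) 2 rfl
  rcases hm with hm | hm
  · exact key hm
  · exact isMatrixSum_R_comm (key hm)

theorem isMatrixSum_R_four_real (hm : p % 8 = 1 ∧ q % 8 = 1 ∨ p % 8 = 5 ∧ q % 8 = 5) :
    IsMatrixSum (R p q) 4 ℝ := by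
  rcases hm with ⟨hp, hq⟩ | ⟨hp, hq⟩
  · exact isMatrixSum_R_of_factors ((hasCliffordType_sumSq p).2.1 hp) ((hasCliffordType_sumSq q).2.1 hq)
      (isMatrixSum_tensor_real ℝ) 4 rfl
  · exact isMatrixSum_R_of_factors ((hasCliffordType_sumSq p).2.2.2.2 hp)
      ((hasCliffordType_sumSq q).2.2.2.2 hq) isMatrixSum_quaternion_tensor_quaternion 4 rfl

theorem isMatrixSum_R_four_quaternion (hm : p % 8 = 1 ∧ q % 8 = 5 ∨ p % 8 = 5 ∧ q % 8 = 1) :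
    IsMatrixSum (R p q) 4 (Quaternion ℝ) := by
  rcases hm with ⟨hp, hq⟩ | ⟨hp, hq⟩
  · exact isMatrixSum_R_of_factors ((hasCliffordType_sumSq p).2.1 hp)
      ((hasCliffordType_sumSq q).2.2.2.2 hq) (isMatrixSum_tensor_real _) 4 rfl
  · exact isMatrixSum_R_of_factors ((hasCliffordType_sumSq p).2.2.2.2 hp)
      ((hasCliffordType_sumSq q).2.1 hq) (isMatrixSum_real_tensor _) 4 rfl

/-- The coefficient 7 writes the index `q - p + 1` modulo 8 without subtraction. -/
theorem hasCliffordType_Rplus (hpq : 1 ≤ p + q) : HasCliffordType (Rplus p q) (q + 1 + 7 * p) :=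
  hasCliffordType_even hpq (by omega)

end AlgebraTypes

/-! ### The rows of the table. -/

section Table

variable {p q m : ℕ}

theorem exists_isOddCentral_one (hm : p % 4 = 1 ∨ q % 4 = 1) : ∃ z : R p q, IsOddCentral z 1 := by
  rcases hm with hm | hm
  · exact ⟨_, isOddCentral_volL (by omega) (by rw [volSign, if_pos (by omega)])⟩
  · exact ⟨_, isOddCentral_volR (by omega) (by rw [volSign, if_pos (by omega)])⟩

theorem exists_isOddCentral_neg_one (hm : p % 4 = 3 ∨ q % 4 = 3) : ∃ z : R p q, IsOddCentral z (-1) := by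
  rcases hm with hm | hm
  · exact ⟨_, isOddCentral_volL (by omega) (by rw [volSign, if_neg (by omega)])⟩
  · exact ⟨_, isOddCentral_volR (by omega) (by rw [volSign, if_neg (by omega)])⟩

variable (hpq : 1 ≤ p + q)

include hpq in
theorem exists_isEvenAnticentral_one (hm : p % 2 = 0 ∧ p % 4 = q % 4) :
    ∃ ω : R p q, IsEvenAnticentral ω 1 :=
  ⟨_, isEvenAnticentral_volL_mul_volR hpq hm.1 (by omega) (by
    rw [show volSign q = volSign p by rw [volSign, volSign, hm.2], volSign_mul_self])⟩

include hpq in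
theorem exists_isEvenAnticentral_neg_one (hm : p % 4 = 0 ∧ q % 4 = 2 ∨ p % 4 = 2 ∧ q % 4 = 0) :
    ∃ ω : R p q, IsEvenAnticentral ω (-1) :=
  ⟨_, isEvenAnticentral_volL_mul_volR hpq (by omega) (by omega) (by
    rcases hm with ⟨hp, hq⟩ | ⟨hp, hq⟩ <;> rw [volSign, volSign, hp, hq] <;> norm_num)⟩

variable {ρ : R p q →ₐ[ℝ] Matrix (Fin m) (Fin m) ℝ}

theorem nonempty_h_equiv {g : Type} [LieRing g] [LieAlgebra ℝ g]
    (hg : Nonempty (hOn (⊤ : Submodule (R p q) (RepSpace ρ)) ≃ₗ⁅ℝ⁆ g)) : Nonempty (h ρ ≃ₗ⁅ℝ⁆ g) := by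
  obtain ⟨F⟩ := nonempty_h_equiv_hOn ρ
  obtain ⟨G⟩ := hg
  exact ⟨F.trans G⟩

variable (hρ : ∀ i, (ρ (e p q i)).IsSymm)
include hpq hρ

/-- Both numbers are even and differ by 2 modulo 4, so exactly one volume element has square `-1`
and `ω² = -1`. -/
theorem table_soC (hm : s(p % 8, q % 8) ∈ ({s(0, 2), s(4, 6)} : Set (Sym2 ℕ))) :
    AlgType p q 1 ℝ 1 ℂ ∧ HasIrreps p q 1 ∧
      ∀ V : Fin 1 → ModuleCat.{0} (R p q), IsIrrepList V →
        Nonempty (h ρ ≃ₗ⁅ℝ⁆ soC (mult (V 0) ρ)) := by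
  simp only [Set.mem_insert_iff, Set.mem_singleton_iff, Sym2.eq_iff] at hm
  have hA : IsMatrixSum (R p q) 1 ℝ := isMatrixSum_R_one_real (by omega)
  obtain ⟨ω, hω⟩ := exists_isEvenAnticentral_neg_one hpq (by omega)
  exact ⟨⟨hA, (hasCliffordType_Rplus hpq).2.2.1 (by omega)⟩, hA.exists_irreps, fun V hV =>
    nonempty_h_equiv (hOn_equiv_soC hpq (isSymmRep_repSpace hρ) hV hω hA)⟩

theorem table_spR (hm : s(p % 8, q % 8) ∈ ({s(0, 7), s(2, 3), s(3, 4), s(6, 7)} : Set (Sym2 ℕ))) :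
    AlgType p q 1 ℂ 1 ℝ ∧ HasIrreps p q 1 ∧
      ∀ V : Fin 1 → ModuleCat.{0} (R p q), IsIrrepList V →
        Nonempty (h ρ ≃ₗ⁅ℝ⁆ spR (mult (V 0) ρ)) := by
  simp only [Set.mem_insert_iff, Set.mem_singleton_iff, Sym2.eq_iff] at hm
  have hA : IsMatrixSum (R p q) 1 ℂ := isMatrixSum_R_one_complex (by omega)
  have hA' : IsMatrixSum (Rplus p q) 1 ℝ := (hasCliffordType_Rplus hpq).1 (by omega)
  have := hA.isSemisimpleRing
  obtain ⟨z, hz⟩ := exists_isOddCentral_neg_one (p := p) (q := q) (by omega)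
  exact ⟨⟨hA, hA'⟩, hA.exists_irreps, fun V hV =>
    nonempty_h_equiv (hOn_top_equiv_spR hpq (isSymmRep_repSpace hρ) hz hA' hV)⟩

theorem table_soStar (hm : s(p % 8, q % 8) ∈ ({s(0, 3), s(2, 7), s(3, 6), s(4, 7)} : Set (Sym2 ℕ))) :
    AlgType p q 1 ℂ 1 (Quaternion ℝ) ∧ HasIrreps p q 1 ∧
      ∀ V : Fin 1 → ModuleCat.{0} (R p q), IsIrrepList V →
        Nonempty (h ρ ≃ₗ⁅ℝ⁆ soStar (mult (V 0) ρ)) := by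
  simp only [Set.mem_insert_iff, Set.mem_singleton_iff, Sym2.eq_iff] at hm
  have hA : IsMatrixSum (R p q) 1 ℂ := isMatrixSum_R_one_complex (by omega)
  have hA' : IsMatrixSum (Rplus p q) 1 (Quaternion ℝ) := (hasCliffordType_Rplus hpq).2.2.2.1 (by omega)
  have := hA.isSemisimpleRing
  obtain ⟨z, hz⟩ := exists_isOddCentral_neg_one (p := p) (q := q) (by omega)
  exact ⟨⟨hA, hA'⟩, hA.exists_irreps, fun V hV =>
    nonempty_h_equiv (hOn_top_equiv_soStar hpq (isSymmRep_repSpace hρ) hz hA' hV)⟩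

theorem table_spC (hm : s(p % 8, q % 8) ∈ ({s(0, 6), s(2, 4)} : Set (Sym2 ℕ))) :
    AlgType p q 1 (Quaternion ℝ) 1 ℂ ∧ HasIrreps p q 1 ∧
      ∀ V : Fin 1 → ModuleCat.{0} (R p q), IsIrrepList V →
        Nonempty (h ρ ≃ₗ⁅ℝ⁆ spC (mult (V 0) ρ)) := by
  simp only [Set.mem_insert_iff, Set.mem_singleton_iff, Sym2.eq_iff] at hm
  have hA : IsMatrixSum (R p q) 1 (Quaternion ℝ) := isMatrixSum_R_one_quaternion (by omega)
  obtain ⟨ω, hω⟩ := exists_isEvenAnticentral_neg_one hpq (by omega)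
  exact ⟨⟨hA, (hasCliffordType_Rplus hpq).2.2.1 (by omega)⟩, hA.exists_irreps, fun V hV =>
    nonempty_h_equiv (hOn_equiv_spC hpq (isSymmRep_repSpace hρ) hV hω hA)⟩

theorem table_gl_real (hm : s(p % 8, q % 8) ∈ ({s(0, 0), s(2, 2), s(4, 4), s(6, 6)} : Set (Sym2 ℕ))) :
    AlgType p q 1 ℝ 2 ℝ ∧ HasIrreps p q 1 ∧
      ∀ V : Fin 1 → ModuleCat.{0} (R p q), IsIrrepList V →
        Nonempty (h ρ ≃ₗ⁅ℝ⁆ gl (mult (V 0) ρ) ℝ) := by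
  simp only [Set.mem_insert_iff, Set.mem_singleton_iff, Sym2.eq_iff] at hm
  have hA : IsMatrixSum (R p q) 1 ℝ := isMatrixSum_R_one_real (by omega)
  obtain ⟨ω, hω⟩ := exists_isEvenAnticentral_one hpq (by omega)
  exact ⟨⟨hA, (hasCliffordType_Rplus hpq).2.1 (by omega)⟩, hA.exists_irreps, fun V hV =>
    nonempty_h_equiv (hOn_equiv_gl hpq (isSymmRep_repSpace hρ) hV hω hasRealNorm_real hA)⟩

theorem table_gl_quaternion (hm : s(p % 8, q % 8) ∈ ({s(0, 4), s(2, 6)} : Set (Sym2 ℕ))) :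
    AlgType p q 1 (Quaternion ℝ) 2 (Quaternion ℝ) ∧ HasIrreps p q 1 ∧
      ∀ V : Fin 1 → ModuleCat.{0} (R p q), IsIrrepList V →
        Nonempty (h ρ ≃ₗ⁅ℝ⁆ gl (mult (V 0) ρ) (Quaternion ℝ)) := by
  simp only [Set.mem_insert_iff, Set.mem_singleton_iff, Sym2.eq_iff] at hm
  have hA : IsMatrixSum (R p q) 1 (Quaternion ℝ) := isMatrixSum_R_one_quaternion (by omega)
  obtain ⟨ω, hω⟩ := exists_isEvenAnticentral_one hpq (by omega)
  exact ⟨⟨hA, (hasCliffordType_Rplus hpq).2.2.2.2 (by omega)⟩, hA.exists_irreps, fun V hV =>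
    nonempty_h_equiv (hOn_equiv_gl hpq (isSymmRep_repSpace hρ) hV hω hasRealNorm_quaternion hA)⟩

theorem table_so (hm : s(p % 8, q % 8) ∈ ({s(0, 1), s(1, 2), s(4, 5), s(5, 6)} : Set (Sym2 ℕ))) :
    AlgType p q 2 ℝ 1 ℝ ∧ HasIrreps p q 2 ∧
      ∀ V : Fin 2 → ModuleCat.{0} (R p q), IsIrrepList V →
        Nonempty (h ρ ≃ₗ⁅ℝ⁆ so (mult (V 0) ρ) (mult (V 1) ρ)) := by
  simp only [Set.mem_insert_iff, Set.mem_singleton_iff, Sym2.eq_iff] at hm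
  have hA : IsMatrixSum (R p q) 2 ℝ := isMatrixSum_R_two_real (by omega)
  have hA' : IsMatrixSum (Rplus p q) 1 ℝ := (hasCliffordType_Rplus hpq).1 (by omega)
  have := hA.isSemisimpleRing
  obtain ⟨z, hz⟩ := exists_isOddCentral_one (p := p) (q := q) (by omega)
  refine ⟨⟨hA, hA'⟩, hA.exists_irreps, fun V hV => ?_⟩
  rw [← skewHerm_diagSign_real]
  exact nonempty_h_equiv (hOn_equiv_of_two hpq (isSymmRep_repSpace hρ) hz hasRealNorm_real hA' hV)

/-- Although both numbers are odd, the product of the volume elements has square `-1` and gives no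
splitting; the factor congruent to 1 modulo 4 supplies the central element of square `1`. -/
theorem table_u (hm : s(p % 8, q % 8) ∈ ({s(1, 3), s(1, 7), s(3, 5), s(5, 7)} : Set (Sym2 ℕ))) :
    AlgType p q 2 ℂ 1 ℂ ∧ HasIrreps p q 2 ∧
      ∀ V : Fin 2 → ModuleCat.{0} (R p q), IsIrrepList V →
        Nonempty (h ρ ≃ₗ⁅ℝ⁆ u (mult (V 0) ρ) (mult (V 1) ρ)) := by
  simp only [Set.mem_insert_iff, Set.mem_singleton_iff, Sym2.eq_iff] at hm
  have hA : IsMatrixSum (R p q) 2 ℂ := isMatrixSum_R_two_complex (by omega)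
  have hA' : IsMatrixSum (Rplus p q) 1 ℂ := (hasCliffordType_Rplus hpq).2.2.1 (by omega)
  have := hA.isSemisimpleRing
  obtain ⟨z, hz⟩ := exists_isOddCentral_one (p := p) (q := q) (by omega)
  exact ⟨⟨hA, hA'⟩, hA.exists_irreps, fun V hV =>
    nonempty_h_equiv (hOn_equiv_of_two hpq (isSymmRep_repSpace hρ) hz hasRealNorm_complex hA' hV)⟩

theorem table_sp (hm : s(p % 8, q % 8) ∈ ({s(0, 5), s(1, 4), s(1, 6), s(2, 5)} : Set (Sym2 ℕ))) :
    AlgType p q 2 (Quaternion ℝ) 1 (Quaternion ℝ) ∧ HasIrreps p q 2 ∧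
      ∀ V : Fin 2 → ModuleCat.{0} (R p q), IsIrrepList V →
        Nonempty (h ρ ≃ₗ⁅ℝ⁆ sp (mult (V 0) ρ) (mult (V 1) ρ)) := by
  simp only [Set.mem_insert_iff, Set.mem_singleton_iff, Sym2.eq_iff] at hm
  have hA : IsMatrixSum (R p q) 2 (Quaternion ℝ) := isMatrixSum_R_two_quaternion (by omega)
  have hA' : IsMatrixSum (Rplus p q) 1 (Quaternion ℝ) := (hasCliffordType_Rplus hpq).2.2.2.1 (by omega)
  have := hA.isSemisimpleRing
  obtain ⟨z, hz⟩ := exists_isOddCentral_one (p := p) (q := q) (by omega)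
  exact ⟨⟨hA, hA'⟩, hA.exists_irreps, fun V hV =>
    nonempty_h_equiv (hOn_equiv_of_two hpq (isSymmRep_repSpace hρ) hz hasRealNorm_quaternion hA' hV)⟩

/-- Both numbers are congruent to 3 modulo 4: each volume element has square `-1` and yields a
symplectic form, while their product has square `1` and separates the two representations. -/
theorem table_spR_prod (hm : s(p % 8, q % 8) ∈ ({s(3, 3), s(7, 7)} : Set (Sym2 ℕ))) :
    AlgType p q 2 ℂ 2 ℝ ∧ HasIrreps p q 2 ∧
      ∀ V : Fin 2 → ModuleCat.{0} (R p q), IsIrrepList V →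
        Nonempty (h ρ ≃ₗ⁅ℝ⁆ (spR (mult (V 0) ρ) × spR (mult (V 1) ρ))) := by
  simp only [Set.mem_insert_iff, Set.mem_singleton_iff, Sym2.eq_iff] at hm
  have hA : IsMatrixSum (R p q) 2 ℂ := isMatrixSum_R_two_complex (by omega)
  have hA' : IsMatrixSum (Rplus p q) 2 ℝ := (hasCliffordType_Rplus hpq).2.1 (by omega)
  have := hA.isSemisimpleRing
  obtain ⟨z, hz⟩ := exists_isOddCentral_neg_one (p := p) (q := q) (by omega)
  exact ⟨⟨hA, hA'⟩, hA.exists_irreps, fun V hV =>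
    nonempty_h_equiv (hOn_equiv_prod_of_two hpq (isSymmRep_repSpace hρ)
      (isEvenCentral_volL_mul_volR hpq (by omega) (by omega)) hV (g := fun n => spR n)
      fun P n hP hn => hOn_equiv_spR hpq (isSymmRep_repSpace hρ) hz hA' hP hn)⟩

theorem table_soStar_prod (hm : s(p % 8, q % 8) ∈ ({s(3, 7)} : Set (Sym2 ℕ))) :
    AlgType p q 2 ℂ 2 (Quaternion ℝ) ∧ HasIrreps p q 2 ∧
      ∀ V : Fin 2 → ModuleCat.{0} (R p q), IsIrrepList V →
        Nonempty (h ρ ≃ₗ⁅ℝ⁆ (soStar (mult (V 0) ρ) × soStar (mult (V 1) ρ))) := by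
  simp only [Set.mem_singleton_iff, Sym2.eq_iff] at hm
  have hA : IsMatrixSum (R p q) 2 ℂ := isMatrixSum_R_two_complex (by omega)
  have hA' : IsMatrixSum (Rplus p q) 2 (Quaternion ℝ) := (hasCliffordType_Rplus hpq).2.2.2.2 (by omega)
  have := hA.isSemisimpleRing
  obtain ⟨z, hz⟩ := exists_isOddCentral_neg_one (p := p) (q := q) (by omega)
  exact ⟨⟨hA, hA'⟩, hA.exists_irreps, fun V hV =>
    nonempty_h_equiv (hOn_equiv_prod_of_two hpq (isSymmRep_repSpace hρ)
      (isEvenCentral_volL_mul_volR hpq (by omega) (by omega)) hV (g := fun n => soStar n)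
      fun P n hP hn => hOn_equiv_soStar hpq (isSymmRep_repSpace hρ) hz hA' hP hn)⟩

theorem table_so_prod (hm : s(p % 8, q % 8) ∈ ({s(1, 1), s(5, 5)} : Set (Sym2 ℕ))) :
    AlgType p q 4 ℝ 2 ℝ ∧ HasPairedIrreps p q ∧
      ∀ V : Fin 4 → ModuleCat.{0} (R p q), IsIrrepList V → IsPaired V →
        Nonempty (h ρ ≃ₗ⁅ℝ⁆
          (so (mult (V 0) ρ) (mult (V 1) ρ) × so (mult (V 2) ρ) (mult (V 3) ρ))) := by
  simp only [Set.mem_insert_iff, Set.mem_singleton_iff, Sym2.eq_iff] at hm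
  have hA : IsMatrixSum (R p q) 4 ℝ := isMatrixSum_R_four_real (by omega)
  have hA' : IsMatrixSum (Rplus p q) 2 ℝ := (hasCliffordType_Rplus hpq).2.1 (by omega)
  have := hA.isSemisimpleRing
  obtain ⟨z, hz⟩ := exists_isOddCentral_one (p := p) (q := q) (by omega)
  have hc := isEvenCentral_volL_mul_volR hpq (p := p) (q := q) (by omega) (by omega)
  refine ⟨⟨hA, hA'⟩, hasPairedIrreps hpq hz hc hA hA', fun V hV hP => ?_⟩
  rw [← skewHerm_diagSign_real, ← skewHerm_diagSign_real]
  exact nonempty_h_equiv (hOn_equiv_of_four hpq (isSymmRep_repSpace hρ) hz hc hasRealNorm_real hA' hV hP)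

theorem table_sp_prod (hm : s(p % 8, q % 8) ∈ ({s(1, 5)} : Set (Sym2 ℕ))) :
    AlgType p q 4 (Quaternion ℝ) 2 (Quaternion ℝ) ∧ HasPairedIrreps p q ∧
      ∀ V : Fin 4 → ModuleCat.{0} (R p q), IsIrrepList V → IsPaired V →
        Nonempty (h ρ ≃ₗ⁅ℝ⁆
          (sp (mult (V 0) ρ) (mult (V 1) ρ) × sp (mult (V 2) ρ) (mult (V 3) ρ))) := by
  simp only [Set.mem_singleton_iff, Sym2.eq_iff] at hm
  have hA : IsMatrixSum (R p q) 4 (Quaternion ℝ) := isMatrixSum_R_four_quaternion (by omega)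
  have hA' : IsMatrixSum (Rplus p q) 2 (Quaternion ℝ) := (hasCliffordType_Rplus hpq).2.2.2.2 (by omega)
  have := hA.isSemisimpleRing
  obtain ⟨z, hz⟩ := exists_isOddCentral_one (p := p) (q := q) (by omega)
  have hc := isEvenCentral_volL_mul_volR hpq (p := p) (q := q) (by omega) (by omega)
  exact ⟨⟨hA, hA'⟩, hasPairedIrreps hpq hz hc hA hA', fun V hV hP =>
    nonempty_h_equiv
      (hOn_equiv_of_four hpq (isSymmRep_repSpace hρ) hz hc hasRealNorm_quaternion hA' hV hP)⟩

end Table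

end

end CliffordQuartic

end

open CliffordQuartic in
theorem theorem3p4 (p q m : ℕ) (hpq : 1 ≤ p + q)
    (ρ : R p q →ₐ[ℝ] Matrix (Fin m) (Fin m) ℝ) (hρ : ∀ i, (ρ (e p q i)).IsSymm) :
    LieAlgebra.HasCentralRadical ℝ (h ρ) ∧
    -- one irreducible representation; `R_{p,q}^+` simple
    (s(p % 8, q % 8) ∈ ({s(0, 2), s(4, 6)} : Set (Sym2 ℕ)) →
      AlgType p q 1 ℝ 1 ℂ ∧ HasIrreps p q 1 ∧
      ∀ V : Fin 1 → ModuleCat.{0} (R p q), IsIrrepList V →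
        Nonempty (h ρ ≃ₗ⁅ℝ⁆ soC (mult (V 0) ρ))) ∧
    (s(p % 8, q % 8) ∈ ({s(0, 7), s(2, 3), s(3, 4), s(6, 7)} : Set (Sym2 ℕ)) →
      AlgType p q 1 ℂ 1 ℝ ∧ HasIrreps p q 1 ∧
      ∀ V : Fin 1 → ModuleCat.{0} (R p q), IsIrrepList V →
        Nonempty (h ρ ≃ₗ⁅ℝ⁆ spR (mult (V 0) ρ))) ∧
    (s(p % 8, q % 8) ∈ ({s(0, 3), s(2, 7), s(3, 6), s(4, 7)} : Set (Sym2 ℕ)) →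
      AlgType p q 1 ℂ 1 (Quaternion ℝ) ∧ HasIrreps p q 1 ∧
      ∀ V : Fin 1 → ModuleCat.{0} (R p q), IsIrrepList V →
        Nonempty (h ρ ≃ₗ⁅ℝ⁆ soStar (mult (V 0) ρ))) ∧
    (s(p % 8, q % 8) ∈ ({s(0, 6), s(2, 4)} : Set (Sym2 ℕ)) →
      AlgType p q 1 (Quaternion ℝ) 1 ℂ ∧ HasIrreps p q 1 ∧
      ∀ V : Fin 1 → ModuleCat.{0} (R p q), IsIrrepList V →
        Nonempty (h ρ ≃ₗ⁅ℝ⁆ spC (mult (V 0) ρ))) ∧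
    -- one irreducible representation; `R_{p,q}^+` a sum of two simple algebras
    (s(p % 8, q % 8) ∈ ({s(0, 0), s(2, 2), s(4, 4), s(6, 6)} : Set (Sym2 ℕ)) →
      AlgType p q 1 ℝ 2 ℝ ∧ HasIrreps p q 1 ∧
      ∀ V : Fin 1 → ModuleCat.{0} (R p q), IsIrrepList V →
        Nonempty (h ρ ≃ₗ⁅ℝ⁆ gl (mult (V 0) ρ) ℝ)) ∧
    (s(p % 8, q % 8) ∈ ({s(0, 4), s(2, 6)} : Set (Sym2 ℕ)) →
      AlgType p q 1 (Quaternion ℝ) 2 (Quaternion ℝ) ∧ HasIrreps p q 1 ∧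
      ∀ V : Fin 1 → ModuleCat.{0} (R p q), IsIrrepList V →
        Nonempty (h ρ ≃ₗ⁅ℝ⁆ gl (mult (V 0) ρ) (Quaternion ℝ))) ∧
    -- two irreducible representations; `R_{p,q}^+` simple
    (s(p % 8, q % 8) ∈ ({s(0, 1), s(1, 2), s(4, 5), s(5, 6)} : Set (Sym2 ℕ)) →
      AlgType p q 2 ℝ 1 ℝ ∧ HasIrreps p q 2 ∧
      ∀ V : Fin 2 → ModuleCat.{0} (R p q), IsIrrepList V →
        Nonempty (h ρ ≃ₗ⁅ℝ⁆ so (mult (V 0) ρ) (mult (V 1) ρ))) ∧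
    (s(p % 8, q % 8) ∈ ({s(1, 3), s(1, 7), s(3, 5), s(5, 7)} : Set (Sym2 ℕ)) →
      AlgType p q 2 ℂ 1 ℂ ∧ HasIrreps p q 2 ∧
      ∀ V : Fin 2 → ModuleCat.{0} (R p q), IsIrrepList V →
        Nonempty (h ρ ≃ₗ⁅ℝ⁆ u (mult (V 0) ρ) (mult (V 1) ρ))) ∧
    (s(p % 8, q % 8) ∈ ({s(0, 5), s(1, 4), s(1, 6), s(2, 5)} : Set (Sym2 ℕ)) →
      AlgType p q 2 (Quaternion ℝ) 1 (Quaternion ℝ) ∧ HasIrreps p q 2 ∧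
      ∀ V : Fin 2 → ModuleCat.{0} (R p q), IsIrrepList V →
        Nonempty (h ρ ≃ₗ⁅ℝ⁆ sp (mult (V 0) ρ) (mult (V 1) ρ))) ∧
    -- two irreducible representations; `R_{p,q}^+` a sum of two simple algebras
    (s(p % 8, q % 8) ∈ ({s(3, 3), s(7, 7)} : Set (Sym2 ℕ)) →
      AlgType p q 2 ℂ 2 ℝ ∧ HasIrreps p q 2 ∧
      ∀ V : Fin 2 → ModuleCat.{0} (R p q), IsIrrepList V →
        Nonempty (h ρ ≃ₗ⁅ℝ⁆ (spR (mult (V 0) ρ) × spR (mult (V 1) ρ)))) ∧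
    (s(p % 8, q % 8) ∈ ({s(3, 7)} : Set (Sym2 ℕ)) →
      AlgType p q 2 ℂ 2 (Quaternion ℝ) ∧ HasIrreps p q 2 ∧
      ∀ V : Fin 2 → ModuleCat.{0} (R p q), IsIrrepList V →
        Nonempty (h ρ ≃ₗ⁅ℝ⁆ (soStar (mult (V 0) ρ) × soStar (mult (V 1) ρ)))) ∧
    -- four irreducible representations; `R_{p,q}^+` a sum of two simple algebras
    (s(p % 8, q % 8) ∈ ({s(1, 1), s(5, 5)} : Set (Sym2 ℕ)) →
      AlgType p q 4 ℝ 2 ℝ ∧ HasPairedIrreps p q ∧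
      ∀ V : Fin 4 → ModuleCat.{0} (R p q), IsIrrepList V → IsPaired V →
        Nonempty (h ρ ≃ₗ⁅ℝ⁆
          (so (mult (V 0) ρ) (mult (V 1) ρ) × so (mult (V 2) ρ) (mult (V 3) ρ)))) ∧
    (s(p % 8, q % 8) ∈ ({s(1, 5)} : Set (Sym2 ℕ)) →
      AlgType p q 4 (Quaternion ℝ) 2 (Quaternion ℝ) ∧ HasPairedIrreps p q ∧
      ∀ V : Fin 4 → ModuleCat.{0} (R p q), IsIrrepList V → IsPaired V →
        Nonempty (h ρ ≃ₗ⁅ℝ⁆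
          (sp (mult (V 0) ρ) (mult (V 1) ρ) × sp (mult (V 2) ρ) (mult (V 3) ρ)))) :=
  ⟨hasCentralRadical_of_transpose_mem _ transpose_mem_h, table_soC hpq hρ, table_spR hpq hρ,
    table_soStar hpq hρ, table_spC hpq hρ, table_gl_real hpq hρ, table_gl_quaternion hpq hρ,
    table_so hpq hρ, table_u hpq hρ, table_sp hpq hρ, table_spR_prod hpq hρ, table_soStar_prod hpq hρ,
    table_so_prod hpq hρ, table_sp_prod hpq hρ⟩
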